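/- **Setting.** Let $D_3=\{(x,y,z)\in\mathbb Z^3: x+y+z\text{ even}\}$ and let $D_3^*=\mathbb Z^3\cup(\mathbb Z^3+(\tfrac12,\tfrac12,\tfrac12))$ be the body-centred cubic lattice, the union of the four cosets $[k]=\{(x,y,z)\in D_3^*: x+y+z\equiv k/2 \pmod 2\}$, $k=0,1,2,3$, of $D_3$. Every Delaunay cell of $D_3^*$ is a tetrahedron with one vertex in each coset; its *sign* is the orientation of its vertices taken in the order of the colours $0,1,2,3$. An isometry $g$ of $\mathbb R^3$ *induces* the signed permutation $\pm\pi$ if it maps $[k]$ onto $[\pi(k)]$ for all $k$, and fixes (sign $+$) or changes (sign $-$) the signs of all Delaunay tetrahedra. The following names denote subgroups of the dihedral group of order 8 of permutations of $\{0,1,2,3\}$: $8^\circ=\langle(0123),(13)\rangle$, $4^-=\langle(13),(02)\rangle$, $4^\circ=\langle(0123)\rangle$, $4^+=\langle(01)(23),(03)(12)\rangle$, $2^-=\langle(13)\rangle$, $2^\circ=\langle(02)(13)\rangle$, $2^+=\langle(01)(23)\rangle$, $1^\circ=1$. For each such name $N$, the *full groups* $N$ and $N{:}2$ consist of all isometries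 that induce $+\pi$ with $\pi\in N$, respectively $\pm\pi$ with $\pi\in N$. For each of the 11 pairs $H=N^i$, $G=2N^j$ of such subgroups, $H$ of index 2 in $G$, given by $8^{-\circ}:(4^-,8^\circ)$, $8^{\circ\circ}:(4^\circ,8^\circ)$, $8^{+\circ}:(4^+,8^\circ)$, $4^{--}:(2^-,4^-)$, $4^{\circ-}:(2^\circ,4^-)$, $4^{\circ\circ}:(2^\circ,4^\circ)$, $4^{\circ+}:(2^\circ,4^+)$, $4^{++}:(2^+,4^+)$, $2^{\circ-}:(1^\circ,2^-)$, $2^{\circ\circ}:(1^\circ,2^\circ)$, $2^{\circ+}:(1^\circ,2^+)$, the full group $2N^{ij}$ consists of all isometries that induce $+\pi$ with $\pi\in H$ or $-\pi$ with $\pi\in G\setminus H$. Let $\mathcal L$ be the set of lines through the points of $D_3^*$ such that $(x,y,z)\in D_3^*$ lies on a line of $\mathcal L$ in direction $(1,1,1)$, $(-1,1,1)$, $(1,-1,1)$ or $(1,1,-1)$ according as (congruences mod 2) $x\equiv y\equiv z$, $y\not\equiv z\equiv x$, $z\not\equiv x\equiv y$ or $x\not\equiv y\equiv z$ if $x,y,z$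 are integers, and according as $x\equiv y\equiv z$, $z\not\equiv x\equiv y$, $x\not\equiv y\equiv z$ or $y\not\equiv z\equiv x$ if they are not. For each of the 8 names $N$, the *quarter group* $N/4$ consists of all isometries that preserve $D_3^*$ and $\mathcal L$ and induce a permutation $\pi\in N$ of the four cosets. This gives $8+8+11+8=35$ names of groups. The *odd subgroup* of a group of isometries is the subgroup generated by its elements of order 3. Let $T_1$ be the odd subgroup of the group of all isometries preserving $D_3^*$, and $T_2$ the odd subgroup of the group of all isometries preserving $D_3^*$ and $\mathcal L$. For two of the 35 names write $A\subset B$ if some isometric conjugate of $A$ is contained in $B$; an inclusion $A\subset B$ is *minimal* if $A\ne B$ and $A\subset C\subset B$ holds only for $C=A$ and $C=B$. **Statement.** 1. Each of the 35 groups is an irreducible space group (a discrete cocompact group of isometries of $\mathbb R^3$ that preserves no direction up to sign) with odd subgroup $T_1$ or $T_2$; no two of them are conjugate under an affine map; and every group of isometries of $\mathbb R^3$ with odd subgroup $T_1$ or $T_2$ is conjugate to one of them by an isometry. 2. There are exactly 83 minimal inclusions among the 35 groups, namely the following $8\cdot2+11\cdot5+12$: - for each of the 8 names $G$, the two inclusions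 $G/4\subset G\subset G{:}2$ (16 inclusions); here $G/4$ has index 4 in $G$, which has index 2 in $G{:}2$; - for each of the 11 pairs $H=N^i$, $G=2N^j$ above, the five inclusions $H/4\subset G/4$, $H\subset G$, $H{:}2\subset G{:}2$, $N^i\subset 2N^{ij}$, $2N^{ij}\subset 2N^j{:}2$ (55 inclusions), all of index 2; - the 12 inclusions, all of index 2: $4^{\circ-}\subset 8^{\circ\circ}$, $4^{\circ-}\subset 8^{+\circ}$, $4^{\circ\circ}\subset 8^{-\circ}$, $4^{\circ\circ}\subset 8^{+\circ}$, $4^{\circ+}\subset 8^{-\circ}$, $4^{\circ+}\subset 8^{\circ\circ}$, $2^{\circ-}\subset 4^{--}$, $2^{\circ-}\subset 4^{\circ-}$, $2^{\circ\circ}\subset 4^{--}$, $2^{\circ\circ}\subset 4^{++}$, $2^{\circ+}\subset 4^{\circ+}$, $2^{\circ+}\subset 4^{++}$. In the first two families the inclusions hold literally for the groups as defined above. 3. The group $2^+/4$ has two enantiomorphous forms: the quarter groups obtained from $\{1,(01)(23)\}$ and from $\{1,(03)(12)\}$ are conjugate by an isometry, but not by any orientation-preserving affine map. -/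

import Mathlib

/-! ### Groups of isometries of Euclidean 3-space -/

/-- Euclidean 3-space. -/
abbrev E3 : Type := EuclideanSpace ℝ (Fin 3)

/-- The group of isometries of Euclidean 3-space (every isometry is affine). -/
abbrev Isom3 : Type := E3 ≃ᵃⁱ[ℝ] E3

/-- Crystallographic (space) group: a discrete cocompact group of isometries. -/
def IsSpaceGroup (G : Subgroup Isom3) : Prop :=
  (∀ K : Set E3, IsCompact K → ∀ x : E3, {g : Isom3 | g ∈ G ∧ g x ∈ K}.Finite) ∧
    ∃ K : Set E3, IsCompact K ∧ ∀ x : E3, ∃ g ∈ G, ∃ y ∈ K, g y = x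

/-- A group is irreducible if there is no direction that it preserves up to sign. -/
def IsIrreducibleGroup (G : Subgroup Isom3) : Prop :=
  ¬ ∃ v : E3, v ≠ 0 ∧ ∀ g ∈ G, g.linearIsometryEquiv v = v ∨ g.linearIsometryEquiv v = -v

/-- The odd subgroup: the subgroup generated by the elements of order 3. -/
noncomputable def oddSubgroup (G : Subgroup Isom3) : Subgroup Isom3 :=
  Subgroup.closure {g : Isom3 | g ∈ G ∧ orderOf g = 3}

/-- The conjugate `g G g⁻¹`. -/
noncomputable def conjGroup (g : Isom3) (G : Subgroup Isom3) : Subgroup Isom3 :=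
  G.map (MulAut.conj g).toMonoidHom

/-- Conjugation by the affine map `φ` carries `G` onto `H`. -/
def AffineConjugates (φ : E3 ≃ᵃ[ℝ] E3) (G H : Subgroup Isom3) : Prop :=
  (∀ g ∈ G, ∃ h ∈ H, ∀ x : E3, h (φ x) = φ (g x)) ∧
    (∀ h ∈ H, ∃ g ∈ G, ∀ x : E3, h (φ x) = φ (g x))

/-! ### The body-centred cubic lattice, its four cosets and its Delaunay tetrahedra -/

/-- All three coordinates are integers. -/
def IsIntPoint (p : E3) : Prop := ∀ i, ∃ n : ℤ, p i = n

/-- All three coordinates are integers plus one half. -/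
def IsHalfPoint (p : E3) : Prop := ∀ i, ∃ n : ℤ, p i = n + 1 / 2

/-- The body-centred cubic lattice `D₃*`. -/
def bcc : Set E3 := {p | IsIntPoint p ∨ IsHalfPoint p}

/-- The coset `[k]` of `D₃` in `D₃*`: the points with `x + y + z ≡ k / 2 (mod 2)`. -/
def bccCoset (k : Fin 4) : Set E3 :=
  {p | p ∈ bcc ∧ ∃ m : ℤ, p 0 + p 1 + p 2 = ((k : ℕ) : ℝ) / 2 + 2 * m}

/-- `p 0, …, p 3` are the vertices of a Delaunay cell of the lattice, the vertex `p k` having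
colour `k`: the four points lie on a sphere that has no lattice point in its interior. -/
def IsDelaunayTetrahedron (p : Fin 4 → E3) : Prop :=
  (∀ k, p k ∈ bccCoset k) ∧
    ∃ (c : E3) (r : ℝ), (∀ k, dist (p k) c = r) ∧ ∀ q ∈ bcc, r ≤ dist q c

/-- The class of a Delaunay tetrahedron with coloured vertices: the orientation of the
quadruple of its vertices of colours `0, 1, 2, 3`. Two such tetrahedra have the same sign iff a
motion that respects the colours carries one to the other. -/
noncomputable def tetrahedronSign (p : Fin 4 → E3) : SignType :=
  SignType.sign (Matrix.det (Matrix.of fun i j : Fin 3 => (p i.succ - p 0) j))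

/-- Signed permutations of the four colours. -/
abbrev SignedPerm : Type := Equiv.Perm (Fin 4) × ℤˣ

/-- `g` induces the signed permutation `s`: it maps the coset `[k]` onto `[s.1 k]`, and it fixes
(if `s.2 = 1`) or changes (if `s.2 = -1`) the signs of the Delaunay tetrahedra. The image of the
tetrahedron with vertices `p k` has `g (p (s.1⁻¹ k))` as its vertex of colour `k`. -/
def Induces (g : Isom3) (s : SignedPerm) : Prop :=
  (∀ k, g '' bccCoset k = bccCoset (s.1 k)) ∧
    ∀ p : Fin 4 → E3, IsDelaunayTetrahedron p →
      tetrahedronSign (fun k => g (p (s.1⁻¹ k))) =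
        SignType.sign (s.2 : ℤ) * tetrahedronSign p

theorem bcc_eq_iUnion : bcc = ⋃ k, bccCoset k := by
  ext p
  simp only [Set.mem_iUnion]
  constructor
  · intro hp
    have key : ∃ n : ℤ, p 0 + p 1 + p 2 = (n : ℝ) / 2 := by
      rcases hp with h | h
      · obtain ⟨a, ha⟩ := h 0
        obtain ⟨b, hb⟩ := h 1
        obtain ⟨c, hc⟩ := h 2
        exact ⟨2 * (a + b + c), by rw [ha, hb, hc]; push_cast; ring⟩
      · obtain ⟨a, ha⟩ := h 0
        obtain ⟨b, hb⟩ := h 1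
        obtain ⟨c, hc⟩ := h 2
        exact ⟨2 * (a + b + c) + 3, by rw [ha, hb, hc]; push_cast; ring⟩
    obtain ⟨n, hn⟩ := key
    have h1 : 0 ≤ n % 4 := by omega
    have h2 : n % 4 < 4 := by omega
    refine ⟨⟨(n % 4).toNat, by omega⟩, hp, n / 4, ?_⟩
    have h3 : (((n % 4).toNat : ℕ) : ℤ) + 4 * (n / 4) = n := by omega
    have h4 : (((n % 4).toNat : ℕ) : ℝ) + 4 * ((n / 4 : ℤ) : ℝ) = (n : ℝ) := by exact_mod_cast h3
    rw [hn]
    show (n : ℝ) / 2 = (((n % 4).toNat : ℕ) : ℝ) / 2 + 2 * ((n / 4 : ℤ) : ℝ)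
    linarith
  · rintro ⟨k, hk⟩
    exact hk.1

theorem Induces.image_bcc {g : Isom3} {s : SignedPerm} (h : Induces g s) : g '' bcc = bcc := by
  rw [bcc_eq_iUnion, Set.image_iUnion]
  simp only [h.1]
  exact s.1.surjective.iUnion_comp (fun k => bccCoset k)

theorem Induces.delaunay {g : Isom3} {s : SignedPerm} (h : Induces g s) {p : Fin 4 → E3}
    (hp : IsDelaunayTetrahedron p) : IsDelaunayTetrahedron (fun k => g (p (s.1⁻¹ k))) := by
  obtain ⟨h1, c, r, h2, h3⟩ := hp
  refine ⟨fun k => ?_, g c, r, fun k => ?_, fun q hq => ?_⟩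
  · have : g (p (s.1⁻¹ k)) ∈ g '' bccCoset (s.1⁻¹ k) := ⟨_, h1 _, rfl⟩
    rw [h.1] at this
    simpa using this
  · simpa using h2 (s.1⁻¹ k)
  · rw [← h.image_bcc] at hq
    obtain ⟨q', hq', rfl⟩ := hq
    simpa using h3 q' hq'

theorem Induces.one : Induces 1 1 := by
  refine ⟨fun k => by simp, fun p _ => by simp⟩

theorem Induces.mul {g h : Isom3} {s t : SignedPerm} (hg : Induces g s) (hh : Induces h t) :
    Induces (g * h) (s * t) := by
  refine ⟨fun k => ?_, fun p hp => ?_⟩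
  · have : (g * h) '' bccCoset k = g '' (h '' bccCoset k) := by
      rw [Set.image_image]; rfl
    rw [this, hh.1, hg.1]; rfl
  · have h1 := hg.2 _ (hh.delaunay hp)
    rw [hh.2 p hp, ← mul_assoc, ← sign_mul] at h1
    simpa [mul_inv_rev] using h1

theorem Induces.inv {g : Isom3} {s : SignedPerm} (hg : Induces g s) : Induces g⁻¹ s⁻¹ := by
  have key : ∀ A B : Set E3, g '' A = B → (g⁻¹ : Isom3) '' B = A := by
    rintro A _ rfl
    rw [Set.image_image]
    have : ∀ x, (g⁻¹ : Isom3) (g x) = x := fun x => g.symm_apply_apply x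
    simp [this]
  refine ⟨fun k => key _ _ (by rw [hg.1]; simp), fun p hp => ?_⟩
  have hb : (g⁻¹ : Isom3) '' bcc = bcc := key _ _ hg.image_bcc
  have hq : IsDelaunayTetrahedron (fun k => (g⁻¹ : Isom3) (p (s.1 k))) := by
    obtain ⟨h1, c, r, h2, h3⟩ := hp
    refine ⟨fun k => ?_, (g⁻¹ : Isom3) c, r, fun k => ?_, fun q hq => ?_⟩
    · have := key _ _ (hg.1 k)
      rw [← this]
      exact ⟨_, h1 _, rfl⟩
    · simpa using h2 (s.1 k)
    · rw [← hb] at hq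
      obtain ⟨q', hq', rfl⟩ := hq
      simpa using h3 q' hq'
  have h1 := hg.2 _ hq
  have h2 : ∀ x, g ((g⁻¹ : Isom3) x) = x := fun x => g.apply_symm_apply x
  have h6 : ∀ k, s.1 (s.1⁻¹ k) = k := fun k => s.1.apply_symm_apply k
  simp only [h2, h6] at h1
  have h3 : SignType.sign (s.2 : ℤ) * SignType.sign (s.2 : ℤ) = 1 := by
    rcases Int.units_eq_one_or s.2 with h | h <;> simp [h]
  have h4 : (s⁻¹).2 = s.2 := by
    rcases Int.units_eq_one_or s.2 with h | h <;> simp [h]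
  have h5 : (s⁻¹).1⁻¹ = s.1 := by simp
  rw [h4, h5, h1, ← mul_assoc, h3, one_mul]

/-- All the symmetries of the lattice that induce an element of a given group of signed
permutations. -/
noncomputable def fullGroup (S : Subgroup SignedPerm) : Subgroup Isom3 where
  carrier := {g | ∃ s ∈ S, Induces g s}
  one_mem' := ⟨1, S.one_mem, Induces.one⟩
  mul_mem' := by
    rintro g h ⟨s, hs, hg⟩ ⟨t, ht, hh⟩
    exact ⟨s * t, S.mul_mem hs ht, hg.mul hh⟩
  inv_mem' := by
    rintro g ⟨s, hs, hg⟩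
    exact ⟨s⁻¹, S.inv_mem hs, hg.inv⟩

/-! ### The set of diagonal lines -/

/-- Congruence of real numbers modulo 2. -/
def CongrMod2 (a b : ℝ) : Prop := ∃ m : ℤ, a - b = 2 * m

/-- The lattice point `p = (x, y, z)` lies on a line of the set in direction `d`. -/
def LiesOnLine (p d : E3) : Prop :=
  (IsIntPoint p ∧
    ((d = !₂[1, 1, 1] ∧ CongrMod2 (p 0) (p 1) ∧ CongrMod2 (p 1) (p 2)) ∨
     (d = !₂[-1, 1, 1] ∧ ¬ CongrMod2 (p 1) (p 2) ∧ CongrMod2 (p 2) (p 0)) ∨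
     (d = !₂[1, -1, 1] ∧ ¬ CongrMod2 (p 2) (p 0) ∧ CongrMod2 (p 0) (p 1)) ∨
     (d = !₂[1, 1, -1] ∧ ¬ CongrMod2 (p 0) (p 1) ∧ CongrMod2 (p 1) (p 2)))) ∨
  (IsHalfPoint p ∧
    ((d = !₂[1, 1, 1] ∧ CongrMod2 (p 0) (p 1) ∧ CongrMod2 (p 1) (p 2)) ∨
     (d = !₂[-1, 1, 1] ∧ ¬ CongrMod2 (p 2) (p 0) ∧ CongrMod2 (p 0) (p 1)) ∨
     (d = !₂[1, -1, 1] ∧ ¬ CongrMod2 (p 0) (p 1) ∧ CongrMod2 (p 1) (p 2)) ∨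
     (d = !₂[1, 1, -1] ∧ ¬ CongrMod2 (p 1) (p 2) ∧ CongrMod2 (p 2) (p 0))))

/-- The set of diagonal lines. -/
def diagonalLines : Set (Set E3) :=
  {L | ∃ p d : E3, LiesOnLine p d ∧ L = {q | ∃ t : ℝ, q = p + t • d}}

/-- The isometries that preserve the set of diagonal lines. -/
noncomputable def lineGroup : Subgroup Isom3 where
  carrier := {g | (fun L : Set E3 => g '' L) '' diagonalLines = diagonalLines}
  one_mem' := by simp
  mul_mem' := by
    intro g h hg hh
    simp only [Set.mem_ofPred_eq] at *
    have : (fun L : Set E3 => (g * h) '' L) = (fun L => g '' L) ∘ (fun L => h '' L) := by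
      funext L
      simp only [Function.comp, Set.image_image]
      rfl
    rw [this, Set.image_comp, hh, hg]
  inv_mem' := by
    intro g hg
    simp only [Set.mem_ofPred_eq] at *
    conv_lhs => rw [← hg]
    simp [Set.image_image]

/-- All the symmetries of the lattice together with the set of diagonal lines that induce an
element of a given group of permutations of the four colours. -/
noncomputable def quarterGroup (S : Subgroup (Equiv.Perm (Fin 4))) : Subgroup Isom3 :=
  lineGroup ⊓ fullGroup (S.prod ⊤)

/-- The automorphism group of the body-centred cubic lattice. -/
noncomputable def latticeAut : Subgroup Isom3 where
  carrier := {g | g '' bcc = bcc}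
  one_mem' := by simp
  mul_mem' := by
    intro g h hg hh
    simp only [Set.mem_ofPred_eq] at *
    have : (g * h) '' bcc = g '' (h '' bcc) := by rw [Set.image_image]; rfl
    rw [this, hh, hg]
  inv_mem' := by
    intro g hg
    simp only [Set.mem_ofPred_eq] at *
    conv_lhs => rw [← hg]
    simp [Set.image_image]

/-- The odd subgroup `T₁` of the automorphism group of the lattice. -/
noncomputable def T1 : Subgroup Isom3 := oddSubgroup latticeAut

/-- The odd subgroup `T₂` of the group of the automorphisms of the lattice that preserve the set
of diagonal lines. -/
noncomputable def T2 : Subgroup Isom3 := oddSubgroup (latticeAut ⊓ lineGroup)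

/-! ### The names of the 35 groups -/

/-- The names `8°, 4⁻, 4°, 4⁺, 2⁻, 2°, 2⁺, 1°` of the subgroups (up to conjugacy) of the
dihedral group of order 8; `m`, `o`, `p` stand for the superscripts `-`, `°`, `+`. -/
inductive DihedralName : Type
  | o8 | m4 | o4 | p4 | m2 | o2 | p2 | o1
  deriving DecidableEq

/-- The 4-cycle `(0 1 2 3)`. -/
def rot4 : Equiv.Perm (Fin 4) := Equiv.swap 0 1 * Equiv.swap 1 2 * Equiv.swap 2 3

/-- The elements of (a representative of) the named subgroup of the dihedral group. -/
def dihedralElements : DihedralName → Finset (Equiv.Perm (Fin 4))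
  | .o8 => {1, Equiv.swap 0 2 * Equiv.swap 1 3, rot4, rot4⁻¹, Equiv.swap 1 3, Equiv.swap 0 2,
      Equiv.swap 0 1 * Equiv.swap 2 3, Equiv.swap 0 3 * Equiv.swap 1 2}
  | .m4 => {1, Equiv.swap 0 2 * Equiv.swap 1 3, Equiv.swap 1 3, Equiv.swap 0 2}
  | .o4 => {1, Equiv.swap 0 2 * Equiv.swap 1 3, rot4, rot4⁻¹}
  | .p4 => {1, Equiv.swap 0 2 * Equiv.swap 1 3, Equiv.swap 0 1 * Equiv.swap 2 3,
      Equiv.swap 0 3 * Equiv.swap 1 2}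
  | .m2 => {1, Equiv.swap 1 3}
  | .o2 => {1, Equiv.swap 0 2 * Equiv.swap 1 3}
  | .p2 => {1, Equiv.swap 0 1 * Equiv.swap 2 3}
  | .o1 => {1}

theorem dihedralElements_closed (N : DihedralName) :
    1 ∈ dihedralElements N ∧
      (∀ a ∈ dihedralElements N, ∀ b ∈ dihedralElements N, a * b ∈ dihedralElements N) ∧
      ∀ a ∈ dihedralElements N, a⁻¹ ∈ dihedralElements N := by
  cases N <;> decide

/-- The named subgroup of the dihedral group of order 8. -/
def dihedralSubgroup (N : DihedralName) : Subgroup (Equiv.Perm (Fin 4)) where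
  carrier := {a | a ∈ dihedralElements N}
  one_mem' := (dihedralElements_closed N).1
  mul_mem' := fun {a b} ha hb => (dihedralElements_closed N).2.1 a ha b hb
  inv_mem' := fun {a} ha => (dihedralElements_closed N).2.2 a ha

/-- The names `8⁻°, 8°°, 8⁺°, 4⁻⁻, 4°⁻, 4°°, 4°⁺, 4⁺⁺, 2°⁻, 2°°, 2°⁺` of the groups `2Nⁱʲ`. -/
inductive MixedName : Type
  | mo8 | oo8 | po8 | mm4 | om4 | oo4 | op4 | pp4 | om2 | oo2 | op2
  deriving DecidableEq

/-- The group `H = Nⁱ` of the elements with sign `+` in `2Nⁱʲ`. -/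
def MixedName.lower : MixedName → DihedralName
  | .mo8 => .m4 | .oo8 => .o4 | .po8 => .p4
  | .mm4 => .m2 | .om4 => .o2 | .oo4 => .o2 | .op4 => .o2 | .pp4 => .p2
  | .om2 => .o1 | .oo2 => .o1 | .op2 => .o1

/-- The group `G = 2Nʲ` to whose elements signs are affixed in `2Nⁱʲ`. -/
def MixedName.upper : MixedName → DihedralName
  | .mo8 => .o8 | .oo8 => .o8 | .po8 => .o8
  | .mm4 => .m4 | .om4 => .m4 | .oo4 => .o4 | .op4 => .p4 | .pp4 => .p4
  | .om2 => .m2 | .oo2 => .o2 | .op2 => .p2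

theorem mixed_index_two (e : MixedName) :
    ∀ a ∈ dihedralElements e.upper, ∀ b ∈ dihedralElements e.upper,
      (a * b ∈ dihedralElements e.lower ↔
        (a ∈ dihedralElements e.lower ↔ b ∈ dihedralElements e.lower)) := by
  cases e <;> decide

/-- The group of signed permutations `2Nⁱʲ`: the elements of `G = 2Nʲ` with sign `+` just for
the elements of `H = Nⁱ`. -/
def mixedSubgroup (e : MixedName) : Subgroup SignedPerm where
  carrier := {s | s.1 ∈ dihedralSubgroup e.upper ∧ (s.2 = 1 ↔ s.1 ∈ dihedralSubgroup e.lower)}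
  one_mem' := ⟨one_mem _, by simp [one_mem]⟩
  mul_mem' := by
    rintro ⟨a, u⟩ ⟨b, v⟩ ⟨ha, hu⟩ ⟨hb, hv⟩
    refine ⟨mul_mem ha hb, ?_⟩
    have h1 : a * b ∈ dihedralSubgroup e.lower ↔
        (a ∈ dihedralSubgroup e.lower ↔ b ∈ dihedralSubgroup e.lower) :=
      mixed_index_two e a ha b hb
    have h2 : u * v = 1 ↔ (u = 1 ↔ v = 1) := by
      rcases Int.units_eq_one_or u with rfl | rfl <;>
        rcases Int.units_eq_one_or v with rfl | rfl <;> decide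
    show u * v = 1 ↔ a * b ∈ dihedralSubgroup e.lower
    rw [h1, h2]
    exact iff_congr hu hv
  inv_mem' := by
    rintro ⟨a, u⟩ ⟨ha, hu⟩
    refine ⟨inv_mem ha, ?_⟩
    show u⁻¹ = 1 ↔ a⁻¹ ∈ dihedralSubgroup e.lower
    rw [inv_eq_one, inv_mem_iff]
    exact hu

/-- The names of the 35 groups: `N` (`full N`), `N:2` (`double N`), the groups `2Nⁱʲ`
(`mixed e`), and `N/4` (`quarter N`). -/
inductive IrreducibleName : Type
  | full (N : DihedralName)
  | double (N : DihedralName)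
  | mixed (e : MixedName)
  | quarter (N : DihedralName)
  deriving DecidableEq

/-- The group with a given name. -/
noncomputable def namedGroup : IrreducibleName → Subgroup Isom3
  | .full N => fullGroup ((dihedralSubgroup N).prod ⊥)
  | .double N => fullGroup ((dihedralSubgroup N).prod ⊤)
  | .mixed e => fullGroup (mixedSubgroup e)
  | .quarter N => quarterGroup (dihedralSubgroup N)

/-! ### Inclusions -/

/-- Some congruent copy of the group named `A` is contained in the group named `B`. -/
def Included (A B : IrreducibleName) : Prop :=
  ∃ g : Isom3, conjGroup g (namedGroup A) ≤ namedGroup B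

/-- An inclusion between different groups with none of the others strictly between. -/
def MinimalInclusion (A B : IrreducibleName) : Prop :=
  A ≠ B ∧ Included A B ∧ ∀ C, Included A C → Included C B → C = A ∨ C = B

/-- The inclusions in the triple (heavy box) `G/4 ⊂ G ⊂ G:2`. -/
inductive HeavyBox : IrreducibleName → IrreducibleName → Prop
  | quarter_full (N : DihedralName) : HeavyBox (.quarter N) (.full N)
  | full_double (N : DihedralName) : HeavyBox (.full N) (.double N)

/-- The inclusions represented by a heavy edge between the triples of `H = Nⁱ` and `G = 2Nʲ`:
`H/4 ⊂ G/4`, `H ⊂ G`, `H:2 ⊂ G:2`, and `Nⁱ ⊂ 2Nⁱʲ ⊂ 2Nʲ:2`. -/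
inductive HeavyEdge : IrreducibleName → IrreducibleName → Prop
  | quarter (e : MixedName) : HeavyEdge (.quarter e.lower) (.quarter e.upper)
  | full (e : MixedName) : HeavyEdge (.full e.lower) (.full e.upper)
  | double (e : MixedName) : HeavyEdge (.double e.lower) (.double e.upper)
  | full_mixed (e : MixedName) : HeavyEdge (.full e.lower) (.mixed e)
  | mixed_double (e : MixedName) : HeavyEdge (.mixed e) (.double e.upper)

/-- The inclusions (thin edges) of the form `Nⁱʲ ⊂ 2Nᵏˡ`. -/
inductive ThinEdge : IrreducibleName → IrreducibleName → Prop
  | om4_oo8 : ThinEdge (.mixed .om4) (.mixed .oo8)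
  | om4_po8 : ThinEdge (.mixed .om4) (.mixed .po8)
  | oo4_mo8 : ThinEdge (.mixed .oo4) (.mixed .mo8)
  | oo4_po8 : ThinEdge (.mixed .oo4) (.mixed .po8)
  | op4_mo8 : ThinEdge (.mixed .op4) (.mixed .mo8)
  | op4_oo8 : ThinEdge (.mixed .op4) (.mixed .oo8)
  | om2_mm4 : ThinEdge (.mixed .om2) (.mixed .mm4)
  | om2_om4 : ThinEdge (.mixed .om2) (.mixed .om4)
  | oo2_mm4 : ThinEdge (.mixed .oo2) (.mixed .mm4)
  | oo2_pp4 : ThinEdge (.mixed .oo2) (.mixed .pp4)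
  | op2_op4 : ThinEdge (.mixed .op2) (.mixed .op4)
  | op2_pp4 : ThinEdge (.mixed .op2) (.mixed .pp4)

/-! In doubled coordinates every automorphism of the lattice is a signed permutation of the
coordinates followed by an integral translation with entries of equal parity (`mem_latticeAut_iff`).
Its action on colours and orientations is an element of `D₄ × {±1}`, and all 16 elements occur
(`induces_signedIso`, `exists_induces_eq`). As this is a 2-group, elements of order 3 induce the
identity; conversely they generate the kernel. So `T1` is the kernel (`T1_eq`), and `T2` is the part
of the kernel that preserves the lines (`T2_eq`). The symmetries that preserve the lines always have
sign `+`, and they already induce all of `D₄` (`lineGroup_sign`, `exists_line_induces`).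

The bridge to arbitrary isometries is rigidity: an isometry that conjugates `T2` into `T1` preserves
the lattice (`mem_latticeAut_of_conj`), and a lattice automorphism that normalizes `T2` preserves
the lines (`mem_lineGroup_of_conj`). A group normalizes its odd subgroup. Hence the groups with odd
subgroup `T1` are the preimages of the subgroups of `D₄ × {±1}`, and those with odd subgroup `T2`
are the preimages, among the line-preserving symmetries, of the subgroups of `D₄`: 27 and 8
conjugacy classes. An isometry that conjugates one named group into another is also a lattice
automorphism, and since signs are central it can be traded for a line-preserving one with the same
effect on signed permutations. So inclusion up to congruence is a finite question (`included_iff`),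
settled by computation with bit codes; indices are read off from the orders of the groups of signed
permutations, except for the index 4 of `N/4` in `N`, which is counted by translations.

Affine maps bring nothing new. A conjugating affine map respects the tetrahedral point group, hence
is a similarity (`linear_norm_sq`). Comparing shortest translations fixes its scale; `T1` and `T2`
are told apart because a face-centred and a primitive cubic lattice are not similar. What remains is
an isometry, and mutual inclusion of two named groups forces equal names. Finally, a line-preserving
symmetry changes orientation exactly if its colour permutation is odd, and only odd elements of `D₄`
conjugate `(01)(23)` to `(03)(12)`. -/

/-! ### Signed permutations of the coordinates followed by half-integral translations -/

/-- The linear isometry that precomposes the coordinates with `σ` and multiplies them by `ε`. -/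
noncomputable def signedLin (σ : Equiv.Perm (Fin 3)) (ε : Fin 3 → ℤˣ) : E3 ≃ₗᵢ[ℝ] E3 :=
  (LinearIsometryEquiv.piLpCongrLeft 2 ℝ ℝ σ.symm).trans
    (LinearIsometryEquiv.piLpCongrRight 2
      fun i => if ε i = 1 then LinearIsometryEquiv.refl ℝ ℝ else LinearIsometryEquiv.neg ℝ)

theorem signedLin_apply (σ : Equiv.Perm (Fin 3)) (ε : Fin 3 → ℤˣ) (x : E3) (i : Fin 3) :
    signedLin σ ε x i = ((ε i : ℤ) : ℝ) * x (σ i) := by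
  rcases Int.units_eq_one_or (ε i) with h | h <;>
    simp [signedLin, h]

/-- The point whose coordinates are the halves of the given integers. -/
noncomputable def halfPoint (P : Fin 3 → ℤ) : E3 := WithLp.toLp 2 fun i => (P i : ℝ) / 2

@[simp] theorem halfPoint_apply (P : Fin 3 → ℤ) (i : Fin 3) : halfPoint P i = (P i : ℝ) / 2 := rfl

theorem halfPoint_injective : Function.Injective halfPoint := by
  intro P Q h
  funext i
  have := congrArg (fun x : E3 => x i) h
  simp only [halfPoint_apply] at this
  have h2 : (P i : ℝ) = Q i := by linarith
  exact_mod_cast h2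

/-- A signed permutation of the coordinates followed by a translation by `T / 2`. -/
noncomputable def signedIso (σ : Equiv.Perm (Fin 3)) (ε : Fin 3 → ℤˣ) (T : Fin 3 → ℤ) : Isom3 :=
  (signedLin σ ε).toAffineIsometryEquiv.trans (AffineIsometryEquiv.constVAdd ℝ E3 (halfPoint T))

@[simp] theorem signedIso_apply (σ : Equiv.Perm (Fin 3)) (ε : Fin 3 → ℤˣ) (T : Fin 3 → ℤ)
    (x : E3) (i : Fin 3) :
    signedIso σ ε T x i = ((ε i : ℤ) : ℝ) * x (σ i) + (T i : ℝ) / 2 := by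
  simp [signedIso, signedLin_apply, add_comm]

theorem signedIso_linear (σ : Equiv.Perm (Fin 3)) (ε : Fin 3 → ℤˣ) (T : Fin 3 → ℤ) :
    (signedIso σ ε T).linearIsometryEquiv = signedLin σ ε := by
  ext x i
  have h := AffineIsometryEquiv.map_vadd (signedIso σ ε T) 0 x
  have h2 := congrArg (fun y : E3 => y i) h
  simp at h2
  rw [signedLin_apply, h2]

/-- Precomposition is contravariant, so the permutations multiply in the opposite order. -/
theorem signedIso_mul (σ τ : Equiv.Perm (Fin 3)) (ε δ : Fin 3 → ℤˣ) (T S : Fin 3 → ℤ) :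
    signedIso σ ε T * signedIso τ δ S =
      signedIso (τ * σ) (fun i => ε i * δ (σ i)) (fun i => (ε i : ℤ) * S (σ i) + T i) := by
  ext x i
  simp [AffineIsometryEquiv.coe_mul]
  ring

theorem signedIso_one : signedIso 1 1 0 = 1 := by
  ext x i
  simp

theorem signedIso_congr {σ τ : Equiv.Perm (Fin 3)} {ε δ : Fin 3 → ℤˣ} {T S : Fin 3 → ℤ}
    (h1 : σ = τ) (h2 : ∀ i, ε i = δ i) (h3 : ∀ i, T i = S i) :
    signedIso σ ε T = signedIso τ δ S := by
  rw [h1, funext h2, funext h3]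

theorem signedIso_inv (σ : Equiv.Perm (Fin 3)) (ε : Fin 3 → ℤˣ) (T : Fin 3 → ℤ) :
    (signedIso σ ε T)⁻¹ =
      signedIso σ⁻¹ (fun i => ε (σ⁻¹ i)) (fun i => -((ε (σ⁻¹ i) : ℤ) * T (σ⁻¹ i))) := by
  rw [inv_eq_iff_mul_eq_one, signedIso_mul, ← signedIso_one]
  refine signedIso_congr (by simp) (fun i => ?_) (fun i => ?_)
  · rcases Int.units_eq_one_or (ε i) with h | h <;> simp [h]
  · rcases Int.units_eq_one_or (ε i) with h | h <;> simp [h]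

/-- The value at the origin determines the translation, and the values at the coordinate vectors
determine the permutation and the signs. -/
theorem signedIso_injective {σ τ : Equiv.Perm (Fin 3)} {ε δ : Fin 3 → ℤˣ} {T S : Fin 3 → ℤ}
    (h : signedIso σ ε T = signedIso τ δ S) : σ = τ ∧ ε = δ ∧ T = S := by
  have key : ∀ (x : E3) i, ((ε i : ℤ) : ℝ) * x (σ i) + (T i : ℝ) / 2 =
      ((δ i : ℤ) : ℝ) * x (τ i) + (S i : ℝ) / 2 := fun x i => by
    rw [← signedIso_apply, h, signedIso_apply]
  have hT : ∀ i, (T i : ℝ) / 2 = (S i : ℝ) / 2 := fun i => by simpa using key 0 i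
  have hε : ∀ (x : E3) i, ((ε i : ℤ) : ℝ) * x (σ i) = ((δ i : ℤ) : ℝ) * x (τ i) :=
    fun x i => by have := key x i; rw [hT i] at this; linarith
  have hσ : ∀ i, σ i = τ i := by
    intro i
    by_contra hne
    have := hε (EuclideanSpace.single (σ i) 1) i
    simp [Ne.symm hne] at this
  refine ⟨?_, ?_, ?_⟩
  · exact Equiv.ext hσ
  · funext i
    have := hε (EuclideanSpace.single (σ i) 1) i
    rw [← hσ i] at this
    simpa [Units.ext_iff] using this
  · funext i
    have : (T i : ℝ) = S i := by linarith [hT i]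
    exact_mod_cast this

/-! ### Lattice automorphisms in doubled coordinates -/

/-- All the components have the same parity. -/
def SameParity (P : Fin 3 → ℤ) : Prop := ∀ i j, P i % 2 = P j % 2

theorem sameParity_iff (P : Fin 3 → ℤ) :
    SameParity P ↔ P 0 % 2 = P 1 % 2 ∧ P 0 % 2 = P 2 % 2 := by
  constructor
  · exact fun h => ⟨h _ _, h _ _⟩
  · rintro ⟨h1, h2⟩ i j
    fin_cases i <;> fin_cases j <;> simp <;> omega

theorem signedIso_halfPoint (σ : Equiv.Perm (Fin 3)) (ε : Fin 3 → ℤˣ) (T P : Fin 3 → ℤ) :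
    signedIso σ ε T (halfPoint P) = halfPoint fun i => (ε i : ℤ) * P (σ i) + T i := by
  ext i
  simp
  ring

theorem units_mul_emod_two (u : ℤˣ) (n : ℤ) : ((u : ℤ) * n) % 2 = n % 2 := by
  rcases Int.units_eq_one_or u with h | h <;> simp [h]

theorem SameParity.image {T P : Fin 3 → ℤ} (hT : SameParity T) (hP : SameParity P)
    (σ : Equiv.Perm (Fin 3)) (ε : Fin 3 → ℤˣ) :
    SameParity fun i => (ε i : ℤ) * P (σ i) + T i := by
  intro i j
  have h1 := units_mul_emod_two (ε i) (P (σ i))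
  have h2 := units_mul_emod_two (ε j) (P (σ j))
  have h3 := hT i j
  have h4 := hP (σ i) (σ j)
  simp only
  omega

/-- In doubled coordinates, integral points are even and half-integral points are odd, so both
cosets are treated at once. -/
theorem mem_bcc_iff (p : E3) : p ∈ bcc ↔ ∃ P, SameParity P ∧ p = halfPoint P := by
  constructor
  · rintro (h | h)
    · choose n hn using h
      refine ⟨fun i => 2 * n i, fun i j => by simp, ?_⟩
      ext i
      simp [hn]
    · choose n hn using h
      refine ⟨fun i => 2 * n i + 1, fun i j => by simp only; omega, ?_⟩
      ext i
      simp [hn]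
      ring
  · rintro ⟨P, hP, rfl⟩
    rcases Int.emod_two_eq_zero_or_one (P 0) with h | h
    · left
      intro i
      obtain ⟨n, hn⟩ : ∃ n, P i = 2 * n := ⟨P i / 2, by have := hP i 0; omega⟩
      exact ⟨n, by simp [hn]⟩
    · right
      intro i
      obtain ⟨n, hn⟩ : ∃ n, P i = 2 * n + 1 := ⟨P i / 2, by have := hP i 0; omega⟩
      exact ⟨n, by simp [hn]; ring⟩

theorem signedIso_mem_latticeAut {σ : Equiv.Perm (Fin 3)} {ε : Fin 3 → ℤˣ} {T : Fin 3 → ℤ}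
    (hT : SameParity T) : signedIso σ ε T ∈ latticeAut := by
  have key : ∀ {σ : Equiv.Perm (Fin 3)} {ε : Fin 3 → ℤˣ} {T : Fin 3 → ℤ},
      SameParity T → ∀ p ∈ bcc, signedIso σ ε T p ∈ bcc := by
    intro σ ε T hT p hp
    obtain ⟨P, hP, rfl⟩ := (mem_bcc_iff p).1 hp
    rw [signedIso_halfPoint]
    exact (mem_bcc_iff _).2 ⟨_, hT.image hP σ ε, rfl⟩
  apply Set.Subset.antisymm
  · rintro _ ⟨p, hp, rfl⟩
    exact key hT p hp
  · intro p hp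
    refine ⟨(signedIso σ ε T)⁻¹ p, ?_, (signedIso σ ε T).apply_symm_apply p⟩
    rw [signedIso_inv]
    refine key (fun i j => ?_) p hp
    have h1 := units_mul_emod_two (ε (σ⁻¹ i)) (T (σ⁻¹ i))
    have h2 := units_mul_emod_two (ε (σ⁻¹ j)) (T (σ⁻¹ j))
    have h3 := hT (σ⁻¹ i) (σ⁻¹ j)
    omega

/-- An integral vector of norm `2` is `±2` times a coordinate vector. -/
theorem eq_two_mul_single {v : Fin 3 → ℤ} (h : v 0 ^ 2 + v 1 ^ 2 + v 2 ^ 2 = 4) :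
    ∃ (j : Fin 3) (u : ℤˣ), ∀ i, v i = if i = j then 2 * (u : ℤ) else 0 := by
  have b : ∀ x : ℤ, x ^ 2 ≤ 4 → -2 ≤ x ∧ x ≤ 2 := fun x hx => by constructor <;> nlinarith
  have b0 := b (v 0) (by nlinarith [sq_nonneg (v 1), sq_nonneg (v 2)])
  have b1 := b (v 1) (by nlinarith [sq_nonneg (v 0), sq_nonneg (v 2)])
  have b2 := b (v 2) (by nlinarith [sq_nonneg (v 0), sq_nonneg (v 1)])
  obtain ⟨x, hx⟩ : ∃ x, v 0 = x := ⟨_, rfl⟩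
  obtain ⟨y, hy⟩ : ∃ y, v 1 = y := ⟨_, rfl⟩
  obtain ⟨z, hz⟩ : ∃ z, v 2 = z := ⟨_, rfl⟩
  simp only [Fin.forall_fin_succ, IsEmpty.forall_iff, and_true, Fin.succ_zero_eq_one,
    Fin.succ_one_eq_two, hx, hy, hz] at *
  have : (∃ u : ℤˣ, x = 2 * (u : ℤ) ∧ y = 0 ∧ z = 0) ∨ (∃ u : ℤˣ, x = 0 ∧ y = 2 * (u : ℤ) ∧ z = 0)
      ∨ (∃ u : ℤˣ, x = 0 ∧ y = 0 ∧ z = 2 * (u : ℤ)) := by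
    obtain ⟨l0, u0⟩ := b0
    obtain ⟨l1, u1⟩ := b1
    obtain ⟨l2, u2⟩ := b2
    clear hx hy hz b
    interval_cases x <;> interval_cases y <;> interval_cases z <;> revert h <;> decide
  rcases this with ⟨u, h0, h1, h2⟩ | ⟨u, h0, h1, h2⟩ | ⟨u, h0, h1, h2⟩
  · exact ⟨0, u, by simp [h0, h1, h2]⟩
  · exact ⟨1, u, by simp [h0, h1, h2]⟩
  · exact ⟨2, u, by simp [h0, h1, h2]⟩

theorem norm_sq_fin_three (x : E3) : ‖x‖ ^ 2 = x 0 ^ 2 + x 1 ^ 2 + x 2 ^ 2 := by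
  rw [EuclideanSpace.norm_sq_eq]
  simp [Fin.sum_univ_three]

/-- A linear isometry that maps the doubled coordinate vectors to integral vectors is a signed
permutation of the coordinates. -/
theorem eq_signedLin (R : E3 ≃ₗᵢ[ℝ] E3)
    (h : ∀ j, ∃ v : Fin 3 → ℤ, ∀ i, R (EuclideanSpace.single j 2) i = v i) :
    ∃ σ ε, R = signedLin σ ε := by
  have key : ∀ j, ∃ (k : Fin 3) (u : ℤˣ), ∀ i, R (EuclideanSpace.single j 1) i =
      if i = k then ((u : ℤ) : ℝ) else 0 := by
    intro j
    obtain ⟨v, hv⟩ := h j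
    have hn : ‖R (EuclideanSpace.single j 2)‖ ^ 2 = 4 := by
      rw [R.norm_map]
      simp
      norm_num
    rw [norm_sq_fin_three] at hn
    simp only [hv] at hn
    obtain ⟨k, u, hu⟩ := eq_two_mul_single (v := v) (by exact_mod_cast hn)
    refine ⟨k, u, fun i => ?_⟩
    have h2 : (EuclideanSpace.single j 2 : E3) = (2 : ℝ) • EuclideanSpace.single j 1 := by
      ext i
      by_cases hij : i = j <;> simp [hij]
    have h3 := hv i
    rw [h2, map_smul, hu i] at h3
    by_cases hik : i = k
    · simp only [hik, PiLp.smul_apply, smul_eq_mul, if_true] at h3 ⊢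
      push_cast at h3
      linarith
    · simp only [hik, PiLp.smul_apply, smul_eq_mul, if_false] at h3 ⊢
      push_cast at h3
      linarith
  choose τ u hu using key
  -- Orthogonal coordinate vectors cannot go to multiples of the same one.
  have hinj : Function.Injective τ := by
    intro j k hjk
    by_contra hne
    have h1 :
        inner ℝ (R (EuclideanSpace.single j 1)) (R (EuclideanSpace.single k 1)) = (0 : ℝ) := by
      rw [R.inner_map_map, EuclideanSpace.inner_single_left]
      simp [hne]
    rw [PiLp.inner_apply] at h1
    simp [hu, hjk] at h1
  have hbij : Function.Bijective τ := Finite.injective_iff_bijective.1 hinj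
  refine ⟨(Equiv.ofBijective τ hbij).symm, fun i => u ((Equiv.ofBijective τ hbij).symm i), ?_⟩
  ext x i
  rw [signedLin_apply]
  have hx : x = ∑ j, x j • (EuclideanSpace.single j 1 : E3) := by
    ext i
    simp [Fin.sum_univ_three]
    fin_cases i <;> simp
  conv_lhs => rw [hx]
  simp only [map_sum, map_smul]
  obtain ⟨j, rfl⟩ := hbij.2 i
  have hj : (Equiv.ofBijective τ hbij).symm (τ j) = j :=
    (Equiv.ofBijective τ hbij).symm_apply_apply j
  rw [hj]
  simp [hu, hinj.eq_iff]
  ring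

theorem isom_eq_signedIso {g : Isom3} {T : Fin 3 → ℤ} (h0 : g 0 = halfPoint T)
    (h : ∀ j, ∃ v : Fin 3 → ℤ, ∀ i, g.linearIsometryEquiv (EuclideanSpace.single j 2) i = v i) :
    ∃ σ ε, g = signedIso σ ε T := by
  obtain ⟨σ, ε, hR⟩ := eq_signedLin _ h
  refine ⟨σ, ε, ?_⟩
  ext x i
  have h1 := AffineIsometryEquiv.map_vadd g 0 x
  simp only [vadd_eq_add, add_zero] at h1
  rw [h1, h0, hR, signedIso_apply, PiLp.add_apply, signedLin_apply, halfPoint_apply]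

/-- The images of the origin and of a coordinate vector are lattice points; twice their difference
is an integral vector of length 2, so `eq_signedLin` applies. -/
theorem mem_latticeAut_iff (g : Isom3) :
    g ∈ latticeAut ↔ ∃ σ ε T, SameParity T ∧ g = signedIso σ ε T := by
  constructor
  · intro hg
    have hb : ∀ p ∈ bcc, g p ∈ bcc := fun p hp => by
      have : g '' bcc = bcc := hg
      rw [← this]
      exact ⟨p, hp, rfl⟩
    have h0 : (0 : E3) = halfPoint 0 := by ext i; simp
    obtain ⟨T, hT, h0T⟩ := (mem_bcc_iff _).1 (hb 0 ((mem_bcc_iff _).2 ⟨0, fun i j => rfl, h0⟩))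
    obtain ⟨σ, ε, h⟩ := isom_eq_signedIso h0T (fun j => by
      have hj : EuclideanSpace.single j 1 ∈ bcc := by
        left
        intro i
        by_cases hij : i = j
        · exact ⟨1, by simp [hij]⟩
        · exact ⟨0, by simp [hij]⟩
      obtain ⟨S, hS, hgS⟩ := (mem_bcc_iff _).1 (hb _ hj)
      refine ⟨fun i => S i - T i, fun i => ?_⟩
      have h1 := AffineIsometryEquiv.map_vadd g 0 (EuclideanSpace.single j 1 : E3)
      simp only [vadd_eq_add, add_zero] at h1
      rw [h0T, hgS] at h1
      have h2 : (EuclideanSpace.single j 2 : E3) = (2 : ℝ) • EuclideanSpace.single j 1 := by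
        ext i
        by_cases hij : i = j <;> simp [hij]
      have h3 := congrArg (fun y : E3 => y i) h1
      simp only [PiLp.add_apply, halfPoint_apply] at h3
      rw [h2, map_smul, PiLp.smul_apply, smul_eq_mul]
      push_cast
      linarith)
    exact ⟨σ, ε, T, hT, h⟩
  · rintro ⟨σ, ε, T, hT, rfl⟩
    exact signedIso_mem_latticeAut hT

/-! ### Signed permutations induced by the automorphisms of the lattice -/

/-- The permutation `k ↦ u k + b` of the integers modulo 4. -/
def affPerm (u : ℤˣ) (b : ZMod 4) : Equiv.Perm (Fin 4) where
  -- `ZMod 4` and `Fin 4` are definitionally equal, so colours can be added.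
  toFun := fun k : ZMod 4 => ((u : ℤ) : ZMod 4) * k + b
  invFun := fun k : ZMod 4 => ((u : ℤ) : ZMod 4) * (k - b)
  left_inv := by unfold Function.LeftInverse; revert u b; decide
  right_inv := by unfold Function.RightInverse Function.LeftInverse; revert u b; decide

theorem affPerm_mul (u v : ℤˣ) (b c : ZMod 4) :
    affPerm u b * affPerm v c = affPerm (u * v) (((u : ℤ) : ZMod 4) * c + b) := by
  have h : ∀ k : ZMod 4, ((u : ℤ) : ZMod 4) * (((v : ℤ) : ZMod 4) * k + c) + b =
      (((u * v : ℤˣ) : ℤ) : ZMod 4) * k + (((u : ℤ) : ZMod 4) * c + b) := fun k => by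
    push_cast
    ring
  exact Equiv.ext h

/-- The sign `(-1) ^ n`. -/
def paritySign (n : ℤ) : ℤˣ := if n % 2 = 0 then 1 else -1

/-- The 4-cycle `k ↦ k + 1` is odd, and so is `k ↦ -k`, the transposition `(13)`. -/
theorem sign_affPerm (u : ℤˣ) (n : ℤ) :
    Equiv.Perm.sign (affPerm u (n : ZMod 4)) = u * paritySign n := by
  have h1 : paritySign n = paritySign (n % 4) := by
    unfold paritySign
    rw [Int.emod_emod_of_dvd n (by norm_num : (2 : ℤ) ∣ 4)]
  have h2 : (n : ZMod 4) = ((n % 4 : ℤ) : ZMod 4) := by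
    rw [ZMod.intCast_eq_intCast_iff]
    exact (Int.mod_modEq n 4).symm
  rw [h1, h2]
  have h3 : 0 ≤ n % 4 := by omega
  have h4 : n % 4 < 4 := by omega
  generalize n % 4 = m at *
  interval_cases m <;> revert u <;> decide

theorem mem_bccCoset_iff (k : Fin 4) (p : E3) :
    p ∈ bccCoset k ↔ ∃ P : Fin 3 → ℤ, SameParity P ∧ p = halfPoint P ∧
      (((P 0 + P 1 + P 2 : ℤ)) : ZMod 4) = k := by
  have hk : ∀ n : ℤ, (n : ZMod 4) = k ↔ ∃ m : ℤ, n = (k.val : ℤ) + 4 * m := by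
    intro n
    have : k = (((k.val : ℤ) : ZMod 4) : Fin 4) := by
      revert k; decide
    conv_lhs => rw [this]
    rw [ZMod.intCast_eq_intCast_iff, Int.modEq_iff_dvd]
    generalize (k.val : ℤ) = c
    constructor
    · rintro ⟨m, hm⟩
      exact ⟨-m, by omega⟩
    · rintro ⟨m, hm⟩
      exact ⟨-m, by omega⟩
  constructor
  · rintro ⟨hp, m, hm⟩
    obtain ⟨P, hP, rfl⟩ := (mem_bcc_iff p).1 hp
    refine ⟨P, hP, rfl, (hk _).2 ⟨m, ?_⟩⟩
    simp only [halfPoint_apply] at hm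
    have : (P 0 : ℝ) + P 1 + P 2 = ((k : ℕ) : ℝ) + 4 * m := by linarith
    exact_mod_cast this
  · rintro ⟨P, hP, rfl, h⟩
    obtain ⟨m, hm⟩ := (hk _).1 h
    refine ⟨(mem_bcc_iff _).2 ⟨P, hP, rfl⟩, m, ?_⟩
    have : (P 0 : ℝ) + P 1 + P 2 = ((k : ℕ) : ℝ) + 4 * m := by exact_mod_cast hm
    simp only [halfPoint_apply]
    linarith

theorem bccCoset_unique {p : E3} {k l : Fin 4} (hk : p ∈ bccCoset k) (hl : p ∈ bccCoset l) :
    k = l := by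
  obtain ⟨P, _, rfl, h1⟩ := (mem_bccCoset_iff k p).1 hk
  obtain ⟨Q, _, h, h2⟩ := (mem_bccCoset_iff l _).1 hl
  rw [halfPoint_injective h] at h1
  exact h1.symm.trans h2

/-! ### Orientation of Delaunay tetrahedra -/

/-- A Delaunay tetrahedron with a vertex at the origin. -/
noncomputable def referenceTetrahedron : Fin 4 → E3 :=
  ![halfPoint ![0, 0, 0], halfPoint ![1, 1, -1], halfPoint ![2, 0, 0], halfPoint ![1, 1, 1]]

theorem referenceTetrahedron_mem (k : Fin 4) : referenceTetrahedron k ∈ bccCoset k := by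
  rw [mem_bccCoset_iff]
  match k with
  | 0 => exact ⟨![0, 0, 0], by simp [sameParity_iff], rfl, rfl⟩
  | 1 => exact ⟨![1, 1, -1], by simp [sameParity_iff], rfl, rfl⟩
  | 2 => exact ⟨![2, 0, 0], by simp [sameParity_iff], rfl, rfl⟩
  | 3 => exact ⟨![1, 1, 1], by simp [sameParity_iff], rfl, rfl⟩

theorem referenceTetrahedron_isDelaunay : IsDelaunayTetrahedron referenceTetrahedron := by
  have hd : ∀ x : E3, dist x !₂[1 / 2, 1 / 4, 0] =
      √((x 0 - 1 / 2) ^ 2 + (x 1 - 1 / 4) ^ 2 + (x 2) ^ 2) := fun x => by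
    rw [EuclideanSpace.dist_eq]
    simp [Fin.sum_univ_three, Real.dist_eq, sq_abs]
  refine ⟨referenceTetrahedron_mem, !₂[1 / 2, 1 / 4, 0], √(5 / 16), fun k => ?_, fun q hq => ?_⟩
  · rw [hd]
    congr 1
    fin_cases k <;> simp [referenceTetrahedron] <;> norm_num
  · rw [hd]
    apply Real.sqrt_le_sqrt
    have odd_sq : ∀ n : ℤ, n % 2 = 1 → (1 : ℝ) ≤ (n : ℝ) ^ 2 := fun n hn => by
      have : 1 ≤ n ^ 2 := by
        have : n ≠ 0 := by omega
        have := sq_pos_of_ne_zero this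
        omega
      exact_mod_cast this
    obtain ⟨P, hP, rfl⟩ := (mem_bcc_iff q).1 hq
    simp only [halfPoint_apply]
    -- Four times the squared distance from the centre is `(P 0 - 1)² + (P 1 - 1/2)² + (P 2)²`. The
    -- middle term is at least `1/4`, and since `P 0` and `P 2` have equal parity, one of `P 0 - 1`
    -- and `P 2` is odd; the total is at least `5/4`.
    have h1 := odd_sq (2 * P 1 - 1) (by omega)
    have h01 := hP 0 2
    push_cast at h1
    rcases Int.emod_two_eq_zero_or_one (P 0) with h | h
    · have h2 := odd_sq (P 0 - 1) (by omega)
      push_cast at h2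
      nlinarith [sq_nonneg ((P 2 : ℝ))]
    · have h2 := odd_sq (P 2) (by omega)
      nlinarith [sq_nonneg ((P 0 : ℝ) - 1)]

theorem tetrahedronSign_reference : tetrahedronSign referenceTetrahedron ≠ 0 := by
  unfold tetrahedronSign
  rw [Ne, sign_eq_zero_iff, Matrix.det_fin_three]
  simp [referenceTetrahedron]
  norm_num

/-- The orientation of a quadruple of points as a determinant of order 4. -/
theorem tetrahedronSign_eq (p : Fin 4 → E3) :
    tetrahedronSign p =
      SignType.sign (Matrix.det (Matrix.of fun k j : Fin 4 =>
        (![1, p k 0, p k 1, p k 2] : Fin 4 → ℝ) j)) := by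
  unfold tetrahedronSign
  congr 1
  rw [Matrix.det_fin_three, Matrix.det_succ_row_zero]
  simp [Fin.sum_univ_four, Matrix.det_fin_three, Fin.succAbove]
  ring

theorem sign_units_mul (u : ℤˣ) (x : ℝ) :
    SignType.sign (((u : ℤ) : ℝ) * x) = SignType.sign (u : ℤ) * SignType.sign x := by
  rcases Int.units_eq_one_or u with h | h <;> simp [h, Left.sign_neg]

/-- The determinant of order 4 treats the four vertices alike, so relabelling them permutes its
rows. -/
theorem tetrahedronSign_perm (p : Fin 4 → E3) (π : Equiv.Perm (Fin 4)) :
    tetrahedronSign (fun k => p (π k)) =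
      SignType.sign (Equiv.Perm.sign π : ℤ) * tetrahedronSign p := by
  rw [tetrahedronSign_eq, tetrahedronSign_eq, ← sign_units_mul, ← Matrix.det_permute]
  rfl

/-- The translation cancels in the edge vectors; the linear part permutes and scales the columns. -/
theorem tetrahedronSign_signedIso (σ : Equiv.Perm (Fin 3)) (ε : Fin 3 → ℤˣ) (T : Fin 3 → ℤ)
    (p : Fin 4 → E3) :
    tetrahedronSign (fun k => signedIso σ ε T (p k)) =
      SignType.sign ((Equiv.Perm.sign σ * ∏ i, ε i : ℤˣ) : ℤ) * tetrahedronSign p := by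
  unfold tetrahedronSign
  rw [← sign_units_mul]
  congr 1
  have h1 := Matrix.det_mul_row (fun j => ((ε j : ℤ) : ℝ))
    (Matrix.of fun i j : Fin 3 => (p i.succ - p 0) (σ j))
  have h2 := Matrix.det_permute' σ (Matrix.of fun i j : Fin 3 => (p i.succ - p 0) j)
  have h3 : (Matrix.of fun i j : Fin 3 => (p i.succ - p 0) (σ j)) =
      (Matrix.of fun i j : Fin 3 => (p i.succ - p 0) j).submatrix id σ := rfl
  rw [h3, h2] at h1
  push_cast
  rw [mul_assoc, mul_left_comm, ← h1]
  congr 1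
  ext i j
  simp
  ring

/-- The signed permutation induced by an automorphism of the lattice. -/
def inducedPerm (σ : Equiv.Perm (Fin 3)) (ε : Fin 3 → ℤˣ) (T : Fin 3 → ℤ) : SignedPerm :=
  (affPerm (∏ i, ε i) ((T 0 + T 1 + T 2 : ℤ) : ZMod 4), Equiv.Perm.sign σ * paritySign (T 0))

/-- Two coordinates of equal parity have an even sum, so changing both their signs alters the total
by a multiple of 4. Modulo 4 only the product of the three signs matters. -/
theorem sum_image_eq {P : Fin 3 → ℤ} (hP : SameParity P) (σ : Equiv.Perm (Fin 3))
    (ε : Fin 3 → ℤˣ) (T : Fin 3 → ℤ) :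
    ((((ε 0 : ℤ) * P (σ 0) + T 0) + ((ε 1 : ℤ) * P (σ 1) + T 1) + ((ε 2 : ℤ) * P (σ 2) + T 2) : ℤ)
        : ZMod 4) =
      ((((∏ i, ε i : ℤˣ) : ℤ) * (P 0 + P 1 + P 2) + (T 0 + T 1 + T 2) : ℤ) : ZMod 4) := by
  have h : P 0 + P 1 + P 2 = P (σ 0) + P (σ 1) + P (σ 2) := by
    rw [← Fin.sum_univ_three, ← Fin.sum_univ_three (fun i => P (σ i)), Equiv.sum_comp σ P]
  have h1 := hP (σ 0) (σ 1)
  have h2 := hP (σ 0) (σ 2)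
  rw [h, ZMod.intCast_eq_intCast_iff, Int.modEq_iff_dvd, Fin.prod_univ_three]
  generalize P (σ 0) = a at *
  generalize P (σ 1) = b at *
  generalize P (σ 2) = c at *
  rcases Int.units_eq_one_or (ε 0) with e0 | e0 <;>
  rcases Int.units_eq_one_or (ε 1) with e1 | e1 <;>
  rcases Int.units_eq_one_or (ε 2) with e2 | e2 <;>
  simp only [e0, e1, e2, mul_one, one_mul, Units.val_neg, Units.val_one, mul_neg, neg_neg] <;>
  omega

theorem image_mem_bccCoset {σ : Equiv.Perm (Fin 3)} {ε : Fin 3 → ℤˣ} {T : Fin 3 → ℤ}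
    (hT : SameParity T) {k : Fin 4} {p : E3} (hp : p ∈ bccCoset k) :
    signedIso σ ε T p ∈ bccCoset ((inducedPerm σ ε T).1 k) := by
  obtain ⟨P, hP, rfl, hk⟩ := (mem_bccCoset_iff k p).1 hp
  rw [signedIso_halfPoint, mem_bccCoset_iff]
  refine ⟨_, hT.image hP σ ε, rfl, ?_⟩
  rw [sum_image_eq hP, ← hk]
  change _ = ((((∏ i, ε i : ℤˣ) : ℤ) : ZMod 4) * ((P 0 + P 1 + P 2 : ℤ) : ZMod 4) +
    ((T 0 + T 1 + T 2 : ℤ) : ZMod 4))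
  push_cast
  ring

theorem induces_signedIso {σ : Equiv.Perm (Fin 3)} {ε : Fin 3 → ℤˣ} {T : Fin 3 → ℤ}
    (hT : SameParity T) : Induces (signedIso σ ε T) (inducedPerm σ ε T) := by
  refine ⟨fun k => Set.Subset.antisymm ?_ ?_, fun p _ => ?_⟩
  · rintro _ ⟨p, hp, rfl⟩
    exact image_mem_bccCoset hT hp
  · intro p hp
    have hb : signedIso σ ε T '' bcc = bcc := signedIso_mem_latticeAut hT
    obtain ⟨q, hq, rfl⟩ : p ∈ signedIso σ ε T '' bcc := by rw [hb]; exact hp.1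
    rw [bcc_eq_iUnion, Set.mem_iUnion] at hq
    obtain ⟨l, hl⟩ := hq
    have := (inducedPerm σ ε T).1.injective (bccCoset_unique (image_mem_bccCoset hT hl) hp)
    exact ⟨q, this ▸ hl, rfl⟩
  -- The isometry contributes `sign σ * ∏ ε`, the relabelling `∏ ε * (-1) ^ (T 0 + T 1 + T 2)`. The
  -- products of the signs cancel, and the sum has the parity of `T 0`.
  · rw [tetrahedronSign_signedIso σ ε T (fun k => p ((inducedPerm σ ε T).1⁻¹ k)),
      tetrahedronSign_perm, ← mul_assoc, ← sign_mul, Equiv.Perm.sign_inv]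
    congr 2
    rw [← Units.val_mul]
    congr 1
    simp only [inducedPerm]
    rw [sign_affPerm]
    have hpar : paritySign (T 0 + T 1 + T 2) = paritySign (T 0) := by
      have h1 := hT 0 1
      have h2 := hT 0 2
      have : (T 0 + T 1 + T 2) % 2 = T 0 % 2 := by omega
      simp [paritySign, this]
    rw [hpar]
    rcases Int.units_eq_one_or (∏ i, ε i) with h | h <;> simp [h]

/-- A single nondegenerate Delaunay tetrahedron detects both the permutation and the sign. -/
theorem Induces.unique {g : Isom3} {s t : SignedPerm} (hs : Induces g s) (ht : Induces g t) :
    s = t := by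
  have h1 : s.1 = t.1 := by
    ext k : 1
    have hm : g (referenceTetrahedron k) ∈ g '' bccCoset k := ⟨_, referenceTetrahedron_mem k, rfl⟩
    have h1 := hm
    rw [hs.1] at h1
    rw [ht.1] at hm
    exact bccCoset_unique h1 hm
  refine Prod.ext h1 ?_
  have h2 := hs.2 _ referenceTetrahedron_isDelaunay
  have h3 := ht.2 _ referenceTetrahedron_isDelaunay
  rw [h1, h3] at h2
  have h4 := mul_right_cancel₀ tetrahedronSign_reference h2
  rcases Int.units_eq_one_or s.2 with h | h <;> rcases Int.units_eq_one_or t.2 with h' | h' <;>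
    rw [h, h'] at h4 ⊢ <;> revert h4 <;> decide

theorem Induces.mem_latticeAut {g : Isom3} {s : SignedPerm} (h : Induces g s) : g ∈ latticeAut :=
  h.image_bcc

theorem induces_signedIso_iff {σ : Equiv.Perm (Fin 3)} {ε : Fin 3 → ℤˣ} {T : Fin 3 → ℤ}
    (hT : SameParity T) (s : SignedPerm) :
    Induces (signedIso σ ε T) s ↔ s = inducedPerm σ ε T :=
  ⟨fun h => h.unique (induces_signedIso hT), fun h => h ▸ induces_signedIso hT⟩

theorem exists_induces {g : Isom3} (hg : g ∈ latticeAut) : ∃ s, Induces g s := by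
  obtain ⟨σ, ε, T, hT, rfl⟩ := (mem_latticeAut_iff g).1 hg
  exact ⟨_, induces_signedIso hT⟩

/-! ### The diagonal lines -/

/-- The signs of the direction of the diagonal line through a lattice point, in terms of its
doubled coordinates modulo 4. -/
def lineDir (a b c : ZMod 4) : Fin 3 → ℤˣ :=
  if a = b ∧ b = c then ![1, 1, 1]
  -- `2 * a = 0` modulo 4 singles out the integral points. From here on exactly one pair of
  -- coordinates agrees, because residues modulo 4 of equal parity take only two values.
  else if 2 * a = 0 then
    if c = a then ![-1, 1, 1] else if a = b then ![1, -1, 1] else ![1, 1, -1]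
  else
    if a = b then ![-1, 1, 1] else if b = c then ![1, -1, 1] else ![1, 1, -1]

/-- The direction of the diagonal line through the point with the given doubled coordinates. -/
def pointDir (P : Fin 3 → ℤ) : Fin 3 → ℤˣ := lineDir (P 0) (P 1) (P 2)

/-- The vector with the given signs as its coordinates. -/
noncomputable def dirVec (u : Fin 3 → ℤˣ) : E3 := WithLp.toLp 2 fun i => ((u i : ℤ) : ℝ)

@[simp] theorem dirVec_apply (u : Fin 3 → ℤˣ) (i : Fin 3) : dirVec u i = ((u i : ℤ) : ℝ) := rfl

/-- The line through `p` in direction `d`. -/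
def lineThrough (p d : E3) : Set E3 := {q | ∃ t : ℝ, q = p + t • d}

theorem congrMod2_half (m n : ℤ) :
    CongrMod2 ((m : ℝ) / 2) ((n : ℝ) / 2) ↔ (m : ZMod 4) = n := by
  rw [ZMod.intCast_eq_intCast_iff, Int.modEq_iff_dvd]
  constructor
  · rintro ⟨k, hk⟩
    have : (m : ℝ) - n = 4 * k := by linarith
    have : m - n = 4 * k := by exact_mod_cast this
    exact ⟨-k, by push_cast; linarith⟩
  · rintro ⟨k, hk⟩
    refine ⟨-k, ?_⟩
    have : (n : ℝ) - m = 4 * k := by exact_mod_cast hk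
    push_cast
    linarith

theorem two_mul_intCast_eq_zero (n : ℤ) : 2 * (n : ZMod 4) = 0 ↔ n % 2 = 0 := by
  have : 2 * (n : ZMod 4) = ((2 * n : ℤ) : ZMod 4) := by push_cast; ring
  rw [this, ZMod.intCast_zmod_eq_zero_iff_dvd]
  push_cast
  omega

theorem isIntPoint_half_iff {P : Fin 3 → ℤ} (hP : SameParity P) :
    IsIntPoint (halfPoint P) ↔ P 0 % 2 = 0 := by
  constructor
  · intro h
    obtain ⟨n, hn⟩ := h 0
    simp only [halfPoint_apply] at hn
    have : (P 0 : ℝ) = 2 * n := by linarith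
    have : P 0 = 2 * n := by exact_mod_cast this
    omega
  · intro h i
    obtain ⟨n, hn⟩ : ∃ n, P i = 2 * n := ⟨P i / 2, by have := hP i 0; omega⟩
    exact ⟨n, by simp [hn]⟩

theorem isHalfPoint_half_iff {P : Fin 3 → ℤ} (hP : SameParity P) :
    IsHalfPoint (halfPoint P) ↔ ¬ P 0 % 2 = 0 := by
  constructor
  · intro h
    obtain ⟨n, hn⟩ := h 0
    simp only [halfPoint_apply] at hn
    have : (P 0 : ℝ) = 2 * n + 1 := by linarith
    have : P 0 = 2 * n + 1 := by exact_mod_cast this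
    omega
  · intro h i
    obtain ⟨n, hn⟩ : ∃ n, P i = 2 * n + 1 := ⟨P i / 2, by have := hP i 0; omega⟩
    exact ⟨n, by simp [hn]; ring⟩

theorem SameParity.zmod {P : Fin 3 → ℤ} (hP : SameParity P) :
    2 * (P 0 : ZMod 4) = 2 * (P 1 : ZMod 4) ∧ 2 * (P 0 : ZMod 4) = 2 * (P 2 : ZMod 4) := by
  have h : ∀ m n : ℤ, m % 2 = n % 2 → 2 * (m : ZMod 4) = 2 * (n : ZMod 4) := fun m n h => by
    have : ((2 * m : ℤ) : ZMod 4) = ((2 * n : ℤ) : ZMod 4) := by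
      rw [ZMod.intCast_eq_intCast_iff, Int.modEq_iff_dvd]
      push_cast
      omega
    push_cast at this
    exact this
  exact ⟨h _ _ (hP 0 1), h _ _ (hP 0 2)⟩

theorem toLp_eq_dirVec {x y z : ℝ} {a b c : ℤˣ} (h0 : ((a : ℤ) : ℝ) = x) (h1 : ((b : ℤ) : ℝ) = y)
    (h2 : ((c : ℤ) : ℝ) = z) : (!₂[x, y, z] : E3) = dirVec ![a, b, c] := by
  ext i
  fin_cases i <;> simp [h0, h1, h2]

theorem liesOnLine_half_iff {P : Fin 3 → ℤ} (hP : SameParity P) (d : E3) :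
    LiesOnLine (halfPoint P) d ↔ d = dirVec (pointDir P) := by
  obtain ⟨h1, h2⟩ := hP.zmod
  unfold LiesOnLine pointDir lineDir
  simp only [isIntPoint_half_iff hP, isHalfPoint_half_iff hP, halfPoint_apply, congrMod2_half,
    ← two_mul_intCast_eq_zero]
  rw [toLp_eq_dirVec (a := 1) (b := 1) (c := 1), toLp_eq_dirVec (a := -1) (b := 1) (c := 1),
    toLp_eq_dirVec (a := 1) (b := -1) (c := 1), toLp_eq_dirVec (a := 1) (b := 1) (c := -1)]
  · generalize (P 0 : ZMod 4) = a at *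
    generalize (P 1 : ZMod 4) = b at *
    generalize (P 2 : ZMod 4) = c at *
    -- By pigeonhole among the two residues of the given parity; with transitivity this excludes the
    -- impossible cases below.
    have h3 : a = b ∨ b = c ∨ c = a := by revert a b c; decide
    have t1 : a = b → b = c → c = a := fun e1 e2 => (e1.trans e2).symm
    have t2 : a = b → c = a → b = c := fun e1 e2 => (e2.trans e1).symm
    have t3 : b = c → c = a → a = b := fun e1 e2 => (e1.trans e2).symm
    rcases Classical.propComplete (2 * a = 0) with e0 | e0 <;>
    rcases Classical.propComplete (a = b) with e1 | e1 <;>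
    rcases Classical.propComplete (b = c) with e2 | e2 <;>
    rcases Classical.propComplete (c = a) with e3 | e3 <;>
    simp only [e1, e2, e3, not_true, not_false_eq_true, or_false, or_true, imp_false,
      implies_true] at h3 t1 t2 t3 <;>
    simp [e0, e1, e2, e3]
  all_goals simp

theorem LiesOnLine.mem_bcc {p d : E3} (h : LiesOnLine p d) : p ∈ bcc := by
  rcases h with h | h
  · exact Or.inl h.1
  · exact Or.inr h.1

theorem mem_diagonalLines_iff (L : Set E3) :
    L ∈ diagonalLines ↔
      ∃ P, SameParity P ∧ L = lineThrough (halfPoint P) (dirVec (pointDir P)) := by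
  constructor
  · rintro ⟨p, d, h, rfl⟩
    obtain ⟨P, hP, rfl⟩ := (mem_bcc_iff p).1 h.mem_bcc
    rw [liesOnLine_half_iff hP] at h
    subst h
    exact ⟨P, hP, rfl⟩
  · rintro ⟨P, hP, rfl⟩
    exact ⟨_, _, (liesOnLine_half_iff hP _).2 rfl, rfl⟩

theorem signedIso_image_line (σ : Equiv.Perm (Fin 3)) (ε : Fin 3 → ℤˣ) (T P : Fin 3 → ℤ)
    {u v : Fin 3 → ℤˣ}
    (h : v = (fun i => ε i * u (σ i)) ∨ v = fun i => -(ε i * u (σ i))) :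
    signedIso σ ε T '' lineThrough (halfPoint P) (dirVec u) =
      lineThrough (halfPoint fun i => (ε i : ℤ) * P (σ i) + T i) (dirVec v) := by
  obtain ⟨w, hw⟩ : ∃ w : ℤˣ, ∀ i, v i = w * (ε i * u (σ i)) := by
    rcases h with rfl | rfl
    · exact ⟨1, by simp⟩
    · exact ⟨-1, by simp⟩
  have key : ∀ t : ℝ, signedIso σ ε T (halfPoint P + t • dirVec u) =
      (halfPoint fun i => (ε i : ℤ) * P (σ i) + T i) + (((w : ℤ) : ℝ) * t) • dirVec v := by
    intro t
    ext i
    rcases Int.units_eq_one_or w with h | h <;> simp [hw, h] <;> ring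
  ext q
  constructor
  · rintro ⟨_, ⟨t, rfl⟩, rfl⟩
    exact ⟨_, key t⟩
  · rintro ⟨t, rfl⟩
    refine ⟨_, ⟨((w : ℤ) : ℝ) * t, rfl⟩, ?_⟩
    rw [key]
    rcases Int.units_eq_one_or w with h | h <;> simp [h]

/-- The direction of the line through a lattice point depends only on the doubled coordinates modulo
4, so the hypothesis can be decided by finitely many cases. -/
theorem signedIso_mem_lineGroup {σ : Equiv.Perm (Fin 3)} {ε : Fin 3 → ℤˣ} {T : Fin 3 → ℤ}
    (hT : SameParity T)
    (h : ∀ P, SameParity P →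
      pointDir (fun i => (ε i : ℤ) * P (σ i) + T i) = (fun i => ε i * pointDir P (σ i)) ∨
      pointDir (fun i => (ε i : ℤ) * P (σ i) + T i) = fun i => -(ε i * pointDir P (σ i))) :
    signedIso σ ε T ∈ lineGroup := by
  apply Set.Subset.antisymm
  · rintro _ ⟨L, hL, rfl⟩
    obtain ⟨P, hP, rfl⟩ := (mem_diagonalLines_iff L).1 hL
    exact (mem_diagonalLines_iff _).2 ⟨_, hT.image hP σ ε, signedIso_image_line σ ε T P (h P hP)⟩
  · intro L hL
    obtain ⟨Q, hQ, rfl⟩ := (mem_diagonalLines_iff L).1 hL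
    have hb : signedIso σ ε T '' bcc = bcc := signedIso_mem_latticeAut hT
    obtain ⟨q, hq, hqQ⟩ : halfPoint Q ∈ signedIso σ ε T '' bcc := by
      rw [hb]; exact (mem_bcc_iff _).2 ⟨Q, hQ, rfl⟩
    obtain ⟨P, hP, rfl⟩ := (mem_bcc_iff q).1 hq
    rw [signedIso_halfPoint] at hqQ
    obtain rfl := halfPoint_injective hqQ
    exact ⟨_, (mem_diagonalLines_iff _).2 ⟨P, hP, rfl⟩, signedIso_image_line σ ε T P (h P hP)⟩

theorem eq_of_lineThrough_eq {p q : E3} {u v : Fin 3 → ℤˣ}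
    (h : lineThrough p (dirVec u) = lineThrough q (dirVec v)) :
    (u = v ∨ u = -v) ∧ ∃ t : ℝ, ∀ i, p i = q i + t * ((v i : ℤ) : ℝ) := by
  obtain ⟨t, ht⟩ : p ∈ lineThrough q (dirVec v) := h ▸ ⟨0, by simp⟩
  obtain ⟨s, hs⟩ : p + dirVec u ∈ lineThrough q (dirVec v) := h ▸ ⟨1, by simp⟩
  have h1 : ∀ i, p i = q i + t * ((v i : ℤ) : ℝ) := fun i => by
    have := congrArg (fun y : E3 => y i) ht
    simpa using this
  have h2 : ∀ i, ((u i : ℤ) : ℝ) = (s - t) * ((v i : ℤ) : ℝ) := fun i => by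
    have := congrArg (fun y : E3 => y i) hs
    simp only [PiLp.add_apply, PiLp.smul_apply, dirVec_apply, smul_eq_mul] at this
    have := h1 i
    linarith
  refine ⟨?_, t, h1⟩
  -- Both direction vectors have entries `±1`, which pins down their ratio.
  have h3 : s - t = 1 ∨ s - t = -1 := by
    have := h2 0
    rcases Int.units_eq_one_or (u 0) with h | h <;>
    rcases Int.units_eq_one_or (v 0) with h' | h' <;>
      simp only [h, h', Units.val_neg, Units.val_one, Int.cast_neg, Int.cast_one] at this
    · left; linarith
    · right; linarith
    · right; linarith
    · left; linarith
  rcases h3 with h3 | h3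
  · left
    funext i
    have := h2 i
    rw [h3, one_mul] at this
    exact Units.ext (by exact_mod_cast this)
  · right
    funext i
    have := h2 i
    rw [h3, neg_one_mul] at this
    exact Units.ext (by simpa using (by exact_mod_cast this : (u i : ℤ) = -(v i : ℤ)))

/-- Two test lines suffice: those through `(0, 0, 0)` and `(0, 1, 0)`, in directions `(1, 1, 1)` and
`(-1, 1, 1)`. Along the first the differences of the coordinates are constant, along the second the
sum of the first and the third. -/
theorem translation_mem_lineGroup_iff {T : Fin 3 → ℤ} (hT : SameParity T) :
    signedIso 1 1 T ∈ lineGroup ↔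
      2 * (T 0 : ZMod 4) = 0 ∧ (T 1 : ZMod 4) = T 0 ∧ (T 2 : ZMod 4) = T 0 := by
  constructor
  · intro h
    have key : ∀ P, SameParity P → ∃ Q : Fin 3 → ℤ, SameParity Q ∧
        (pointDir P = pointDir Q ∨ pointDir P = -pointDir Q) ∧
        ∃ t : ℝ, ∀ i, ((P i + T i : ℝ)) / 2 = (Q i : ℝ) / 2 + t * ((pointDir Q i : ℤ) : ℝ) := by
      intro P hP
      have h1 : signedIso 1 1 T '' lineThrough (halfPoint P) (dirVec (pointDir P)) ∈
          diagonalLines := by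
        have h2 : (fun L : Set E3 => signedIso 1 1 T '' L) '' diagonalLines = diagonalLines := h
        have h3 := Set.mem_image_of_mem (fun L : Set E3 => signedIso 1 1 T '' L)
          ((mem_diagonalLines_iff _).2 ⟨P, hP, rfl⟩)
        rw [h2] at h3
        exact h3
      rw [signedIso_image_line 1 1 T P (v := pointDir P) (Or.inl (by simp))] at h1
      obtain ⟨Q, hQ, hL⟩ := (mem_diagonalLines_iff _).1 h1
      obtain ⟨h3, t, ht⟩ := eq_of_lineThrough_eq hL
      refine ⟨Q, hQ, h3, t, fun i => ?_⟩
      rw [← halfPoint_apply Q, ← ht i]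
      simp
    obtain ⟨Q, hQ, h1, t, ht⟩ := key 0 (fun i j => rfl)
    obtain ⟨S, hS, h2, s, hs⟩ := key ![0, 2, 0] (by simp [sameParity_iff])
    -- The invariants of the lines in these two directions: in doubled coordinates modulo 4, all the
    -- coordinates are equal, respectively `a + c = 0`.
    have fact1 : ∀ a b c : ZMod 4, 2 * a = 2 * b → 2 * a = 2 * c →
        (lineDir 0 0 0 = lineDir a b c ∨ lineDir 0 0 0 = -lineDir a b c) →
        (a = b ∧ a = c) ∧ lineDir a b c = ![1, 1, 1] := by decide
    have fact2 : ∀ a b c : ZMod 4, 2 * a = 2 * b → 2 * a = 2 * c →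
        (lineDir 0 2 0 = lineDir a b c ∨ lineDir 0 2 0 = -lineDir a b c) →
        a + c = 0 ∧ lineDir a b c = ![-1, 1, 1] := by decide
    obtain ⟨⟨e1, e2⟩, e3⟩ := fact1 _ _ _ hQ.zmod.1 hQ.zmod.2 (by simpa [pointDir] using h1)
    obtain ⟨f1, f2⟩ := fact2 _ _ _ hS.zmod.1 hS.zmod.2 (by simpa [pointDir] using h2)
    simp only [pointDir, e3, f2] at ht hs
    have a0 := ht 0
    have a1 := ht 1
    have a2 := ht 2
    have b0 := hs 0
    have b2 := hs 2
    simp at a0 a1 a2 b0 b2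
    have c1 : (T 1 - T 0 : ℤ) = Q 1 - Q 0 := by
      have : (T 1 - T 0 : ℝ) = Q 1 - Q 0 := by linarith
      exact_mod_cast this
    have c2 : (T 2 - T 0 : ℤ) = Q 2 - Q 0 := by
      have : (T 2 - T 0 : ℝ) = Q 2 - Q 0 := by linarith
      exact_mod_cast this
    have c3 : (T 0 + T 2 : ℤ) = S 0 + S 2 := by
      have : (T 0 + T 2 : ℝ) = S 0 + S 2 := by linarith
      exact_mod_cast this
    have c1' := congrArg (Int.cast : ℤ → ZMod 4) c1
    have c2' := congrArg (Int.cast : ℤ → ZMod 4) c2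
    have c3' := congrArg (Int.cast : ℤ → ZMod 4) c3
    push_cast at c1' c2' c3'
    rw [← e1, sub_self, sub_eq_zero] at c1'
    rw [← e2, sub_self, sub_eq_zero] at c2'
    rw [f1, c2', ← two_mul] at c3'
    exact ⟨c3', c1', c2'⟩
  · rintro ⟨h1, h2, h3⟩
    refine signedIso_mem_lineGroup hT fun P hP => ?_
    have hz := hP.zmod
    simp only [pointDir, Pi.one_apply, Units.val_one, one_mul, Equiv.Perm.coe_one, id_eq,
      Int.cast_add, h2, h3]
    left
    generalize (P 0 : ZMod 4) = a at *
    generalize (P 1 : ZMod 4) = b at *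
    generalize (P 2 : ZMod 4) = c at *
    generalize (T 0 : ZMod 4) = t at *
    clear h2 h3 hT hP
    revert t a b c
    decide

/-! ### Symmetries of the set of lines -/

/-- The cyclic permutation of the coordinates. -/
def cyc3 : Equiv.Perm (Fin 3) := finRotate 3

theorem cyc3_apply (i : Fin 3) : cyc3 i = i + 1 := by revert i; decide

theorem cyc_mem_lineGroup : signedIso cyc3 1 0 ∈ lineGroup := by
  refine signedIso_mem_lineGroup (fun i j => rfl) fun P hP => ?_
  have hz := hP.zmod
  simp only [pointDir, Pi.one_apply, Units.val_one, one_mul, cyc3_apply, Pi.zero_apply, add_zero,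
    zero_add, show (1 + 1 : Fin 3) = 2 from rfl, show (2 + 1 : Fin 3) = 0 from rfl]
  generalize (P 0 : ZMod 4) = a at *
  generalize (P 1 : ZMod 4) = b at *
  generalize (P 2 : ZMod 4) = c at *
  clear hP
  revert a b c
  decide

theorem inversion_mem_lineGroup : signedIso 1 (-1) 0 ∈ lineGroup := by
  refine signedIso_mem_lineGroup (fun i j => rfl) fun P hP => ?_
  have hz := hP.zmod
  simp only [pointDir, Pi.neg_apply, Pi.one_apply, Units.val_neg, Units.val_one, neg_mul, one_mul,
    Equiv.Perm.coe_one, id_eq, Pi.zero_apply, add_zero, Int.cast_neg]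
  generalize (P 0 : ZMod 4) = a at *
  generalize (P 1 : ZMod 4) = b at *
  generalize (P 2 : ZMod 4) = c at *
  clear hP
  revert a b c
  decide

/-- A transposition of the coordinates interchanges the rules for integral and half-integral points;
the translation by `(1/2, 1/2, 1/2)` interchanges these points back and keeps all congruences
between coordinates. -/
theorem swap_mem_lineGroup : signedIso (Equiv.swap 0 1) 1 1 ∈ lineGroup := by
  refine signedIso_mem_lineGroup (fun i j => rfl) fun P hP => ?_
  have hz := hP.zmod
  simp only [pointDir, Pi.one_apply, Units.val_one, one_mul, Int.cast_add, Int.cast_one,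
    Equiv.swap_apply_left, Equiv.swap_apply_right,
    show Equiv.swap (0 : Fin 3) 1 2 = 2 from rfl]
  generalize (P 0 : ZMod 4) = a at *
  generalize (P 1 : ZMod 4) = b at *
  generalize (P 2 : ZMod 4) = c at *
  clear hP
  revert a b c
  decide

theorem screw_mem_lineGroup : signedIso 1 ![1, -1, -1] ![2, 0, 2] ∈ lineGroup := by
  refine signedIso_mem_lineGroup (by simp [sameParity_iff]) fun P hP => ?_
  have hz := hP.zmod
  simp [pointDir]
  generalize (P 0 : ZMod 4) = a at *
  generalize (P 1 : ZMod 4) = b at *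
  generalize (P 2 : ZMod 4) = c at *
  clear hP
  revert a b c
  decide

/-! ### The odd subgroups -/

theorem affPerm_eq_one {u : ℤˣ} {b : ZMod 4} (h : affPerm u b = 1) : u = 1 ∧ b = 0 := by
  have h1 : ∀ k : ZMod 4, ((u : ℤ) : ZMod 4) * k + b = k := fun k =>
    congrArg (fun f : Equiv.Perm (Fin 4) => f k) h
  revert u b
  decide

/-- The dihedral group of order 8 has exponent 4. -/
theorem affPerm_pow_four (u : ℤˣ) (b : ZMod 4) : affPerm u b ^ 4 = 1 := by
  have h1 : affPerm (1 : ℤˣ) 0 = 1 := by decide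
  rw [pow_mul (affPerm u b) 2 2, pow_two, pow_two, affPerm_mul, affPerm_mul, ← h1]
  congr 1
  · rcases Int.units_eq_one_or u with h | h <;> simp [h]
  · revert u b
    decide

/-- The kernel consists of tetrahedral rotations with translation part in `D₃`. The evenness of `T
0` comes for free from the colours: three numbers of equal parity with a sum divisible by 4 are
even. -/
theorem induces_one_iff {σ : Equiv.Perm (Fin 3)} {ε : Fin 3 → ℤˣ} {T : Fin 3 → ℤ}
    (hT : SameParity T) :
    Induces (signedIso σ ε T) 1 ↔
      Equiv.Perm.sign σ = 1 ∧ ε 0 * ε 1 * ε 2 = 1 ∧ T 0 % 2 = 0 ∧ (T 0 + T 1 + T 2) % 4 = 0 := by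
  rw [induces_signedIso_iff hT, inducedPerm, Prod.ext_iff, Fin.prod_univ_three]
  have h0 := hT 0 1
  have h1 := hT 0 2
  constructor
  · rintro ⟨h2, h3⟩
    obtain ⟨h4, h5⟩ := affPerm_eq_one h2.symm
    rw [ZMod.intCast_zmod_eq_zero_iff_dvd] at h5
    push_cast at h5
    have h6 : T 0 % 2 = 0 := by omega
    refine ⟨?_, h4, h6, by omega⟩
    simp [paritySign, h6] at h3
    exact h3.symm
  · rintro ⟨h2, h3, h4, h5⟩
    constructor
    · have h6 : ((T 0 + T 1 + T 2 : ℤ) : ZMod 4) = 0 := by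
        rw [ZMod.intCast_zmod_eq_zero_iff_dvd]
        push_cast
        omega
      rw [h3, h6]
      exact (by decide : (1 : Equiv.Perm (Fin 4)) = affPerm 1 0)
    · simp [paritySign, h4, h2]

/-- The order of the induced signed permutation divides both 3 and 4. -/
theorem induces_one_of_orderOf {g : Isom3} (hg : g ∈ latticeAut) (h3 : orderOf g = 3) :
    Induces g 1 := by
  obtain ⟨σ, ε, T, hT, rfl⟩ := (mem_latticeAut_iff g).1 hg
  have h := induces_signedIso (σ := σ) (ε := ε) hT
  have h4 : inducedPerm σ ε T ^ 4 = 1 := by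
    refine Prod.ext (affPerm_pow_four _ _) ?_
    rw [Prod.pow_snd]
    rcases Int.units_eq_one_or (inducedPerm σ ε T).2 with h | h <;> rw [h] <;> rfl
  have hp := pow_orderOf_eq_one (signedIso σ ε T)
  rw [h3] at hp
  have h5 : inducedPerm σ ε T ^ 3 = 1 := by
    have h6 := (h.mul h).mul h
    rw [← pow_two, ← pow_succ, hp, ← pow_two, ← pow_succ] at h6
    exact h6.unique Induces.one
  rw [pow_succ, h5, one_mul] at h4
  rwa [h4] at h

theorem mem_fullGroup_bot (g : Isom3) : g ∈ fullGroup ⊥ ↔ Induces g 1 := by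
  constructor
  · rintro ⟨s, hs, h⟩
    rw [Subgroup.mem_bot] at hs
    rwa [hs] at h
  · exact fun h => ⟨1, Subgroup.mem_bot.2 rfl, h⟩

theorem fullGroup_le_latticeAut (S : Subgroup SignedPerm) : fullGroup S ≤ latticeAut := by
  rintro g ⟨s, _, h⟩
  exact h.mem_latticeAut

/-- The cube has trivial linear part, so it is a translation; `hT` says that this translation
vanishes, i.e. that the motion is a rotation and not a screw. -/
theorem orderOf_signedIso_cyc {ε : Fin 3 → ℤˣ} {T : Fin 3 → ℤ} (hε : ε 0 * ε 1 * ε 2 = 1)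
    (hT : T 0 + (ε 0 : ℤ) * T 1 + (ε 0 : ℤ) * (ε 1 : ℤ) * T 2 = 0) :
    orderOf (signedIso cyc3 ε T) = 3 := by
  refine orderOf_eq_prime ?_ ?_
  · have e2 : ε 2 = ε 0 * ε 1 := by
      rcases Int.units_eq_one_or (ε 0) with h | h <;>
      rcases Int.units_eq_one_or (ε 1) with h' | h' <;>
      rw [h, h'] at hε ⊢ <;> simp at hε ⊢
      · exact hε
      · exact neg_eq_iff_eq_neg.1 hε
      · exact neg_eq_iff_eq_neg.1 hε
      · exact hε
    rw [pow_succ, pow_two, signedIso_mul, signedIso_mul, ← signedIso_one]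
    refine signedIso_congr (by decide) (fun i => ?_) (fun i => ?_) <;>
    fin_cases i <;>
    simp [cyc3_apply, show (1 + 1 : Fin 3) = 2 from rfl, show (2 + 1 : Fin 3) = 0 from rfl, e2] <;>
    rcases Int.units_eq_one_or (ε 0) with h | h <;>
    rcases Int.units_eq_one_or (ε 1) with h' | h' <;>
    simp [h, h'] at hT ⊢ <;> omega
  · rw [← signedIso_one]
    intro h
    exact absurd (signedIso_injective h).1 (by decide)

/-- The translations (in half units) of a group form a group. -/
def translationVectors (U : Subgroup Isom3) : AddSubgroup (Fin 3 → ℤ) where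
  carrier := {T | signedIso 1 1 T ∈ U}
  zero_mem' := by
    change signedIso 1 1 0 ∈ U
    rw [signedIso_one]
    exact U.one_mem
  add_mem' := by
    intro T S hT hS
    have h := U.mul_mem hS hT
    rw [signedIso_mul] at h
    change signedIso 1 1 (T + S) ∈ U
    convert h using 1
    exact signedIso_congr (by simp) (fun i => by simp) (fun i => by simp)
  neg_mem' := by
    intro T hT
    have h := U.inv_mem hT
    rw [signedIso_inv] at h
    change signedIso 1 1 (-T) ∈ U
    convert h using 1
    exact signedIso_congr (by simp) (fun i => by simp) (fun i => by simp)

theorem mem_translationVectors {U : Subgroup Isom3} {T : Fin 3 → ℤ} :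
    T ∈ translationVectors U ↔ signedIso 1 1 T ∈ U := Iff.rfl

theorem translationVectors_conj {U : Subgroup Isom3} {σ : Equiv.Perm (Fin 3)} {ε : Fin 3 → ℤˣ}
    {S T : Fin 3 → ℤ} (h : signedIso σ ε S ∈ U) (hT : T ∈ translationVectors U) :
    (fun i => (ε i : ℤ) * T (σ i)) ∈ translationVectors U := by
  have h1 := U.mul_mem (U.mul_mem h hT) (U.inv_mem h)
  rw [signedIso_mul, signedIso_inv, signedIso_mul] at h1
  rw [mem_translationVectors]
  convert h1 using 1
  refine signedIso_congr (by simp) (fun i => ?_) (fun i => ?_)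
  · simp
  · rcases Int.units_eq_one_or (ε i) with h | h <;> simp [h]

theorem eq_cyc3_pow {σ : Equiv.Perm (Fin 3)} (h : Equiv.Perm.sign σ = 1) :
    ∃ n : ℕ, σ = cyc3 ^ n := by
  have : σ = cyc3 ^ 0 ∨ σ = cyc3 ^ 1 ∨ σ = cyc3 ^ 2 := by
    revert σ
    decide
  rcases this with h | h | h
  exacts [⟨_, h⟩, ⟨_, h⟩, ⟨_, h⟩]

theorem signedIso_cyc3_pow (n : ℕ) : signedIso (cyc3 ^ n) 1 0 = signedIso cyc3 1 0 ^ n := by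
  induction n with
  | zero => simp [signedIso_one]
  | succ n ih =>
    rw [pow_succ (signedIso cyc3 1 0), ← ih, signedIso_mul]
    exact signedIso_congr (pow_succ' _ _) (fun i => by simp) (fun i => by simp)

/-- Decomposition into a translation, an isometry with diagonal linear part, and a cyclic
permutation of the coordinates. -/
theorem signedIso_decomp (σ : Equiv.Perm (Fin 3)) (ε : Fin 3 → ℤˣ) (T S : Fin 3 → ℤ) :
    signedIso σ ε T = signedIso 1 1 (T - S) * signedIso 1 ε S * signedIso σ 1 0 := by
  rw [signedIso_mul, signedIso_mul]
  exact signedIso_congr (by simp) (fun i => by simp) (fun i => by simp)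

theorem signs_of_prod_eq_one {ε : Fin 3 → ℤˣ} (h : ε 0 * ε 1 * ε 2 = 1) :
    ε = ![1, 1, 1] ∨ ε = ![1, -1, -1] ∨ ε = ![-1, 1, -1] ∨ ε = ![-1, -1, 1] := by
  revert ε
  decide

/-- One inclusion is `induces_one_of_orderOf`. For the other, quotients of threefold rotations give
the half-turns and enough translations to generate `D₃`. -/
theorem T1_eq : T1 = fullGroup ⊥ := by
  apply le_antisymm
  · rw [T1, oddSubgroup, Subgroup.closure_le]
    rintro g ⟨hg, h3⟩
    exact (mem_fullGroup_bot g).2 (induces_one_of_orderOf hg h3)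
  · intro g hg
    obtain ⟨σ, ε, T, hT, rfl⟩ := (mem_latticeAut_iff g).1 (fullGroup_le_latticeAut _ hg)
    rw [mem_fullGroup_bot, induces_one_iff hT] at hg
    obtain ⟨hσ, hε, h2, h4⟩ := hg
    have hcyc : ∀ (ε : Fin 3 → ℤˣ) (T : Fin 3 → ℤ), SameParity T → ε 0 * ε 1 * ε 2 = 1 →
        T 0 + (ε 0 : ℤ) * T 1 + (ε 0 : ℤ) * (ε 1 : ℤ) * T 2 = 0 → signedIso cyc3 ε T ∈ T1 :=
      fun ε T hT hε h => Subgroup.subset_closure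
        ⟨signedIso_mem_latticeAut hT, orderOf_signedIso_cyc hε h⟩
    have hc := hcyc 1 0 (fun i j => rfl) (by simp) (by simp)
    -- Dividing out the cyclic permutation leaves a diagonal linear part.
    have hdiag : ∀ (ε : Fin 3 → ℤˣ) (T : Fin 3 → ℤ), SameParity T → ε 0 * ε 1 * ε 2 = 1 →
        T 0 + (ε 0 : ℤ) * T 1 + (ε 0 : ℤ) * (ε 1 : ℤ) * T 2 = 0 → signedIso 1 ε T ∈ T1 := by
      intro ε T hT hε h
      have h1 := T1.mul_mem (hcyc ε T hT hε h) (T1.inv_mem hc)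
      rw [signedIso_inv, signedIso_mul] at h1
      convert h1 using 1
      exact signedIso_congr (by simp) (fun i => by simp) (fun i => by simp)
    obtain ⟨n, rfl⟩ := eq_cyc3_pow hσ
    rw [signedIso_decomp _ ε T 0, signedIso_cyc3_pow]
    refine T1.mul_mem (T1.mul_mem ?_ (hdiag ε 0 (fun i j => rfl) hε (by simp))) (T1.pow_mem hc n)
    rw [← mem_translationVectors, sub_zero]
    have t1 : ![2, -2, 0] ∈ translationVectors T1 :=
      hdiag 1 ![2, -2, 0] (by simp [sameParity_iff]) (by simp) (by simp)
    have t2 : ![0, 2, -2] ∈ translationVectors T1 :=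
      hdiag 1 ![0, 2, -2] (by simp [sameParity_iff]) (by simp) (by simp)
    -- This vector violates the condition in `hdiag`; it is the image of `t1` under a half-turn.
    have t3 : ![2, 2, 0] ∈ translationVectors T1 := by
      have h1 := translationVectors_conj
        (hdiag ![1, -1, -1] 0 (fun i j => rfl) (by simp) (by simp)) t1
      convert h1 using 1
      funext i
      fin_cases i <;> simp
    have e : T = (T 0 / 2 - (T 0 + T 1 + T 2) / 4) • ![2, -2, 0] + (-(T 2 / 2)) • ![0, 2, -2] +
        ((T 0 + T 1 + T 2) / 4) • ![2, 2, 0] := by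
      have := hT 0 1
      have := hT 0 2
      funext i
      fin_cases i <;> simp <;> omega
    rw [e]
    exact add_mem (add_mem (zsmul_mem t1 _) (zsmul_mem t2 _)) (zsmul_mem t3 _)

/-- The translation parts of the elements of `T₂` with diagonal linear part, modulo `4`. -/
def screwPart (ε : Fin 3 → ℤˣ) (i : Fin 3) : ℤ := 1 - (ε (i + 2) : ℤ)

theorem screwPart_sameParity (ε : Fin 3 → ℤˣ) : SameParity (screwPart ε) := by
  intro i j
  unfold screwPart
  rcases Int.units_eq_one_or (ε (i + 2)) with h | h <;>
    rcases Int.units_eq_one_or (ε (j + 2)) with h' | h' <;> simp [h, h']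

theorem T2_le : T2 ≤ lineGroup ⊓ fullGroup ⊥ := by
  rw [T2, oddSubgroup, Subgroup.closure_le]
  rintro g ⟨hg, h3⟩
  exact ⟨hg.2, (mem_fullGroup_bot g).2 (induces_one_of_orderOf hg.1 h3)⟩

theorem cyc_mem_T2 : signedIso cyc3 1 0 ∈ T2 :=
  Subgroup.subset_closure ⟨⟨signedIso_mem_latticeAut (fun i j => rfl), cyc_mem_lineGroup⟩,
    orderOf_signedIso_cyc (by simp) (by simp)⟩

theorem signedIso_conj_cyc {U : Subgroup Isom3} (hc : signedIso cyc3 1 0 ∈ U)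
    {ε : Fin 3 → ℤˣ} {T : Fin 3 → ℤ} (h : signedIso 1 ε T ∈ U) :
    signedIso 1 (fun i => ε (i + 1)) (fun i => T (i + 1)) ∈ U := by
  have h1 := U.mul_mem (U.mul_mem hc h) (U.inv_mem hc)
  rw [signedIso_mul, signedIso_inv, signedIso_mul] at h1
  convert h1 using 1
  exact signedIso_congr (by simp) (fun i => by simp [cyc3_apply]) (fun i => by simp [cyc3_apply])

/-- The screw motion is the quotient of two threefold rotations that preserve the lines. -/
theorem screw_mem_T2 : signedIso 1 ![1, -1, -1] ![2, 0, 2] ∈ T2 := by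
  have h : signedIso cyc3 ![1, -1, -1] ![2, 0, 2] =
      signedIso 1 ![1, -1, -1] ![2, 0, 2] * signedIso cyc3 1 0 := by
    rw [signedIso_mul]
    exact signedIso_congr (by simp) (fun i => by simp) (fun i => by simp)
  have h1 : signedIso cyc3 ![1, -1, -1] ![2, 0, 2] ∈ T2 := by
    refine Subgroup.subset_closure ⟨⟨signedIso_mem_latticeAut (by simp [sameParity_iff]), ?_⟩,
      orderOf_signedIso_cyc (by simp) (by simp)⟩
    rw [h]
    exact mul_mem screw_mem_lineGroup cyc_mem_lineGroup
  rw [h] at h1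
  exact (T2.mul_mem_cancel_right cyc_mem_T2).1 h1

/-- The square of the screw motion is the translation by `(2, 0, 0)`, and the cyclic permutation
carries it to the other axes. -/
theorem translation_mem_T2 (v : Fin 3 → ℤ) : signedIso 1 1 (4 • v) ∈ T2 := by
  have t0 : ![4, 0, 0] ∈ translationVectors T2 := by
    have h := T2.mul_mem screw_mem_T2 screw_mem_T2
    rw [signedIso_mul] at h
    rw [mem_translationVectors]
    convert h using 1
    refine signedIso_congr (by simp) (fun i => ?_) (fun i => ?_) <;> fin_cases i <;> simp
  have t2 : ![0, 0, 4] ∈ translationVectors T2 := by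
    convert translationVectors_conj cyc_mem_T2 t0 using 1
    funext i
    fin_cases i <;> rfl
  have t1 : ![0, 4, 0] ∈ translationVectors T2 := by
    convert translationVectors_conj cyc_mem_T2 t2 using 1
    funext i
    fin_cases i <;> rfl
  rw [← mem_translationVectors]
  have e : 4 • v = v 0 • ![4, 0, 0] + v 1 • ![0, 4, 0] + v 2 • ![0, 0, 4] := by
    funext i
    fin_cases i <;> simp <;> ring
  rw [e]
  exact add_mem (add_mem (zsmul_mem t0 _) (zsmul_mem t1 _)) (zsmul_mem t2 _)

theorem diag_mem_T2 {ε : Fin 3 → ℤˣ} (hε : ε 0 * ε 1 * ε 2 = 1) :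
    signedIso 1 ε (screwPart ε) ∈ T2 := by
  have s0 : signedIso 1 ![1, -1, -1] (screwPart ![1, -1, -1]) ∈ T2 := by
    have h := screw_mem_T2
    convert h using 1
    refine signedIso_congr (by simp) (fun i => by simp) (fun i => ?_)
    fin_cases i <;> simp [screwPart]
  have s2 := signedIso_conj_cyc cyc_mem_T2 s0
  have s1 := signedIso_conj_cyc cyc_mem_T2 s2
  rcases signs_of_prod_eq_one hε with rfl | rfl | rfl | rfl
  · convert T2.one_mem using 1
    rw [← signedIso_one]
    refine signedIso_congr rfl (fun i => ?_) (fun i => ?_) <;> fin_cases i <;> simp [screwPart]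
  · exact s0
  · convert s1 using 1
    refine signedIso_congr rfl (fun i => ?_) (fun i => ?_) <;> fin_cases i <;> rfl
  · convert s2 using 1
    refine signedIso_congr rfl (fun i => ?_) (fun i => ?_) <;> fin_cases i <;> rfl

/-- Every rotation of the tetrahedral group is the linear part of an element of `T₂`. -/
theorem even_mem_T2 {σ : Equiv.Perm (Fin 3)} {ε : Fin 3 → ℤˣ} (hσ : Equiv.Perm.sign σ = 1)
    (hε : ε 0 * ε 1 * ε 2 = 1) : signedIso σ ε (screwPart ε) ∈ T2 := by
  obtain ⟨n, rfl⟩ := eq_cyc3_pow hσ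
  rw [signedIso_decomp _ ε _ (screwPart ε), signedIso_cyc3_pow, sub_self, signedIso_one, one_mul]
  exact T2.mul_mem (diag_mem_T2 hε) (T2.pow_mem cyc_mem_T2 n)

/-- Dividing by the element of `even_mem_T2` with the same linear part leaves a translation.
Preservation of the lines makes its entries congruent to one `t` modulo 4, and trivial action on
colours gives `3 t ≡ 0`, so all entries are divisible by 4. -/
theorem T2_eq : T2 = lineGroup ⊓ fullGroup ⊥ := by
  refine le_antisymm T2_le ?_
  rintro g ⟨hl, hg⟩
  obtain ⟨σ, ε, T, hT, rfl⟩ := (mem_latticeAut_iff g).1 (fullGroup_le_latticeAut _ hg)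
  obtain ⟨hσ, hε, h2, h4⟩ := (induces_one_iff hT).1 ((mem_fullGroup_bot _).1 hg)
  have hs := even_mem_T2 hσ hε
  have e : signedIso σ ε T = signedIso 1 1 (T - screwPart ε) * signedIso σ ε (screwPart ε) := by
    rw [signedIso_mul]
    exact signedIso_congr (by simp) (fun i => by simp) (fun i => by simp)
  have hp : SameParity (T - screwPart ε) := by
    intro i j
    have := hT i j
    have := screwPart_sameParity ε i j
    simp only [Pi.sub_apply]
    omega
  rw [e]
  refine T2.mul_mem ?_ hs
  have hs' := T2_le hs
  have hl' := (lineGroup.mul_mem_cancel_right hs'.1).1 (e ▸ hl)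
  have hg' := ((fullGroup ⊥).mul_mem_cancel_right hs'.2).1 (e ▸ hg)
  rw [mem_fullGroup_bot, induces_one_iff hp] at hg'
  rw [translation_mem_lineGroup_iff hp] at hl'
  obtain ⟨-, -, h5, h6⟩ := hg'
  obtain ⟨-, h7, h8⟩ := hl'
  generalize T - screwPart ε = S at *
  rw [ZMod.intCast_eq_intCast_iff, Int.modEq_iff_dvd] at h7 h8
  push_cast at h7 h8
  have : S = 4 • fun i => S i / 4 := by
    funext i
    fin_cases i <;> simp <;> omega
  rw [this]
  exact translation_mem_T2 _

theorem T2_le_T1 : T2 ≤ T1 := by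
  rw [T2_eq, T1_eq]
  exact inf_le_right

/-! ### Rigidity -/

theorem signedIso_mem_latticeAut_iff {σ : Equiv.Perm (Fin 3)} {ε : Fin 3 → ℤˣ} {T : Fin 3 → ℤ} :
    signedIso σ ε T ∈ latticeAut ↔ SameParity T := by
  refine ⟨fun h => ?_, signedIso_mem_latticeAut⟩
  obtain ⟨σ', ε', T', hT, h'⟩ := (mem_latticeAut_iff _).1 h
  rwa [(signedIso_injective h').2.2]

theorem isom_apply_eq (g : Isom3) (x : E3) : g x = g.linearIsometryEquiv x + g 0 := by
  have h := AffineIsometryEquiv.map_vadd g 0 x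
  simpa only [vadd_eq_add, add_zero] using h

theorem isom_inv_apply_self (g : Isom3) (x : E3) : (g⁻¹ : Isom3) (g x) = x := g.symm_apply_apply x

theorem isom_apply_inv_self (g : Isom3) (x : E3) : g ((g⁻¹ : Isom3) x) = x := g.apply_symm_apply x

theorem T1_apply_zero {k : Isom3} (hk : k ∈ T1) :
    ∃ W : Fin 3 → ℤ, (∀ i, k 0 i = (W i : ℝ)) ∧ (W 0 + W 1 + W 2) % 2 = 0 := by
  rw [T1_eq] at hk
  obtain ⟨σ, ε, T, hT, rfl⟩ := (mem_latticeAut_iff k).1 (fullGroup_le_latticeAut _ hk)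
  rw [mem_fullGroup_bot, induces_one_iff hT] at hk
  obtain ⟨-, -, h2, h4⟩ := hk
  have h01 := hT 0 1
  have h02 := hT 0 2
  refine ⟨fun i => T i / 2, fun i => ?_, by
    change (T 0 / 2 + T 1 / 2 + T 2 / 2) % 2 = 0
    omega⟩
  obtain ⟨n, hn⟩ : ∃ n, T i = 2 * n := ⟨T i / 2, by have := hT i 0; omega⟩
  simp [hn]

/-- An isometry that conjugates `T₂` into `T₁` is an automorphism of the lattice. -/
theorem mem_latticeAut_of_conj {g : Isom3} (h : ∀ k ∈ T2, g * k * g⁻¹ ∈ T1) : g ∈ latticeAut := by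
  have hR : ∀ j, ∃ v : Fin 3 → ℤ,
      ∀ i, g.linearIsometryEquiv (EuclideanSpace.single j 2) i = v i := by
    intro j
    -- The translation by twice a coordinate vector is conjugate to the translation by the image of
    -- that vector, which is integral because it belongs to `T1`.
    obtain ⟨W, hW, -⟩ := T1_apply_zero (h _ (translation_mem_T2 (Pi.single j 1)))
    refine ⟨W, fun i => ?_⟩
    rw [← hW]
    have h1 : signedIso 1 1 (4 • Pi.single j 1) ((g⁻¹ : Isom3) 0) =
        EuclideanSpace.single j 2 + (g⁻¹ : Isom3) 0 := by
      ext i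
      by_cases hij : i = j
      · subst hij
        simp
        ring
      · simp [hij]
    rw [AffineIsometryEquiv.coe_mul, AffineIsometryEquiv.coe_mul, Function.comp_apply,
      Function.comp_apply, h1, isom_apply_eq g, map_add, add_assoc, ← isom_apply_eq g,
      isom_apply_inv_self, add_zero]
  obtain ⟨σ, ε, hσ⟩ := eq_signedLin _ hR
  have hg : ∀ x i, g x i = ((ε i : ℤ) : ℝ) * x (σ i) + g 0 i := fun x i => by
    rw [isom_apply_eq g x, hσ, PiLp.add_apply, signedLin_apply]
  have hinv : ∀ i, (g⁻¹ : Isom3) 0 (σ i) = -((ε i : ℤ) : ℝ) * g 0 i := fun i => by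
    have h1 := hg ((g⁻¹ : Isom3) 0) i
    rw [isom_apply_inv_self, PiLp.zero_apply] at h1
    rcases Int.units_eq_one_or (ε i) with h | h <;> simp [h] at h1 ⊢ <;> linarith
  -- The conjugated half-turns constrain `g 0`: evaluating such a conjugate at the origin produces
  -- `(1 - δ) g 0` up to a vector of `D₃`.
  have key : ∀ δ : Fin 3 → ℤˣ, δ 0 * δ 1 * δ 2 = 1 → ∃ W : Fin 3 → ℤ,
      (∀ i, (1 - ((δ (σ i) : ℤ) : ℝ)) * g 0 i = (W i : ℝ)) ∧ (W 0 + W 1 + W 2) % 2 = 0 := by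
    intro δ hδ
    obtain ⟨V, hV, hVs⟩ := T1_apply_zero (T2_le_T1 (diag_mem_T2 hδ))
    obtain ⟨W, hW, hWs⟩ := T1_apply_zero (h _ (diag_mem_T2 hδ))
    refine ⟨fun i => W i - ε i * V (σ i), fun i => ?_, ?_⟩
    · have e := hg (signedIso 1 δ (screwPart δ) ((g⁻¹ : Isom3) 0)) i
      push_cast
      rw [← hW, ← hV, AffineIsometryEquiv.coe_mul, AffineIsometryEquiv.coe_mul,
        Function.comp_apply, Function.comp_apply, e, signedIso_apply, signedIso_apply]
      simp only [Equiv.Perm.coe_one, id_eq, hinv, PiLp.zero_apply]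
      rcases Int.units_eq_one_or (ε i) with h | h <;> simp [h] <;> ring
    · have hs : V 0 + V 1 + V 2 = V (σ 0) + V (σ 1) + V (σ 2) := by
        rw [← Fin.sum_univ_three, ← Fin.sum_univ_three (fun i => V (σ i)), Equiv.sum_comp σ V]
      have h0 := units_mul_emod_two (ε 0) (V (σ 0))
      have h1 := units_mul_emod_two (ε 1) (V (σ 1))
      have h2 := units_mul_emod_two (ε 2) (V (σ 2))
      change (W 0 - ε 0 * V (σ 0) + (W 1 - ε 1 * V (σ 1)) + (W 2 - ε 2 * V (σ 2))) % 2 = 0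
      omega
  have key2 : ∀ δ : Fin 3 → ℤˣ, δ 0 * δ 1 * δ 2 = 1 → ∃ W : Fin 3 → ℤ,
      (∀ i, δ i = 1 → W i = 0) ∧ (∀ i, δ i = -1 → 2 * g 0 i = (W i : ℝ)) ∧
      (W 0 + W 1 + W 2) % 2 = 0 := by
    intro δ hδ
    have hp : δ (σ⁻¹ 0) * δ (σ⁻¹ 1) * δ (σ⁻¹ 2) = 1 := by
      rw [← hδ, ← Fin.prod_univ_three, ← Fin.prod_univ_three (fun i => δ (σ⁻¹ i)),
        Equiv.prod_comp σ⁻¹ δ]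
    obtain ⟨W, hW, hs⟩ := key (fun i => δ (σ⁻¹ i)) hp
    refine ⟨W, fun i hi => ?_, fun i hi => ?_, hs⟩
    · have h1 := hW i
      simp [hi] at h1
      exact_mod_cast h1.symm
    · rw [← hW i]
      simp [hi]
      norm_num
  -- Each half-turn shows that two entries of `2 * g 0` are integers of equal parity; two half-turns
  -- with a common entry cover all three.
  obtain ⟨W, hW, hW', hWs⟩ := key2 ![1, -1, -1] (by simp)
  obtain ⟨V, hV, hV', hVs⟩ := key2 ![-1, -1, 1] (by simp)
  have w0 := hW 0 rfl
  have w1 := hW' 1 rfl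
  have w2 := hW' 2 rfl
  have v0 := hV' 0 rfl
  have v1 := hV' 1 rfl
  have v2 := hV 2 rfl
  have e1 : V 1 = W 1 := Int.cast_injective (α := ℝ) (v1.symm.trans w1)
  obtain ⟨σ', ε', hg'⟩ := isom_eq_signedIso (g := g) (T := ![V 0, W 1, W 2]) (by
    ext i
    fin_cases i <;> simp <;> linarith) hR
  rw [hg']
  refine signedIso_mem_latticeAut ((sameParity_iff _).2 ?_)
  simp
  omega

theorem induces_conj {g h : Isom3} {s t : SignedPerm} (hg : Induces g s) (hh : Induces h t) :
    Induces (g * h * g⁻¹) (s * t * s⁻¹) := (hg.mul hh).mul hg.inv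

theorem conj_mem_T1 {g k : Isom3} (hg : g ∈ latticeAut) (hk : k ∈ T1) : g * k * g⁻¹ ∈ T1 := by
  obtain ⟨s, hs⟩ := exists_induces hg
  rw [T1_eq, mem_fullGroup_bot] at *
  simpa using induces_conj hs hk

theorem conj_mem_T2 {g k : Isom3} (hg : g ∈ latticeAut) (hl : g ∈ lineGroup) (hk : k ∈ T2) :
    g * k * g⁻¹ ∈ T2 := by
  have h1 := conj_mem_T1 hg (T2_le_T1 hk)
  rw [T1_eq] at h1
  rw [T2_eq] at *
  exact ⟨lineGroup.mul_mem (lineGroup.mul_mem hl hk.1) (lineGroup.inv_mem hl), h1⟩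

/-! ### Lifts that preserve the lines -/

theorem induces_inversion : Induces (signedIso 1 (-1) 0) (affPerm (-1) 0, 1) := by
  rw [induces_signedIso_iff (fun i j => rfl), inducedPerm]
  refine Prod.ext ?_ ?_
  · simp
    decide
  · simp [paritySign]

theorem induces_swap : Induces (signedIso (Equiv.swap 0 1) 1 1) (affPerm 1 3, 1) := by
  rw [induces_signedIso_iff (fun i j => rfl), inducedPerm]
  refine Prod.ext ?_ ?_
  · simp
  · simp [paritySign]

/-- The mirror `x ↔ y` supplies the sign: it keeps all colours and reverses orientation. -/
theorem induces_mirror : Induces (signedIso (Equiv.swap 0 1) 1 0) (1, -1) := by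
  rw [induces_signedIso_iff (fun i j => rfl), inducedPerm]
  refine Prod.ext ?_ ?_
  · simp
    exact (by decide : (1 : Equiv.Perm (Fin 4)) = affPerm 1 0)
  · simp [paritySign]

theorem T2_induces {g : Isom3} (h : g ∈ T2) : Induces g 1 := by
  rw [T2_eq] at h
  exact (mem_fullGroup_bot g).1 h.2

/-- Every signed permutation of the coordinates is the linear part of a symmetry of the lattice and
the diagonal lines that induces an even signed permutation of the colours. -/
theorem exists_line_lift (σ : Equiv.Perm (Fin 3)) (ε : Fin 3 → ℤˣ) :
    ∃ T, signedIso σ ε T ∈ lineGroup ∧ ∃ π, Induces (signedIso σ ε T) (π, 1) := by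
  have h1 : ∀ (σ : Equiv.Perm (Fin 3)) (ε : Fin 3 → ℤˣ), Equiv.Perm.sign σ = 1 →
      ∃ T, signedIso σ ε T ∈ lineGroup ∧ ∃ π, Induces (signedIso σ ε T) (π, 1) := by
    intro σ ε hσ
    -- Proper rotations lift to `T2`; the others are obtained by composing with the inversion, and
    -- odd permutations below by composing with the swap.
    rcases Int.units_eq_one_or (ε 0 * ε 1 * ε 2) with hε | hε
    · have h := even_mem_T2 hσ hε
      exact ⟨_, (T2_eq ▸ h : _ ∈ lineGroup ⊓ fullGroup ⊥).1, 1, T2_induces h⟩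
    · have h := even_mem_T2 (ε := -ε) hσ (by
        rcases Int.units_eq_one_or (ε 0) with h | h <;>
        rcases Int.units_eq_one_or (ε 1) with h' | h' <;>
        rcases Int.units_eq_one_or (ε 2) with h'' | h'' <;>
        simp [h, h', h''] at hε ⊢)
      have e : signedIso σ ε (-screwPart (-ε)) =
          signedIso 1 (-1) 0 * signedIso σ (-ε) (screwPart (-ε)) := by
        rw [signedIso_mul]
        exact signedIso_congr (by simp) (fun i => by simp) (fun i => by simp)
      refine ⟨_, e ▸ lineGroup.mul_mem inversion_mem_lineGroup
        (T2_eq ▸ h : _ ∈ lineGroup ⊓ fullGroup ⊥).1, affPerm (-1) 0, ?_⟩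
      rw [e]
      simpa using induces_inversion.mul (T2_induces h)
  rcases Int.units_eq_one_or (Equiv.Perm.sign σ) with hσ | hσ
  · exact h1 σ ε hσ
  · obtain ⟨T, hT, π, hπ⟩ := h1 (σ * Equiv.swap 0 1) (fun i => ε (Equiv.swap 0 1 i))
      (by simp [hσ])
    have e : signedIso σ ε (fun i => T (Equiv.swap 0 1 i) + 1) =
        signedIso (Equiv.swap 0 1) 1 1 *
          signedIso (σ * Equiv.swap 0 1) (fun i => ε (Equiv.swap 0 1 i)) T := by
      rw [signedIso_mul]
      exact signedIso_congr (by simp [mul_assoc]) (fun i => by simp) (fun i => by simp)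
    have h2 := lineGroup.mul_mem swap_mem_lineGroup hT
    have h3 := induces_swap.mul hπ
    rw [← e] at h2 h3
    exact ⟨_, h2, _, h3⟩

/-- Every linear part has a line-preserving lift, so questions about preserving the lines reduce to
translations. -/
theorem exists_line_decomp {g : Isom3} (hg : g ∈ latticeAut) :
    ∃ (S : Fin 3 → ℤ) (h : Isom3), SameParity S ∧ h ∈ lineGroup ∧ (∃ π, Induces h (π, 1)) ∧
      g = signedIso 1 1 S * h := by
  obtain ⟨σ, ε, T, hT, rfl⟩ := (mem_latticeAut_iff g).1 hg
  obtain ⟨T', hl, π, hπ⟩ := exists_line_lift σ ε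
  have hT' := signedIso_mem_latticeAut_iff.1 hπ.mem_latticeAut
  refine ⟨T - T', _, fun i j => ?_, hl, ⟨π, hπ⟩, ?_⟩
  · have := hT i j
    have := hT' i j
    simp only [Pi.sub_apply]
    omega
  · rw [signedIso_mul]
    exact signedIso_congr (by simp) (fun i => by simp) (fun i => by simp)

/-- After dividing by a lift of sign `+`, only a translation remains; its sign is `(-1) ^ S 0`, and
translations that preserve the lines have `S 0` even. -/
theorem lineGroup_sign {g : Isom3} {s : SignedPerm} (hl : g ∈ lineGroup) (h : Induces g s) :
    s.2 = 1 := by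
  obtain ⟨S, k, hS, hk, ⟨π, hπ⟩, rfl⟩ := exists_line_decomp h.mem_latticeAut
  have h1 := (lineGroup.mul_mem_cancel_right hk).1 hl
  rw [translation_mem_lineGroup_iff hS, two_mul_intCast_eq_zero] at h1
  have h2 := ((induces_signedIso hS).mul hπ).unique h
  rw [← h2]
  simp [inducedPerm, paritySign, h1.1]

/-- The automorphisms of the lattice that normalize `T₂` preserve the set of diagonal lines. -/
theorem mem_lineGroup_of_conj {g : Isom3} (hg : g ∈ latticeAut)
    (h : ∀ k ∈ T2, g * k * g⁻¹ ∈ T2) : g ∈ lineGroup := by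
  obtain ⟨S, k, hS, hk, ⟨π, hπ⟩, rfl⟩ := exists_line_decomp hg
  refine lineGroup.mul_mem ?_ hk
  -- The factor `k` normalizes `T2`, so the translation `S` also does, and its commutators with
  -- elements of `T2` preserve the lines. Those with the screw motion and the cyclic permutation are
  -- translations, which force the entries of `S` to be even and congruent modulo 4.
  have hT : ∀ t ∈ T2, signedIso 1 1 S * t * (signedIso 1 1 S)⁻¹ * t⁻¹ ∈ lineGroup := by
    intro t ht
    have h1 := conj_mem_T2 (inv_mem hπ.mem_latticeAut) (inv_mem hk) ht
    have h2 := T2.mul_mem (h _ h1) (T2.inv_mem ht)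
    rw [T2_eq] at h2
    have e : signedIso 1 1 S * t * (signedIso 1 1 S)⁻¹ * t⁻¹ =
        signedIso 1 1 S * k * (k⁻¹ * t * k⁻¹⁻¹) * (signedIso 1 1 S * k)⁻¹ * t⁻¹ := by group
    rw [e]
    exact h2.1
  have h1 := hT _ (diag_mem_T2 (ε := ![1, -1, -1]) (by simp))
  have e1 : signedIso 1 1 S * signedIso 1 ![1, -1, -1] (screwPart ![1, -1, -1]) *
      (signedIso 1 1 S)⁻¹ * (signedIso 1 ![1, -1, -1] (screwPart ![1, -1, -1]))⁻¹ =
      signedIso 1 1 ![0, 2 * S 1, 2 * S 2] := by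
    rw [mul_inv_eq_iff_eq_mul, mul_inv_eq_iff_eq_mul, signedIso_mul, signedIso_mul, signedIso_mul]
    refine signedIso_congr (by simp) (fun i => by simp) (fun i => ?_)
    fin_cases i <;> simp <;> ring
  have h2 := hT _ cyc_mem_T2
  have e2 : signedIso 1 1 S * signedIso cyc3 1 0 * (signedIso 1 1 S)⁻¹ * (signedIso cyc3 1 0)⁻¹ =
      signedIso 1 1 ![S 0 - S 1, S 1 - S 2, S 2 - S 0] := by
    rw [mul_inv_eq_iff_eq_mul, mul_inv_eq_iff_eq_mul, signedIso_mul, signedIso_mul, signedIso_mul]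
    refine signedIso_congr (by simp) (fun i => by simp) (fun i => ?_)
    fin_cases i <;> simp [cyc3_apply]
  have h01 := hS 0 1
  have h02 := hS 0 2
  rw [e1, translation_mem_lineGroup_iff (by simp [sameParity_iff])] at h1
  rw [e2, translation_mem_lineGroup_iff (by simp [sameParity_iff]; omega)] at h2
  rw [translation_mem_lineGroup_iff hS]
  simp at h1 h2
  obtain ⟨h3, -⟩ := h1
  obtain ⟨-, h4, h5⟩ := h2
  obtain ⟨z1, z2⟩ := hS.zmod
  generalize (S 0 : ZMod 4) = a at *
  generalize (S 1 : ZMod 4) = b at *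
  generalize (S 2 : ZMod 4) = c at *
  clear hT e1 e2 hS h01 h02
  revert a b c
  decide

/-! ### Realization of signed permutations -/

/-- The dihedral group is the affine group of the integers modulo 4. -/
theorem mem_dihedral_o8 (π : Equiv.Perm (Fin 4)) :
    π ∈ dihedralSubgroup .o8 ↔ ∃ u b, π = affPerm u b := by
  have h1 : ∀ π ∈ dihedralElements .o8, ∃ (u : ℤˣ) (b : ZMod 4), π = affPerm u b := by decide
  have h2 : ∀ (u : ℤˣ) (b : ZMod 4), affPerm u b ∈ dihedralElements .o8 := by decide
  constructor
  · exact h1 π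
  · rintro ⟨u, b, rfl⟩
    exact h2 u b

theorem Induces.mem_dihedral {g : Isom3} {s : SignedPerm} (h : Induces g s) :
    s.1 ∈ dihedralSubgroup .o8 := by
  obtain ⟨σ, ε, T, hT, rfl⟩ := (mem_latticeAut_iff g).1 h.mem_latticeAut
  rw [(induces_signedIso_iff hT s).1 h, mem_dihedral_o8]
  exact ⟨_, _, rfl⟩

/-- The rotation `k ↦ k + 3` and the reflection `k ↦ -k` are induced by line-preserving symmetries
and generate the dihedral group. -/
theorem exists_line_induces {π : Equiv.Perm (Fin 4)} (h : π ∈ dihedralSubgroup .o8) :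
    ∃ g ∈ lineGroup, Induces g (π, 1) := by
  have hpow : ∀ {g : Isom3} {s : SignedPerm}, Induces g s → ∀ n : ℕ, Induces (g ^ n) (s ^ n) := by
    intro g s h n
    induction n with
    | zero => simpa using Induces.one
    | succ n ih => rw [pow_succ, pow_succ]; exact ih.mul h
  have key : ∀ π ∈ dihedralElements .o8, ∃ m < 4, ∃ n < 2,
      π = affPerm 1 3 ^ m * affPerm (-1) 0 ^ n := by decide
  obtain ⟨m, -, n, -, rfl⟩ := key π h
  refine ⟨_, lineGroup.mul_mem (lineGroup.pow_mem swap_mem_lineGroup m)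
    (lineGroup.pow_mem inversion_mem_lineGroup n), ?_⟩
  simpa using (hpow induces_swap m).mul (hpow induces_inversion n)

theorem exists_induces_eq {s : SignedPerm} (h : s.1 ∈ dihedralSubgroup .o8) :
    ∃ g, Induces g s := by
  obtain ⟨g, -, hg⟩ := exists_line_induces h
  rcases Int.units_eq_one_or s.2 with h2 | h2
  · exact ⟨g, by rwa [← h2] at hg⟩
  · have h3 := hg.mul induces_mirror
    rw [show (s.1, 1) * (1, -1) = s from Prod.ext (by simp) (by simp [h2])] at h3
    exact ⟨_, h3⟩

/-! ### Subgroups of the group of signed permutations -/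

/-- The group of signed permutations that belongs to a name. -/
def signedGroup : IrreducibleName → Subgroup SignedPerm
  | .full N => (dihedralSubgroup N).prod ⊥
  | .double N => (dihedralSubgroup N).prod ⊤
  | .mixed e => mixedSubgroup e
  -- `quarterGroup` allows both signs, but `-` never occurs by `lineGroup_sign`.
  | .quarter N => (dihedralSubgroup N).prod ⊥

/-- The names of the quarter groups. -/
def isQuarter : IrreducibleName → Bool
  | .quarter _ => true
  | _ => false

/-- A decision procedure for membership in `signedGroup`. -/
def memSignedGroup (A : IrreducibleName) (s : SignedPerm) : Bool :=
  match A with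
  | .full N => s.1 ∈ dihedralElements N ∧ s.2 = 1
  | .double N => s.1 ∈ dihedralElements N
  | .mixed e => s.1 ∈ dihedralElements e.upper ∧ (s.2 = 1 ↔ s.1 ∈ dihedralElements e.lower)
  | .quarter N => s.1 ∈ dihedralElements N ∧ s.2 = 1

theorem mem_signedGroup_iff (A : IrreducibleName) (s : SignedPerm) :
    s ∈ signedGroup A ↔ memSignedGroup A s = true := by
  have h : ∀ (N : DihedralName) π, π ∈ dihedralSubgroup N ↔ π ∈ dihedralElements N :=
    fun N π => Iff.rfl
  have h2 : ∀ e : MixedName, s ∈ mixedSubgroup e ↔ s.1 ∈ dihedralSubgroup e.upper ∧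
    (s.2 = 1 ↔ s.1 ∈ dihedralSubgroup e.lower) := fun e => Iff.rfl
  cases A <;> simp [signedGroup, memSignedGroup, Subgroup.mem_prod, h, h2]

/-- An enumeration of the signed permutations whose permutation belongs to the dihedral group. -/
def signedElt (j : ℕ) : SignedPerm :=
  -- The two lowest bits of `j` are the shift `b`, the next is the multiplier `u`, the highest the
  -- sign.
  (affPerm (if j / 4 % 2 = 0 then 1 else -1) ((j % 4 : ℕ) : ZMod 4), if j / 8 = 0 then 1 else -1)

theorem exists_signedElt {s : SignedPerm} (h : s.1 ∈ dihedralSubgroup .o8) :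
    ∃ j < 16, s = signedElt j := by
  obtain ⟨u, b, hb⟩ := (mem_dihedral_o8 _).1 h
  have key : ∀ (u e : ℤˣ) (b : ZMod 4), ∃ j < 16, (affPerm u b, e) = signedElt j := by
    decide +kernel
  obtain ⟨j, hj, hs⟩ := key u s.2 b
  exact ⟨j, hj, by rw [← hs, ← hb]⟩

theorem signedElt_mem (j : ℕ) : (signedElt j).1 ∈ dihedralSubgroup .o8 :=
  (mem_dihedral_o8 _).2 ⟨_, _, rfl⟩

/-- The product in the enumeration `signedElt`. -/
def mulCode (i j : ℕ) : ℕ :=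
  (i % 4 + if i / 4 % 2 = 0 then j % 4 else 4 - j % 4) % 4 +
    4 * ((i / 4 + j / 4) % 2) + 8 * ((i / 8 + j / 8) % 2)

/-- Conjugation of the `j`-th by the `s`-th element in the enumeration `signedElt`. -/
def conjCode (s j : ℕ) : ℕ :=
  -- Conjugating `x ↦ u x + b` by `x ↦ v x + c` keeps `u` and changes `b` to `v b + c - u c`; the
  -- sign is kept too.
  ((if s / 4 % 2 = 0 then j % 4 else 4 - j % 4) + s % 4 +
    if j / 4 % 2 = 0 then 4 - s % 4 else s % 4) % 4 + 4 * (j / 4)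

theorem signedElt_mul : ∀ i < 16, ∀ j < 16,
    signedElt i * signedElt j = signedElt (mulCode i j) := by decide +kernel

theorem signedElt_conj : ∀ s < 16, ∀ j < 16,
    signedElt s * signedElt j * (signedElt s)⁻¹ = signedElt (conjCode s j) := by decide +kernel

theorem conjCode_lt : ∀ s < 16, ∀ j < 16, conjCode s j < 16 := by decide +kernel

/-- The named subgroups of the dihedral group as sets of bits. -/
def dihedralMask : DihedralName → ℕ
  -- Bits 0 to 3 are the rotations `k ↦ k + b`, bits 4 to 7 the reflections `k ↦ b - k`.
  | .o8 => 255 | .m4 => 85 | .o4 => 15 | .p4 => 165 | .m2 => 17 | .o2 => 5 | .p2 => 33 | .o1 => 1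

/-- The groups of signed permutations as sets of bits. -/
def nameMask : IrreducibleName → ℕ
  | .full N => dihedralMask N
  -- The factor `257 = 1 + 2 ^ 8` repeats the mask among the elements of sign `-`. In the next case
  -- the subtraction is a set difference, since the lower group is contained in the upper one.
  | .double N => dihedralMask N * 257
  | .mixed e => dihedralMask e.lower + 256 * (dihedralMask e.upper - dihedralMask e.lower)
  | .quarter N => dihedralMask N

theorem signedElt_mem_iff (A : IrreducibleName) :
    ∀ j < 16, signedElt j ∈ signedGroup A ↔ (nameMask A).testBit j = true := by
  have key : ∀ j < 16, memSignedGroup A (signedElt j) = (nameMask A).testBit j := by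
    rcases A with N | N | e | N
    · cases N <;> decide +kernel
    · cases N <;> decide +kernel
    · cases e <;> decide +kernel
    · cases N <;> decide +kernel
  intro j hj
  rw [mem_signedGroup_iff, key j hj]

theorem signedGroup_dihedral {A : IrreducibleName} {s : SignedPerm} (h : s ∈ signedGroup A) :
    s.1 ∈ dihedralSubgroup .o8 := by
  have h1 : ∀ N, dihedralElements N ⊆ dihedralElements .o8 := by
    intro N
    cases N <;> decide
  cases A with
  | full N => exact h1 N h.1
  | double N => exact h1 N h.1
  | mixed e => exact h1 e.upper h.1
  | quarter N => exact h1 N h.1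

/-- All the names. -/
def irreducibleNames : List IrreducibleName :=
  let D : List DihedralName := [.o8, .m4, .o4, .p4, .m2, .o2, .p2, .o1]
  D.map .full ++ D.map .double ++ D.map .quarter ++
    [.mixed .mo8, .mixed .oo8, .mixed .po8, .mixed .mm4, .mixed .om4, .mixed .oo4, .mixed .op4,
      .mixed .pp4, .mixed .om2, .mixed .oo2, .mixed .op2]

theorem mem_irreducibleNames (A : IrreducibleName) : A ∈ irreducibleNames := by
  rcases A with N | N | e | N
  · cases N <;> decide
  · cases N <;> decide
  · cases e <;> decide
  · cases N <;> decide

/-- A decision procedure for inclusion up to conjugacy. -/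
def inclusionTest (A B : IrreducibleName) : Bool :=
  -- A group that contains `T1` does not fit into a quarter group. Conjugation by the eight elements
  -- of sign `+` suffices because signs are central.
  (!isQuarter B || isQuarter A) && (List.range 8).any fun s => (List.range 16).all fun j =>
    !(nameMask A).testBit j || (nameMask B).testBit (conjCode s j)

theorem conjCode_add_eight : ∀ s < 8, ∀ j < 16, conjCode (s + 8) j = conjCode s j := by
  decide +kernel

theorem inclusionTest_iff (A B : IrreducibleName) :
    inclusionTest A B = true ↔ (isQuarter B = true → isQuarter A = true) ∧
      ∃ s : SignedPerm, s.1 ∈ dihedralSubgroup .o8 ∧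
        ∀ x ∈ signedGroup A, s * x * s⁻¹ ∈ signedGroup B := by
  rw [inclusionTest, Bool.and_eq_true]
  refine and_congr (by cases isQuarter A <;> cases isQuarter B <;> simp) ?_
  simp only [List.any_eq_true, List.all_eq_true, List.mem_range, Bool.or_eq_true,
    Bool.not_eq_true']
  have key : ∀ s < 16, (∀ j < 16, (nameMask A).testBit j = false ∨
      (nameMask B).testBit (conjCode s j) = true) ↔
      ∀ x ∈ signedGroup A, signedElt s * x * (signedElt s)⁻¹ ∈ signedGroup B := by
    intro s hs
    constructor
    · intro h x hx
      obtain ⟨j, hj, rfl⟩ := exists_signedElt (signedGroup_dihedral hx)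
      rw [signedElt_conj s hs j hj, signedElt_mem_iff _ _ (conjCode_lt s hs j hj)]
      refine (h j hj).resolve_left ?_
      rw [(signedElt_mem_iff A j hj).1 hx]
      simp
    · intro h j hj
      by_cases hx : signedElt j ∈ signedGroup A
      · right
        have := h _ hx
        rwa [signedElt_conj s hs j hj, signedElt_mem_iff _ _ (conjCode_lt s hs j hj)] at this
      · left
        rw [signedElt_mem_iff A j hj] at hx
        simpa using hx
  constructor
  · rintro ⟨s, hs, h⟩
    exact ⟨signedElt s, signedElt_mem s, (key s (by omega)).1 h⟩
  · rintro ⟨s, hs, h⟩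
    obtain ⟨j, hj, rfl⟩ := exists_signedElt hs
    rw [← key j hj] at h
    by_cases hj8 : j < 8
    · exact ⟨j, hj8, h⟩
    · refine ⟨j - 8, by omega, fun i hi => ?_⟩
      rw [← conjCode_add_eight (j - 8) (by omega) i hi, Nat.sub_add_cancel (by omega)]
      exact h i hi

/-! ### Classification of the subgroups -/

/-- The subgroups of the dihedral group as sets of bits. -/
def subgroupMasks : List ℕ := [1, 5, 15, 17, 33, 65, 85, 129, 165, 255]

/-- Closure of a set of bits under multiplication, for the first `n` elements. -/
def closedMask (n m : ℕ) : Bool :=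
  (List.range n).all fun i => !m.testBit i ||
    (List.range n).all fun j => !m.testBit j || m.testBit (mulCode i j)

theorem closedMask_iff (n m : ℕ) : closedMask n m = true ↔
    ∀ i < n, m.testBit i = true → ∀ j < n, m.testBit j = true →
      m.testBit (mulCode i j) = true := by
  simp only [closedMask, List.all_eq_true, List.mem_range, Bool.or_eq_true, Bool.not_eq_true',
    ← Bool.not_eq_true, ← imp_iff_not_or]

theorem subgroupMasks_complete : ∀ m < 256, m.testBit 0 = true → closedMask 8 m = true →
    m ∈ subgroupMasks := by decide +kernel

/-- The elements of sign `+` form a subgroup, already restricted to ten masks, so only `10 * 256` of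
the `2 ^ 16` sets need to be searched. -/
theorem signedMasks_complete : ∀ h ∈ subgroupMasks, ∀ x < 256,
    closedMask 16 (h + 256 * x) = true →
    ∃ A ∈ irreducibleNames, isQuarter A = false ∧ ∃ s < 8, ∀ j < 16,
      (nameMask A).testBit j = (h + 256 * x).testBit (conjCode s j) := by decide +kernel

theorem exists_signedGroup_conj (S : Subgroup SignedPerm)
    (hS : ∀ s ∈ S, s.1 ∈ dihedralSubgroup .o8) :
    ∃ A, isQuarter A = false ∧ ∃ s : SignedPerm, s.1 ∈ dihedralSubgroup .o8 ∧
      ∀ x : SignedPerm, x ∈ signedGroup A ↔ s * x * s⁻¹ ∈ S := by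
  classical
  -- The subgroup is encoded as a number of 16 bits; its elements of sign `+` are the low byte.
  let m := Nat.ofBits fun j : Fin 16 => decide (signedElt j ∈ S)
  have hm : ∀ j < 16, m.testBit j = true ↔ signedElt j ∈ S := fun j hj => by
    rw [Nat.testBit_ofBits_lt _ _ hj, decide_eq_true_iff]
  have hmul : ∀ i < 16, m.testBit i = true → ∀ j < 16, m.testBit j = true →
      m.testBit (mulCode i j) = true := by
    intro i hi h1 j hj h2
    rw [hm i hi] at h1
    rw [hm j hj] at h2
    rw [hm _ (by unfold mulCode; omega), ← signedElt_mul i hi j hj]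
    exact S.mul_mem h1 h2
  have hlt : m < 65536 := Nat.ofBits_lt_two_pow _
  have hmod : ∀ j < 8, (m % 256).testBit j = m.testBit j := fun j hj => by
    have := Nat.testBit_mod_two_pow m 8 j
    simpa [hj] using this
  have h1 : m % 256 ∈ subgroupMasks := by
    refine subgroupMasks_complete _ (Nat.mod_lt _ (by norm_num)) ?_ ((closedMask_iff _ _).2 ?_)
    · rw [hmod 0 (by norm_num), hm 0 (by norm_num)]
      have : signedElt 0 = 1 := by decide +kernel
      rw [this]
      exact S.one_mem
    · intro i hi h2 j hj h3
      rw [hmod i hi] at h2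
      rw [hmod j hj] at h3
      rw [hmod _ (by unfold mulCode; omega)]
      exact hmul i (by omega) h2 j (by omega) h3
  have hsplit : m % 256 + 256 * (m / 256) = m := Nat.mod_add_div m 256
  obtain ⟨A, -, hA, s, hs, h⟩ := signedMasks_complete _ h1 (m / 256) (by omega) (by
    rw [hsplit, closedMask_iff]; exact hmul)
  rw [hsplit] at h
  refine ⟨A, hA, signedElt s, signedElt_mem s, fun x => ?_⟩
  have key : ∀ j < 16, signedElt j ∈ signedGroup A ↔
      signedElt s * signedElt j * (signedElt s)⁻¹ ∈ S := fun j hj => by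
    rw [signedElt_mem_iff A j hj, h j hj, hm _ (conjCode_lt s (by omega) j hj),
      signedElt_conj s (by omega) j hj]
  constructor
  · intro hx
    obtain ⟨j, hj, rfl⟩ := exists_signedElt (signedGroup_dihedral hx)
    exact (key j hj).1 hx
  · intro hx
    have hx1 : x.1 ∈ dihedralSubgroup .o8 := by
      have h2 := hS _ hx
      have h3 := mul_mem (mul_mem (inv_mem (signedElt_mem s)) h2) (signedElt_mem s)
      simpa [mul_assoc] using h3
    obtain ⟨j, hj, rfl⟩ := exists_signedElt hx1
    exact (key j hj).2 hx

/-! ### Minimal inclusions -/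

/-- The positions of the names in `irreducibleNames`. -/
def nameIndex : IrreducibleName → ℕ :=
  let d : DihedralName → ℕ := fun N => match N with
    | .o8 => 0 | .m4 => 1 | .o4 => 2 | .p4 => 3 | .m2 => 4 | .o2 => 5 | .p2 => 6 | .o1 => 7
  fun A => match A with
    | .full N => d N
    | .double N => 8 + d N
    | .quarter N => 16 + d N
    | .mixed e => match e with
      | .mo8 => 24 | .oo8 => 25 | .po8 => 26 | .mm4 => 27 | .om4 => 28 | .oo4 => 29 | .op4 => 30
      | .pp4 => 31 | .om2 => 32 | .oo2 => 33 | .op2 => 34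

/-- For each name, the set of the positions of the names of the groups that include the group. -/
def upTable : List ℕ :=
  [257, 16777987, 33555717, 67111177, 150999827, 1996500783, 2214611273, 34343026687, 256, 768,
    1280, 2304, 4864, 12032, 18688, 65280, 65793, 16974595, 33883397, 67701001, 152245011,
    1999580975, 2219395401, 34359738367, 16777472, 33554688, 67109120, 134218496, 369099520,
    620758272, 1124075776, 2147485952, 4798288640, 10871648000, 20451444992]

/-- Inclusion up to conjugacy, read off from the table. -/
def tableTest (A B : IrreducibleName) : Bool :=
  (upTable.getD (nameIndex A) 0).testBit (nameIndex B)

/-- Once verified, the table replaces searches over conjugating elements by bit lookups, which makes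
the check of all triples of names cheap. -/
theorem inclusionTest_eq_tableTest (A B : IrreducibleName) :
    inclusionTest A B = tableTest A B := by
  have key : (irreducibleNames.all fun A => irreducibleNames.all fun B =>
      inclusionTest A B == tableTest A B) = true := by decide +kernel
  rw [List.all_eq_true] at key
  have h := key A (mem_irreducibleNames A)
  rw [List.all_eq_true] at h
  simpa using h B (mem_irreducibleNames B)

/-- The dihedral names. -/
def dihedralNames : List DihedralName := [.o8, .m4, .o4, .p4, .m2, .o2, .p2, .o1]

/-- The mixed names. -/
def mixedNames : List MixedName :=
  [.mo8, .oo8, .po8, .mm4, .om4, .oo4, .op4, .pp4, .om2, .oo2, .op2]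

/-- The pairs in the relation `HeavyBox`. -/
def heavyBoxList : List (IrreducibleName × IrreducibleName) :=
  dihedralNames.flatMap fun N => [(.quarter N, .full N), (.full N, .double N)]

/-- The pairs in the relation `HeavyEdge`. -/
def heavyEdgeList : List (IrreducibleName × IrreducibleName) :=
  mixedNames.flatMap fun e =>
    [(.quarter e.lower, .quarter e.upper), (.full e.lower, .full e.upper),
      (.double e.lower, .double e.upper), (.full e.lower, .mixed e), (.mixed e, .double e.upper)]

/-- The pairs in the relation `ThinEdge`. -/
def thinEdgeList : List (IrreducibleName × IrreducibleName) :=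
  ([(.om4, .oo8), (.om4, .po8), (.oo4, .mo8), (.oo4, .po8), (.op4, .mo8), (.op4, .oo8),
    (.om2, .mm4), (.om2, .om4), (.oo2, .mm4), (.oo2, .pp4), (.op2, .op4), (.op2, .pp4)] :
      List (MixedName × MixedName)).map fun e => (.mixed e.1, .mixed e.2)

theorem heavyBox_iff (A B : IrreducibleName) : HeavyBox A B ↔ (A, B) ∈ heavyBoxList := by
  constructor
  · rintro (N | N) <;> cases N <;> decide
  · intro h
    simp only [heavyBoxList, List.mem_flatMap, List.mem_cons, Prod.mk.injEq, List.not_mem_nil,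
      or_false] at h
    obtain ⟨N, -, ⟨rfl, rfl⟩ | ⟨rfl, rfl⟩⟩ := h
    · exact .quarter_full N
    · exact .full_double N

theorem heavyEdge_iff (A B : IrreducibleName) : HeavyEdge A B ↔ (A, B) ∈ heavyEdgeList := by
  constructor
  · rintro (e | e | e | e | e) <;> cases e <;> decide
  · intro h
    simp only [heavyEdgeList, List.mem_flatMap, List.mem_cons, Prod.mk.injEq, List.not_mem_nil,
      or_false] at h
    obtain ⟨e, -, ⟨rfl, rfl⟩ | ⟨rfl, rfl⟩ | ⟨rfl, rfl⟩ | ⟨rfl, rfl⟩ | ⟨rfl, rfl⟩⟩ := h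
    · exact .quarter e
    · exact .full e
    · exact .double e
    · exact .full_mixed e
    · exact .mixed_double e

theorem thinEdge_iff (A B : IrreducibleName) : ThinEdge A B ↔ (A, B) ∈ thinEdgeList := by
  constructor
  · rintro (_ | _) <;> decide
  · intro h
    simp only [thinEdgeList, List.map_cons, List.map_nil, List.mem_cons, Prod.mk.injEq,
      List.not_mem_nil, or_false] at h
    rcases h with h | h | h | h | h | h | h | h | h | h | h | h <;> obtain ⟨rfl, rfl⟩ := h <;>
      constructor

theorem ncard_heavyBox :
    {p : IrreducibleName × IrreducibleName | HeavyBox p.1 p.2}.ncard = 8 * 2 := by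
  have h : {p : IrreducibleName × IrreducibleName | HeavyBox p.1 p.2} =
      ↑heavyBoxList.toFinset := by
    ext p
    simp [heavyBox_iff]
  rw [h, Set.ncard_coe_finset]
  decide +kernel

theorem ncard_heavyEdge :
    {p : IrreducibleName × IrreducibleName | HeavyEdge p.1 p.2}.ncard = 11 * 5 := by
  have h : {p : IrreducibleName × IrreducibleName | HeavyEdge p.1 p.2} =
      ↑heavyEdgeList.toFinset := by
    ext p
    simp [heavyEdge_iff]
  rw [h, Set.ncard_coe_finset]
  decide +kernel

theorem ncard_thinEdge :
    {p : IrreducibleName × IrreducibleName | ThinEdge p.1 p.2}.ncard = 12 := by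
  have h : {p : IrreducibleName × IrreducibleName | ThinEdge p.1 p.2} =
      ↑thinEdgeList.toFinset := by
    ext p
    simp [thinEdge_iff]
  rw [h, Set.ncard_coe_finset]
  decide +kernel

theorem ncard_edges :
    {p : IrreducibleName × IrreducibleName |
      HeavyBox p.1 p.2 ∨ HeavyEdge p.1 p.2 ∨ ThinEdge p.1 p.2}.ncard = 83 := by
  have h : {p : IrreducibleName × IrreducibleName |
      HeavyBox p.1 p.2 ∨ HeavyEdge p.1 p.2 ∨ ThinEdge p.1 p.2} =
      ↑(heavyBoxList ++ (heavyEdgeList ++ thinEdgeList)).toFinset := by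
    ext p
    simp [heavyBox_iff, heavyEdge_iff, thinEdge_iff]
  rw [h, Set.ncard_coe_finset]
  decide +kernel

theorem minimal_tableTest_iff (A B : IrreducibleName) :
    (A ≠ B ∧ tableTest A B = true ∧
        ∀ C, tableTest A C = true → tableTest C B = true → C = A ∨ C = B) ↔
      HeavyBox A B ∨ HeavyEdge A B ∨ ThinEdge A B := by
  have key : ∀ A ∈ irreducibleNames, ∀ B ∈ irreducibleNames,
      (A ≠ B ∧ tableTest A B = true ∧
        ∀ C ∈ irreducibleNames, tableTest A C = true → tableTest C B = true → C = A ∨ C = B) ↔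
      (A, B) ∈ heavyBoxList ++ (heavyEdgeList ++ thinEdgeList) := by decide +kernel
  have h := key A (mem_irreducibleNames A) B (mem_irreducibleNames B)
  simp only [List.mem_append, ← heavyBox_iff, ← heavyEdge_iff, ← thinEdge_iff,
    mem_irreducibleNames, true_implies] at h
  exact h

/-- This is what separates the names: conjugate groups would be included in each other. -/
theorem tableTest_antisymm (A B : IrreducibleName) (h1 : tableTest A B = true)
    (h2 : tableTest B A = true) : A = B := by
  have key : ∀ A ∈ irreducibleNames, ∀ B ∈ irreducibleNames,
      tableTest A B = true → tableTest B A = true → A = B := by decide +kernel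
  exact key A (mem_irreducibleNames A) B (mem_irreducibleNames B) h1 h2

theorem card_irreducibleName : Nat.card IrreducibleName = 35 := by
  have h : (irreducibleNames.toFinset : Set IrreducibleName) = Set.univ := by
    ext A
    simp [mem_irreducibleNames]
  rw [← Set.ncard_univ, ← h, Set.ncard_coe_finset]
  decide +kernel

/-- The orders of the groups of signed permutations. -/
def nameOrder : IrreducibleName → ℕ
  | .full N => (dihedralElements N).card
  | .double N => 2 * (dihedralElements N).card
  -- Every permutation of the upper group carries exactly one sign.
  | .mixed e => (dihedralElements e.upper).card
  | .quarter N => (dihedralElements N).card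

theorem card_signedGroup (A : IrreducibleName) : Nat.card (signedGroup A) = nameOrder A := by
  have hinj : ∀ i < 16, ∀ j < 16, signedElt i = signedElt j → i = j := by decide +kernel
  let F : Finset ℕ := (Finset.range 16).filter fun j => (nameMask A).testBit j = true
  have hF : (signedGroup A : Set SignedPerm) = signedElt '' (F : Set ℕ) := by
    ext x
    constructor
    · intro hx
      obtain ⟨j, hj, rfl⟩ := exists_signedElt (signedGroup_dihedral hx)
      exact ⟨j, by simpa [F, hj] using (signedElt_mem_iff A j hj).1 hx, rfl⟩
    · rintro ⟨j, hj, rfl⟩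
      simp only [F, Finset.coe_filter, Finset.mem_range, Set.mem_ofPred_eq] at hj
      exact (signedElt_mem_iff A j hj.1).2 hj.2
  have h1 : Nat.card (signedGroup A) = (signedGroup A : Set SignedPerm).ncard := rfl
  rw [h1, hF, Set.InjOn.ncard_image, Set.ncard_coe_finset]
  · have key : ∀ A ∈ irreducibleNames,
        ((Finset.range 16).filter fun j => (nameMask A).testBit j = true).card = nameOrder A := by
      decide +kernel
    exact key A (mem_irreducibleNames A)
  · intro i hi j hj h
    simp only [F, Finset.coe_filter, Finset.mem_range, Set.mem_ofPred_eq] at hi hj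
    exact hinj i hi.1 j hj.1 h

theorem nameOrder_edge {A B : IrreducibleName}
    (h : (A, B) ∈ heavyEdgeList ++ thinEdgeList) : nameOrder B = 2 * nameOrder A := by
  have key : ∀ p ∈ heavyEdgeList ++ thinEdgeList, nameOrder p.2 = 2 * nameOrder p.1 := by
    decide +kernel
  exact key _ h

theorem nameOrder_pos (A : IrreducibleName) : 0 < nameOrder A := by
  rw [← card_signedGroup]
  exact Nat.card_pos

theorem signedGroup_heavyEdge {A B : IrreducibleName} (h : HeavyEdge A B) :
    signedGroup A ≤ signedGroup B ∧ isQuarter A = isQuarter B := by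
  rw [heavyEdge_iff] at h
  have key : ∀ p ∈ heavyEdgeList, (∀ j < 16, (nameMask p.1).testBit j = true →
      (nameMask p.2).testBit j = true) ∧ isQuarter p.1 = isQuarter p.2 := by decide +kernel
  obtain ⟨h1, h2⟩ := key _ h
  refine ⟨fun x hx => ?_, h2⟩
  obtain ⟨j, hj, rfl⟩ := exists_signedElt (signedGroup_dihedral hx)
  exact (signedElt_mem_iff B j hj).2 (h1 j hj ((signedElt_mem_iff A j hj).1 hx))

/-! ### The named groups -/

/-- The symmetries common to all the groups of one kind. -/
noncomputable def kindGroup (b : Bool) : Subgroup Isom3 := if b then lineGroup else ⊤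

/-- A uniform description of all the kinds of groups; for a quarter group it uses `lineGroup_sign`.
-/
theorem namedGroup_eq (A : IrreducibleName) :
    namedGroup A = kindGroup (isQuarter A) ⊓ fullGroup (signedGroup A) := by
  cases A with
  | full N => simp [namedGroup, kindGroup, isQuarter, signedGroup]
  | double N => simp [namedGroup, kindGroup, isQuarter, signedGroup]
  | mixed e => simp [namedGroup, kindGroup, isQuarter, signedGroup]
  | quarter N =>
    simp only [namedGroup, quarterGroup, kindGroup, isQuarter, signedGroup, if_true]
    ext g
    constructor
    · rintro ⟨hl, s, hs, h⟩
      exact ⟨hl, s, ⟨hs.1, lineGroup_sign hl h⟩, h⟩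
    · rintro ⟨hl, s, hs, h⟩
      exact ⟨hl, s, ⟨hs.1, trivial⟩, h⟩

theorem mem_namedGroup_iff (A : IrreducibleName) (g : Isom3) :
    g ∈ namedGroup A ↔ g ∈ kindGroup (isQuarter A) ∧ ∃ s ∈ signedGroup A, Induces g s := by
  rw [namedGroup_eq]
  rfl

theorem mem_namedGroup_of_induces {A : IrreducibleName} {g : Isom3} {s : SignedPerm}
    (h : Induces g s) :
    g ∈ namedGroup A ↔ g ∈ kindGroup (isQuarter A) ∧ s ∈ signedGroup A := by
  rw [mem_namedGroup_iff]
  refine and_congr_right fun _ => ⟨?_, fun hs => ⟨s, hs, h⟩⟩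
  rintro ⟨t, ht, h'⟩
  rwa [h.unique h']

theorem lineGroup_le_kindGroup (b : Bool) : lineGroup ≤ kindGroup b := by
  cases b <;> simp [kindGroup]

theorem kindGroup_le {a b : Bool} (h : b = true → a = true) : kindGroup a ≤ kindGroup b := by
  cases a <;> cases b <;> simp_all [kindGroup]

/-- The odd subgroup that belongs to a kind. -/
noncomputable def kindOdd (b : Bool) : Subgroup Isom3 := if b then T2 else T1

theorem kindOdd_eq (b : Bool) : kindOdd b = kindGroup b ⊓ fullGroup ⊥ := by
  cases b
  · simp [kindOdd, kindGroup, T1_eq]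
  · simp [kindOdd, kindGroup, T2_eq]

theorem mem_kindOdd_iff {b : Bool} {g : Isom3} :
    g ∈ kindOdd b ↔ g ∈ kindGroup b ∧ Induces g 1 := by
  rw [kindOdd_eq, Subgroup.mem_inf, mem_fullGroup_bot]

theorem T2_le_kindOdd (b : Bool) : T2 ≤ kindOdd b := by
  cases b <;> simp [kindOdd, T2_le_T1]

theorem kindOdd_le_T1 (b : Bool) : kindOdd b ≤ T1 := by
  cases b <;> simp [kindOdd, T2_le_T1]

theorem kindOdd_le_namedGroup (A : IrreducibleName) : kindOdd (isQuarter A) ≤ namedGroup A := by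
  intro g hg
  obtain ⟨h1, h2⟩ := mem_kindOdd_iff.1 hg
  exact (mem_namedGroup_of_induces h2).2 ⟨h1, one_mem _⟩

theorem T2_le_namedGroup (A : IrreducibleName) : T2 ≤ namedGroup A :=
  (T2_le_kindOdd _).trans (kindOdd_le_namedGroup A)

theorem namedGroup_le_latticeAut (A : IrreducibleName) : namedGroup A ≤ latticeAut := by
  rw [namedGroup_eq]
  exact inf_le_right.trans (fullGroup_le_latticeAut _)

theorem namedGroup_le_kindGroup (A : IrreducibleName) :
    namedGroup A ≤ kindGroup (isQuarter A) := by
  rw [namedGroup_eq]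
  exact inf_le_left

theorem exists_kind_induces (b : Bool) {s : SignedPerm} (h : s.1 ∈ dihedralSubgroup .o8)
    (hb : b = true → s.2 = 1) : ∃ g ∈ kindGroup b, Induces g s := by
  cases b
  · obtain ⟨g, hg⟩ := exists_induces_eq h
    exact ⟨g, by simp [kindGroup], hg⟩
  · obtain ⟨g, hl, hg⟩ := exists_line_induces h
    refine ⟨g, by simpa [kindGroup] using hl, ?_⟩
    rwa [show s = (s.1, 1) from Prod.ext rfl (hb rfl)]

theorem signedGroup_quarter {A : IrreducibleName} (h : isQuarter A = true) {s : SignedPerm}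
    (hs : s ∈ signedGroup A) : s.2 = 1 := by
  cases A with
  | quarter N => exact hs.2
  | _ => simp [isQuarter] at h

/-- Elements of order 3 induce the identity and so lie in `kindOdd b`. Conversely `kindOdd b` is an
odd subgroup by definition, and its generators lie in `G` for the same reason. -/
theorem oddSubgroup_eq_kindOdd {G : Subgroup Isom3} {b : Bool} (h1 : kindOdd b ≤ G)
    (h2 : G ≤ kindGroup b) (h3 : G ≤ latticeAut) : oddSubgroup G = kindOdd b := by
  apply le_antisymm
  · rw [oddSubgroup, Subgroup.closure_le]
    rintro g ⟨hg, ho⟩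
    exact mem_kindOdd_iff.2 ⟨h2 hg, induces_one_of_orderOf (h3 hg) ho⟩
  · have key : ∃ L : Subgroup Isom3, L ≤ latticeAut ∧ L ≤ kindGroup b ∧
        kindOdd b = oddSubgroup L := by
      cases b
      · exact ⟨latticeAut, le_rfl, by simp [kindGroup], by simp [kindOdd, T1]⟩
      · exact ⟨latticeAut ⊓ lineGroup, inf_le_left, by simp [kindGroup], by simp [kindOdd, T2]⟩
    obtain ⟨L, hL, hk, he⟩ := key
    rw [he, oddSubgroup, oddSubgroup]
    refine Subgroup.closure_mono ?_
    rintro g ⟨hg, ho⟩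
    exact ⟨h1 (mem_kindOdd_iff.2 ⟨hk hg, induces_one_of_orderOf (hL hg) ho⟩), ho⟩

theorem oddSubgroup_namedGroup (A : IrreducibleName) :
    oddSubgroup (namedGroup A) = kindOdd (isQuarter A) :=
  oddSubgroup_eq_kindOdd (kindOdd_le_namedGroup A) (namedGroup_le_kindGroup A)
    (namedGroup_le_latticeAut A)

/-! ### The named groups are irreducible space groups -/

/-- The cyclic permutation makes the coordinates of such a vector equal up to sign, and a half-turn
makes one of them vanish. -/
theorem isIrreducible_of_T2_le {G : Subgroup Isom3} (h : T2 ≤ G) : IsIrreducibleGroup G := by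
  rintro ⟨v, hv, hG⟩
  have h1 := hG _ (h cyc_mem_T2)
  have h2 := hG _ (h (diag_mem_T2 (ε := ![1, -1, -1]) (by simp)))
  rw [signedIso_linear] at h1 h2
  apply hv
  have hc : ∀ i, signedLin cyc3 1 v i = v (i + 1) := fun i => by
    simp [signedLin_apply, cyc3_apply]
  have d0 : signedLin 1 ![1, -1, -1] v 0 = v 0 := by simp [signedLin_apply]
  have d1 : signedLin 1 ![1, -1, -1] v 1 = -v 1 := by simp [signedLin_apply]
  have d2 : signedLin 1 ![1, -1, -1] v 2 = -v 2 := by simp [signedLin_apply]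
  have hz : v 0 = 0 ∧ v 1 = 0 ∧ v 2 = 0 := by
    have c0 := hc 0
    have c1 := hc 1
    have c2 := hc 2
    simp only [zero_add, show (1 + 1 : Fin 3) = 2 from rfl, show (2 + 1 : Fin 3) = 0 from rfl]
      at c0 c1 c2
    rcases h1 with h1 | h1 <;> rcases h2 with h2 | h2 <;>
      rw [h1] at c0 c1 c2 <;> rw [h2] at d0 d1 d2 <;>
      simp only [PiLp.neg_apply] at c0 c1 c2 d0 d1 d2 <;>
      refine ⟨?_, ?_, ?_⟩ <;> linarith
  ext i
  fin_cases i
  · exact hz.1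
  · exact hz.2.1
  · exact hz.2.2

theorem isSpaceGroup_of_T2_le {G : Subgroup Isom3} (h : T2 ≤ G) (hG : G ≤ latticeAut) :
    IsSpaceGroup G := by
  refine ⟨fun K hK x => ?_, ?_⟩
  · obtain ⟨r, hr⟩ := hK.isBounded.exists_norm_le
    -- The translation part `T / 2` is the difference of the image of `x` in `K` and a vector of
    -- length `‖x‖`, so `T` is bounded.
    let N : ℤ := ⌈2 * (r + ‖x‖)⌉
    have hfin : (Set.univ ×ˢ (Set.univ ×ˢ (Set.pi Set.univ fun _ : Fin 3 => Set.Icc (-N) N)) :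
        Set (Equiv.Perm (Fin 3) × (Fin 3 → ℤˣ) × (Fin 3 → ℤ))).Finite :=
      Set.finite_univ.prod (Set.finite_univ.prod (Set.Finite.pi fun _ => Set.finite_Icc _ _))
    refine (hfin.image fun p => signedIso p.1 p.2.1 p.2.2).subset ?_
    rintro g ⟨hg, hgK⟩
    obtain ⟨σ, ε, T, hT, rfl⟩ := (mem_latticeAut_iff g).1 (hG hg)
    refine ⟨(σ, ε, T), ⟨trivial, trivial, fun i _ => ?_⟩, rfl⟩
    have h1 := (PiLp.norm_apply_le (signedIso σ ε T x) i).trans (hr _ hgK)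
    have h2 := PiLp.norm_apply_le x (σ i)
    rw [signedIso_apply] at h1
    have h3 : |(T i : ℝ)| ≤ 2 * (r + ‖x‖) := by
      rw [Real.norm_eq_abs] at h1 h2
      rcases Int.units_eq_one_or (ε i) with h | h <;> simp [h] at h1 <;>
        rw [abs_le] at * <;> constructor <;> linarith
    have h4 : |(T i : ℝ)| ≤ N := h3.trans (Int.le_ceil _)
    have h5 : |T i| ≤ N := by exact_mod_cast h4
    exact abs_le.1 h5
  -- The translations by even vectors bring every point into the cube `[0, 2]³`, well inside this
  -- ball.
  · refine ⟨Metric.closedBall 0 6, isCompact_closedBall _ _, fun x => ?_⟩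
    refine ⟨_, h (translation_mem_T2 fun i => ⌊x i / 2⌋),
      x - WithLp.toLp 2 fun i => 2 * (⌊x i / 2⌋ : ℝ),
      ?_, ?_⟩
    · rw [mem_closedBall_zero_iff, ← abs_of_nonneg (norm_nonneg _),
        ← abs_of_nonneg (show (0 : ℝ) ≤ 6 by norm_num), ← sq_le_sq, norm_sq_fin_three]
      have hb : ∀ i, (x i - 2 * (⌊x i / 2⌋ : ℝ)) ^ 2 ≤ 4 := fun i => by
        have h1 := Int.floor_le (x i / 2)
        have h2 := Int.lt_floor_add_one (x i / 2)
        nlinarith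
      have h0 := hb 0
      have h1 := hb 1
      have h2 := hb 2
      simp only [PiLp.sub_apply]
      linarith
    · ext i
      simp
      ring

/-! ### Inclusions up to congruence -/

theorem mem_conjGroup {g h : Isom3} {G : Subgroup Isom3} :
    h ∈ conjGroup g G ↔ ∃ k ∈ G, g * k * g⁻¹ = h := by
  rw [conjGroup, Subgroup.mem_map]
  rfl

theorem conjGroup_le_iff {g : Isom3} {G H : Subgroup Isom3} :
    conjGroup g G ≤ H ↔ ∀ k ∈ G, g * k * g⁻¹ ∈ H := by
  rw [conjGroup, Subgroup.map_le_iff_le_comap]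
  rfl

theorem orderOf_conj (g k : Isom3) : orderOf (g * k * g⁻¹) = orderOf k :=
  (MulAut.conj g).orderOf_eq k

theorem conj_mem_oddSubgroup {G H : Subgroup Isom3} {g : Isom3}
    (h : ∀ k ∈ G, g * k * g⁻¹ ∈ H) : ∀ k ∈ oddSubgroup G, g * k * g⁻¹ ∈ oddSubgroup H := by
  rw [← conjGroup_le_iff, conjGroup, Subgroup.map_le_iff_le_comap, oddSubgroup,
    Subgroup.closure_le]
  rintro k ⟨hk, h3⟩
  exact Subgroup.subset_closure ⟨h k hk, (orderOf_conj g k).trans h3⟩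

/-- The odd subgroup of the one group contains `T2`, that of the other is contained in `T1`, and
conjugation respects odd subgroups. -/
theorem mem_latticeAut_of_conj_le {A B : IrreducibleName} {g : Isom3}
    (h : conjGroup g (namedGroup A) ≤ namedGroup B) : g ∈ latticeAut := by
  rw [conjGroup_le_iff] at h
  have h1 := conj_mem_oddSubgroup h
  rw [oddSubgroup_namedGroup, oddSubgroup_namedGroup] at h1
  exact mem_latticeAut_of_conj fun k hk => kindOdd_le_T1 _ (h1 k (T2_le_kindOdd _ hk))

/-- The translation by `(1, 1, 0)` separates them. -/
theorem not_T1_le_T2 : ¬ T1 ≤ T2 := by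
  intro h
  have h1 : signedIso 1 1 ![2, 2, 0] ∈ T1 := by
    rw [T1_eq, mem_fullGroup_bot, induces_one_iff (by simp [sameParity_iff])]
    simp
  have h2 := h h1
  rw [T2_eq] at h2
  have h3 := (translation_mem_lineGroup_iff (by simp [sameParity_iff])).1 h2.1
  revert h3
  simp
  decide

theorem signedGroup_conj_le {A B : IrreducibleName} {g : Isom3} {s : SignedPerm}
    (hs : Induces g s) (h : conjGroup g (namedGroup A) ≤ namedGroup B) :
    ∀ x ∈ signedGroup A, s * x * s⁻¹ ∈ signedGroup B := by
  intro x hx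
  rw [conjGroup_le_iff] at h
  obtain ⟨k, hk, hkx⟩ := exists_kind_induces (isQuarter A) (signedGroup_dihedral hx)
    fun hq => signedGroup_quarter hq hx
  exact ((mem_namedGroup_of_induces (induces_conj hs hkx)).1
    (h k ((mem_namedGroup_of_induces hkx).2 ⟨hk, hx⟩))).2

theorem signedPerm_conj_snd (s x : SignedPerm) : (s * x * s⁻¹).2 = x.2 := by
  rw [Prod.snd_mul, Prod.snd_mul, Prod.snd_inv, mul_comm s.2, mul_inv_cancel_right]

theorem signedPerm_conj_fst (s x : SignedPerm) :
    (s.1, 1) * x * (s.1, 1)⁻¹ = s * x * s⁻¹ :=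
  Prod.ext rfl (by rw [signedPerm_conj_snd, signedPerm_conj_snd])

theorem included_iff (A B : IrreducibleName) : Included A B ↔ inclusionTest A B = true := by
  rw [inclusionTest_iff]
  constructor
  · rintro ⟨g, h⟩
    have hg := mem_latticeAut_of_conj_le h
    obtain ⟨s, hs⟩ := exists_induces hg
    refine ⟨fun hB => ?_, s, hs.mem_dihedral, signedGroup_conj_le hs h⟩
    by_contra hA
    rw [conjGroup_le_iff] at h
    have h1 := conj_mem_oddSubgroup h
    rw [oddSubgroup_namedGroup, oddSubgroup_namedGroup, hB, Bool.eq_false_of_not_eq_true hA] at h1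
    -- If only the larger group were a quarter group, `g` would conjugate `T1` into `T2`; but `g`
    -- normalizes `T1`.
    apply not_T1_le_T2
    intro t ht
    have h2 := h1 _ (conj_mem_T1 (inv_mem hg) ht)
    have e : g * (g⁻¹ * t * g⁻¹⁻¹) * g⁻¹ = t := by group
    rwa [e] at h2
  · rintro ⟨hq, s, hs, h⟩
    -- Choosing the conjugating isometry among the line-preserving symmetries makes one argument
    -- serve for all kinds of groups.
    obtain ⟨g, hl, hg⟩ := exists_line_induces hs
    refine ⟨g, conjGroup_le_iff.2 fun k hk => ?_⟩
    obtain ⟨hk1, x, hx, hkx⟩ := (mem_namedGroup_iff A k).1 hk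
    rw [mem_namedGroup_of_induces (induces_conj hg hkx), signedPerm_conj_fst]
    refine ⟨?_, h x hx⟩
    have hg' := lineGroup_le_kindGroup (isQuarter B) hl
    exact mul_mem (mul_mem hg' (kindGroup_le hq hk1)) (inv_mem hg')

theorem minimalInclusion_iff (A B : IrreducibleName) :
    MinimalInclusion A B ↔ HeavyBox A B ∨ HeavyEdge A B ∨ ThinEdge A B := by
  rw [← minimal_tableTest_iff]
  simp only [MinimalInclusion, included_iff, inclusionTest_eq_tableTest]

/-! ### Classification -/

/-- The group normalizes its odd subgroup, so rigidity makes it a group of lattice automorphisms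
(preserving the lines for `T2`). Being a union of cosets of `kindOdd b`, it is determined by the
signed permutations that it induces. -/
theorem exists_named_of_oddSubgroup {G : Subgroup Isom3} {b : Bool}
    (hG : oddSubgroup G = kindOdd b) :
    ∃ (A : IrreducibleName) (g : Isom3), conjGroup g (namedGroup A) = G := by
  have hle : kindOdd b ≤ G := by
    rw [← hG, oddSubgroup, Subgroup.closure_le]
    exact fun g hg => hg.1
  have hnorm : ∀ g ∈ G, ∀ k ∈ kindOdd b, g * k * g⁻¹ ∈ kindOdd b := by
    intro g hg
    rw [← hG]
    exact conj_mem_oddSubgroup fun k hk => G.mul_mem (G.mul_mem hg hk) (G.inv_mem hg)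
  have haut : G ≤ latticeAut := fun g hg => mem_latticeAut_of_conj fun k hk =>
    kindOdd_le_T1 b (hnorm g hg k (T2_le_kindOdd b hk))
  have hkind : G ≤ kindGroup b := by
    intro g hg
    cases b
    · simp [kindGroup]
    · simpa [kindGroup] using mem_lineGroup_of_conj (haut hg) (by simpa [kindOdd] using hnorm g hg)
  let S : Subgroup SignedPerm :=
    { carrier := {s | ∃ g ∈ G, Induces g s}
      one_mem' := ⟨1, G.one_mem, Induces.one⟩
      mul_mem' := by
        rintro s t ⟨g, hg, hs⟩ ⟨h, hh, ht⟩
        exact ⟨g * h, G.mul_mem hg hh, hs.mul ht⟩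
      inv_mem' := by
        rintro s ⟨g, hg, hs⟩
        exact ⟨g⁻¹, G.inv_mem hg, hs.inv⟩ }
  have hmem : ∀ {g : Isom3} {s : SignedPerm}, g ∈ kindGroup b → Induces g s →
      (g ∈ G ↔ s ∈ S) := by
    intro g s hk hs
    refine ⟨fun hg => ⟨g, hg, hs⟩, ?_⟩
    rintro ⟨h, hh, hhs⟩
    have h1 : h⁻¹ * g ∈ kindOdd b := by
      refine mem_kindOdd_iff.2 ⟨mul_mem (inv_mem (hkind hh)) hk, ?_⟩
      simpa using hhs.inv.mul hs
    have h2 := G.mul_mem hh (hle h1)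
    rwa [mul_inv_cancel_left] at h2
  obtain ⟨A, hA, s, hs, hconj⟩ := exists_signedGroup_conj S (by
    rintro s ⟨g, -, hs⟩
    exact hs.mem_dihedral)
  -- When the lines are preserved, all signs are `+`; this leaves only the groups `N`, which are
  -- then read as `N/4`.
  obtain ⟨B, hB, hBS⟩ : ∃ B, isQuarter B = b ∧ signedGroup B = signedGroup A := by
    cases b
    · exact ⟨A, hA, rfl⟩
    · have hsign : ∀ x ∈ signedGroup A, x.2 = 1 := by
        intro x hx
        obtain ⟨g, hg, hgx⟩ := (hconj x).1 hx
        rw [← signedPerm_conj_snd s]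
        exact lineGroup_sign (by simpa [kindGroup] using hkind hg) hgx
      cases A with
      | full N => exact ⟨.quarter N, rfl, rfl⟩
      | double N =>
        have := hsign (1, -1) ⟨one_mem _, trivial⟩
        exact absurd this (by decide : ¬ (-1 : ℤˣ) = 1)
      | mixed e =>
        exfalso
        have key : ∃ π ∈ dihedralElements e.upper, π ∉ dihedralElements e.lower := by
          cases e <;> decide
        obtain ⟨π, h1, h2⟩ := key
        have := hsign (π, -1) ⟨h1, iff_of_false (by decide : ¬ (-1 : ℤˣ) = 1) h2⟩
        exact absurd this (by decide : ¬ (-1 : ℤˣ) = 1)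
      | quarter N => simp [isQuarter] at hA
  obtain ⟨g, hl, hg⟩ := exists_line_induces hs
  have hgk := lineGroup_le_kindGroup b hl
  refine ⟨B, g, le_antisymm (conjGroup_le_iff.2 fun k hk => ?_) fun h hh => ?_⟩
  · obtain ⟨hk1, x, hx, hkx⟩ := (mem_namedGroup_iff B k).1 hk
    rw [hB] at hk1
    rw [hmem (mul_mem (mul_mem hgk hk1) (inv_mem hgk)) (induces_conj hg hkx),
      signedPerm_conj_fst, ← hconj,
      ← hBS]
    exact hx
  · obtain ⟨y, hy⟩ := exists_induces (haut hh)
    refine mem_conjGroup.2 ⟨g⁻¹ * h * g⁻¹⁻¹, ?_, by group⟩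
    rw [mem_namedGroup_of_induces (induces_conj hg.inv hy), hB, hBS, hconj, ← signedPerm_conj_fst]
    refine ⟨mul_mem (mul_mem (inv_mem hgk) (hkind hh)) (inv_mem (inv_mem hgk)), ?_⟩
    have e : ((s.1, 1) : SignedPerm) * ((s.1, 1)⁻¹ * y * (s.1, 1)⁻¹⁻¹) * (s.1, 1)⁻¹ = y := by group
    rw [e]
    exact ⟨h, hh, hy⟩

/-! ### Indices -/

/-- The homomorphism that maps an automorphism of the lattice to the signed permutation that it
induces. -/
noncomputable def inducedHom : latticeAut →* SignedPerm :=
  MonoidHom.mk' (fun g => (exists_induces g.2).choose) fun g h =>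
    (exists_induces (g * h).2).choose_spec.unique
      ((exists_induces g.2).choose_spec.mul (exists_induces h.2).choose_spec)

theorem induces_inducedHom (g : latticeAut) : Induces g.1 (inducedHom g) :=
  (exists_induces g.2).choose_spec

/-- The index is pulled back along the surjection onto `S'`. -/
theorem relIndex_fullGroup {L : Subgroup Isom3} {S S' : Subgroup SignedPerm}
    (h : ∀ s ∈ S', ∃ g ∈ L, Induces g s) :
    (L ⊓ fullGroup S).relIndex (L ⊓ fullGroup S') = S.relIndex S' := by
  have hle : L ⊓ fullGroup S' ≤ latticeAut := inf_le_right.trans (fullGroup_le_latticeAut _)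
  let f := inducedHom.comp (Subgroup.inclusion hle)
  have hf : ∀ g : ↥(L ⊓ fullGroup S'), Induces g.1 (f g) := fun g =>
    induces_inducedHom (Subgroup.inclusion hle g)
  have hrange : f.range = S' := by
    ext s
    constructor
    · rintro ⟨g, rfl⟩
      obtain ⟨t, ht, hgt⟩ := g.2.2
      rwa [(hf g).unique hgt]
    · intro hs
      obtain ⟨g, hL, hg⟩ := h s hs
      exact ⟨⟨g, hL, s, hs, hg⟩, (hf _).unique hg⟩
  have hcomap : (L ⊓ fullGroup S).subgroupOf (L ⊓ fullGroup S') = S.comap f := by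
    ext g
    rw [Subgroup.mem_subgroupOf, Subgroup.mem_comap]
    constructor
    · rintro ⟨-, s, hs, hgs⟩
      rwa [(hf g).unique hgs]
    · intro hs
      exact ⟨g.2.1, _, hs, hf g⟩
  rw [Subgroup.relIndex, hcomap, Subgroup.index_comap, hrange]

theorem relIndex_mul_card {S S' : Subgroup SignedPerm} (h : S ≤ S') :
    Nat.card S * S.relIndex S' = Nat.card S' := by
  rw [← Subgroup.relIndex_bot_left, ← Subgroup.relIndex_bot_left,
    Subgroup.relIndex_mul_relIndex ⊥ S S' bot_le h]

theorem relIndex_eq_two {S S' : Subgroup SignedPerm} {n : ℕ} (hn : 0 < n) (h : S ≤ S')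
    (h1 : Nat.card S = n) (h2 : Nat.card S' = 2 * n) : S.relIndex S' = 2 := by
  have h3 := relIndex_mul_card h
  rw [h1, h2, mul_comm 2 n] at h3
  exact Nat.eq_of_mul_eq_mul_left hn h3

theorem namedGroup_le {A B : IrreducibleName} (hq : isQuarter A = isQuarter B)
    (h : signedGroup A ≤ signedGroup B) : namedGroup A ≤ namedGroup B := by
  intro g hg
  obtain ⟨h1, s, hs, hgs⟩ := (mem_namedGroup_iff A g).1 hg
  exact (mem_namedGroup_iff B g).2 ⟨hq ▸ h1, s, h hs, hgs⟩

theorem relIndex_namedGroup {A B : IrreducibleName} (hq : isQuarter A = isQuarter B)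
    (h : signedGroup A ≤ signedGroup B) (ho : nameOrder B = 2 * nameOrder A) :
    (namedGroup A).relIndex (namedGroup B) = 2 := by
  rw [namedGroup_eq, namedGroup_eq, hq, relIndex_fullGroup fun s hs =>
    exists_kind_induces _ (signedGroup_dihedral hs) fun hb => signedGroup_quarter hb hs]
  exact relIndex_eq_two (nameOrder_pos A) h (card_signedGroup A) (ho ▸ card_signedGroup B)

theorem heavyEdge_relIndex {A B : IrreducibleName} (h : HeavyEdge A B) :
    namedGroup A ≤ namedGroup B ∧ (namedGroup A).relIndex (namedGroup B) = 2 := by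
  obtain ⟨h1, h2⟩ := signedGroup_heavyEdge h
  exact ⟨namedGroup_le h2 h1, relIndex_namedGroup h2 h1
    (nameOrder_edge (List.mem_append_left _ ((heavyEdge_iff A B).1 h)))⟩

theorem full_le_double (N : DihedralName) :
    namedGroup (.full N) ≤ namedGroup (.double N) ∧
      (namedGroup (.full N)).relIndex (namedGroup (.double N)) = 2 := by
  have h : signedGroup (.full N) ≤ signedGroup (.double N) := fun s hs => ⟨hs.1, trivial⟩
  exact ⟨namedGroup_le rfl h, relIndex_namedGroup rfl h rfl⟩

theorem conjGroup_fullGroup {g : Isom3} {s : SignedPerm} (hg : Induces g s)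
    (S : Subgroup SignedPerm) :
    conjGroup g (fullGroup S) = fullGroup (S.map (MulAut.conj s).toMonoidHom) := by
  ext h
  rw [mem_conjGroup]
  constructor
  · rintro ⟨k, ⟨x, hx, hkx⟩, rfl⟩
    exact ⟨_, ⟨x, hx, rfl⟩, induces_conj hg hkx⟩
  · rintro ⟨_, ⟨x, hx, rfl⟩, hh⟩
    refine ⟨g⁻¹ * h * g⁻¹⁻¹, ⟨x, hx, ?_⟩, by group⟩
    have h1 := induces_conj hg.inv hh
    have e : s⁻¹ * (MulAut.conj s).toMonoidHom x * s⁻¹⁻¹ = x := by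
      change s⁻¹ * (s * x * s⁻¹) * s⁻¹⁻¹ = x
      group
    rwa [e] at h1

/-- Some of these inclusions, such as `2°⁻ ⊂ 4⁻⁻`, hold only after conjugation. Any conjugating
isometry is a lattice automorphism, so the index is a ratio of orders of groups of signed
permutations. -/
theorem thinEdge_relIndex {A B : IrreducibleName} (h : ThinEdge A B) {g : Isom3}
    (hg : conjGroup g (namedGroup A) ≤ namedGroup B) :
    (conjGroup g (namedGroup A)).relIndex (namedGroup B) = 2 := by
  obtain ⟨s, hs⟩ := exists_induces (mem_latticeAut_of_conj_le hg)
  have hconj := signedGroup_conj_le hs hg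
  have hq : isQuarter A = false ∧ isQuarter B = false := by cases h <;> exact ⟨rfl, rfl⟩
  have ho := nameOrder_edge (List.mem_append_right _ ((thinEdge_iff A B).1 h))
  rw [namedGroup_eq A, namedGroup_eq B, hq.1, hq.2]
  have htop : ∀ H : Subgroup Isom3, kindGroup false ⊓ H = H := fun H => by simp [kindGroup]
  rw [htop (fullGroup (signedGroup A)), conjGroup_fullGroup hs, ← htop (fullGroup (_ : Subgroup _)),
    relIndex_fullGroup fun s hs =>
      exists_kind_induces _ (signedGroup_dihedral hs) fun hb => by simp at hb]
  refine relIndex_eq_two (nameOrder_pos A) ?_ ?_ (ho ▸ card_signedGroup B)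
  · rintro _ ⟨x, hx, rfl⟩
    exact hconj x hx
  · rw [← card_signedGroup A]
    exact (Nat.card_congr ((signedGroup A).equivMapOfInjective _
      (MulAut.conj s).injective).toEquiv).symm

/-- Representatives of the cosets of `N/4` in `N`. -/
def quarterRep (i : Fin 4) : Fin 3 → ℤ := ![![0, 0, 0], ![2, 2, 0], ![2, 0, 2], ![0, 2, 2]] i

theorem quarterRep_sameParity (i : Fin 4) : SameParity (quarterRep i) := by
  rw [sameParity_iff]
  revert i
  decide

theorem quarterRep_induces (i : Fin 4) : Induces (signedIso 1 1 (quarterRep i)) 1 := by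
  rw [induces_one_iff (quarterRep_sameParity i)]
  refine ⟨by simp, by simp, ?_⟩
  revert i
  decide

theorem translation_inv_mul (S T : Fin 3 → ℤ) :
    (signedIso 1 1 S)⁻¹ * signedIso 1 1 T = signedIso 1 1 (T - S) := by
  rw [signedIso_inv, signedIso_mul]
  refine signedIso_congr (by simp) (fun i => by simp) (fun i => ?_)
  simp
  ring

theorem quarter_le_full (N : DihedralName) :
    namedGroup (.quarter N) ≤ namedGroup (.full N) := by
  intro g hg
  obtain ⟨-, h⟩ := (mem_namedGroup_iff _ g).1 hg
  exact (mem_namedGroup_iff (.full N) g).2 ⟨by simp [kindGroup, isQuarter], h⟩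

/-- Every element is a translation times a line-preserving symmetry, and sign `+` makes the doubled
translation vector even. Modulo 4 there are eight such vectors, and `(2, 2, 2)` preserves the lines,
which leaves four classes. -/
theorem quarter_relIndex (N : DihedralName) :
    (namedGroup (.quarter N)).relIndex (namedGroup (.full N)) = 4 := by
  have hfull : ∀ {g s}, Induces g s → (g ∈ namedGroup (.full N) ↔ s ∈ signedGroup (.full N)) :=
    fun h => by simp [mem_namedGroup_of_induces h, kindGroup, isQuarter]
  have hquarter : ∀ {g s}, Induces g s → (g ∈ namedGroup (.quarter N) ↔
      g ∈ lineGroup ∧ s ∈ signedGroup (.full N)) :=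
    fun h => by simp [mem_namedGroup_of_induces h, kindGroup, isQuarter, signedGroup]
  have hsub : ∀ i j, SameParity (quarterRep j - quarterRep i) := fun i j k l => by
    have h1 := quarterRep_sameParity i k l
    have h2 := quarterRep_sameParity j k l
    simp only [Pi.sub_apply]
    omega
  let rep : Fin 4 → namedGroup (.full N) := fun i =>
    ⟨signedIso 1 1 (quarterRep i), (hfull (quarterRep_induces i)).2 (one_mem _)⟩
  let f : Fin 4 →
      namedGroup (.full N) ⧸ (namedGroup (.quarter N)).subgroupOf (namedGroup (.full N)) :=
    fun i => QuotientGroup.mk (rep i)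
  have hbij : Function.Bijective f := by
    constructor
    · intro i j hij
      have h1 := (QuotientGroup.eq (s := (namedGroup (.quarter N)).subgroupOf _)).1 hij
      rw [Subgroup.mem_subgroupOf] at h1
      change (signedIso 1 1 (quarterRep i))⁻¹ * signedIso 1 1 (quarterRep j) ∈ _ at h1
      have h2 := ((mem_namedGroup_iff _ _).1 h1).1
      rw [translation_inv_mul] at h2
      have h3 := (translation_mem_lineGroup_iff (hsub i j)).1
        (by simpa [kindGroup, isQuarter] using h2)
      have key : ∀ i j, (((quarterRep j - quarterRep i) 1 : ℤ) : ZMod 4) =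
          ((quarterRep j - quarterRep i) 0 : ℤ) → (((quarterRep j - quarterRep i) 2 : ℤ) : ZMod 4) =
          ((quarterRep j - quarterRep i) 0 : ℤ) → i = j := by decide
      exact key i j h3.2.1 h3.2.2
    · intro q
      obtain ⟨⟨g, hg⟩, rfl⟩ := QuotientGroup.mk_surjective q
      obtain ⟨s, hs⟩ := exists_induces (namedGroup_le_latticeAut _ hg)
      have hsN := (hfull hs).1 hg
      have hs2 : s.2 = 1 := hsN.2
      obtain ⟨S, h, hS, hl, ⟨π, hπ⟩, rfl⟩ := exists_line_decomp hs.mem_latticeAut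
      have hu := ((induces_signedIso hS).mul hπ).unique hs
      rw [← hu] at hs2
      have hpar : S 0 % 2 = 0 := by
        by_contra hne
        simp [inducedPerm, paritySign, hne] at hs2
      have hz := hS.zmod
      have h0 := (two_mul_intCast_eq_zero (S 0)).2 hpar
      have key : ∀ a b c : ZMod 4, 2 * a = 2 * b ∧ 2 * a = 2 * c → 2 * a = 0 → ∃ i,
          2 * (a - (quarterRep i 0 : ℤ)) = 0 ∧ b - (quarterRep i 1 : ℤ) = a - (quarterRep i 0 : ℤ) ∧
          c - (quarterRep i 2 : ℤ) = a - (quarterRep i 0 : ℤ) := by decide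
      obtain ⟨i, hi⟩ := key _ _ _ hz h0
      refine ⟨i, (QuotientGroup.eq (s := (namedGroup (.quarter N)).subgroupOf _)).2 ?_⟩
      rw [Subgroup.mem_subgroupOf]
      change (signedIso 1 1 (quarterRep i))⁻¹ * (signedIso 1 1 S * h) ∈ _
      have hind := (quarterRep_induces i).inv.mul hs
      rw [hquarter hind, inv_one, one_mul]
      refine ⟨?_, hsN⟩
      rw [← mul_assoc, translation_inv_mul]
      refine lineGroup.mul_mem ((translation_mem_lineGroup_iff fun k l => ?_).2 ?_) hl
      · have h1 := quarterRep_sameParity i k l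
        have h2 := hS k l
        simp only [Pi.sub_apply]
        omega
      · simpa only [Pi.sub_apply, Int.cast_sub] using hi
  rw [Subgroup.relIndex, Subgroup.index, ← Nat.card_congr (Equiv.ofBijective f hbij), Nat.card_fin]

/-! ### Affine equivalence -/

theorem AffineConjugates.symm {φ : E3 ≃ᵃ[ℝ] E3} {G H : Subgroup Isom3}
    (h : AffineConjugates φ G H) : AffineConjugates φ.symm H G := by
  have key : ∀ {g k : Isom3}, (∀ x, k (φ x) = φ (g x)) → ∀ y, g (φ.symm y) = φ.symm (k y) :=
    fun {g k} hgk y => by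
      have := hgk (φ.symm y)
      rw [AffineEquiv.apply_symm_apply] at this
      rw [this, AffineEquiv.symm_apply_apply]
  refine ⟨fun k hk => ?_, fun g hg => ?_⟩
  · obtain ⟨g, hg, hgk⟩ := h.2 k hk
    exact ⟨g, hg, key hgk⟩
  · obtain ⟨k, hk, hgk⟩ := h.1 g hg
    exact ⟨k, hk, key hgk⟩

/-- Conjugation by an affine bijection preserves order 3. -/
theorem affine_odd_aux {φ : E3 ≃ᵃ[ℝ] E3} {G H : Subgroup Isom3}
    (h : ∀ g ∈ G, ∃ k ∈ H, ∀ x : E3, k (φ x) = φ (g x)) :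
    ∀ g ∈ oddSubgroup G, ∃ k ∈ oddSubgroup H, ∀ x : E3, k (φ x) = φ (g x) := by
  intro g hg
  induction hg using Subgroup.closure_induction with
  | mem g hg =>
    obtain ⟨k, hk, hgk⟩ := h g hg.1
    refine ⟨k, Subgroup.subset_closure ⟨hk, orderOf_eq_prime ?_ ?_⟩, hgk⟩
    · have h3 := pow_orderOf_eq_one g
      rw [hg.2] at h3
      ext1 y
      obtain ⟨x, rfl⟩ := φ.surjective y
      have e : (k ^ 3) (φ x) = φ ((g ^ 3) x) := by
        simp only [pow_succ, pow_zero, one_mul, AffineIsometryEquiv.coe_mul, Function.comp_apply,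
          hgk]
      rw [e, h3]
      rfl
    · rintro rfl
      have h1 : g = 1 := by
        ext1 x
        exact (φ.injective (hgk x)).symm
      have := hg.2
      rw [h1, orderOf_one] at this
      exact absurd this (by norm_num)
  | one => exact ⟨1, one_mem _, fun x => rfl⟩
  | mul a b _ _ ha hb =>
    obtain ⟨k, hk, hk'⟩ := ha
    obtain ⟨l, hl, hl'⟩ := hb
    exact ⟨k * l, mul_mem hk hl, fun x => by
      rw [AffineIsometryEquiv.coe_mul, AffineIsometryEquiv.coe_mul, Function.comp_apply,
        Function.comp_apply, hl', hk']⟩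
  | inv a _ ha =>
    obtain ⟨k, hk, hk'⟩ := ha
    refine ⟨k⁻¹, inv_mem hk, fun x => ?_⟩
    have h1 := hk' ((a⁻¹ : Isom3) x)
    rw [isom_apply_inv_self] at h1
    rw [← h1, isom_inv_apply_self]

theorem AffineConjugates.odd {φ : E3 ≃ᵃ[ℝ] E3} {G H : Subgroup Isom3}
    (h : AffineConjugates φ G H) : AffineConjugates φ (oddSubgroup G) (oddSubgroup H) := by
  refine ⟨affine_odd_aux h.1, fun k hk => ?_⟩
  have h1 := h.symm.1
  obtain ⟨g, hg, hgk⟩ := affine_odd_aux h1 k hk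
  refine ⟨g, hg, fun x => ?_⟩
  have h2 := hgk (φ x)
  rw [AffineEquiv.symm_apply_apply] at h2
  rw [h2, AffineEquiv.apply_symm_apply]

theorem affine_apply_add (φ : E3 ≃ᵃ[ℝ] E3) (x v : E3) : φ (v + x) = φ.linear v + φ x :=
  φ.map_vadd x v

/-- The linear part of a map that conjugates `T₂` to isometries is a similarity. -/
theorem linear_norm_sq {φ : E3 ≃ᵃ[ℝ] E3} {K H : Subgroup Isom3} (hK : T2 ≤ K)
    (h : ∀ g ∈ K, ∃ k ∈ H, ∀ x : E3, k (φ x) = φ (g x)) :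
    ∀ x, ‖φ.linear x‖ ^ 2 = ‖φ.linear (EuclideanSpace.single 0 1)‖ ^ 2 * ‖x‖ ^ 2 := by
  let f : Fin 3 → E3 := fun i => φ.linear (EuclideanSpace.single i 1)
  -- The inner product pulled back along the linear part is invariant under the point group. The
  -- half-turns then make the images of the coordinate vectors orthogonal, and the cyclic
  -- permutation makes them equally long.
  have hinv : ∀ g ∈ K, ∀ x y : E3,
      inner ℝ (φ.linear (g.linearIsometryEquiv x)) (φ.linear (g.linearIsometryEquiv y)) =
        inner ℝ (φ.linear x) (φ.linear y) := by
    intro g hg x y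
    obtain ⟨k, -, hk⟩ := h g hg
    have hlin : ∀ v, φ.linear (g.linearIsometryEquiv v) = k.linearIsometryEquiv (φ.linear v) := by
      intro v
      have h1 := hk (v + 0)
      have h2 := hk 0
      rw [affine_apply_add, isom_apply_eq g, add_zero, affine_apply_add, ← h2] at h1
      have h3 := AffineIsometryEquiv.map_vadd k (φ 0) (φ.linear v)
      simp only [vadd_eq_add] at h3
      rw [h3] at h1
      exact (add_right_cancel h1).symm
    rw [hlin, hlin, LinearIsometryEquiv.inner_map_map]
  have hsingle : ∀ (ε : Fin 3 → ℤˣ) (i : Fin 3), signedLin 1 ε (EuclideanSpace.single i 1) =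
      ((ε i : ℤ) : ℝ) • EuclideanSpace.single i 1 := by
    intro ε i
    ext j
    by_cases hij : j = i
    · subst hij
      simp [signedLin_apply]
    · simp [signedLin_apply, hij]
  have hdiag : ∀ ε : Fin 3 → ℤˣ, ε 0 * ε 1 * ε 2 = 1 → ∀ i j, ε i * ε j = -1 →
      inner ℝ (f i) (f j) = (0 : ℝ) := by
    intro ε hε i j hij
    have h1 := hinv _ (hK (diag_mem_T2 hε)) (EuclideanSpace.single i 1) (EuclideanSpace.single j 1)
    rw [signedIso_linear, hsingle, hsingle, map_smul, map_smul, real_inner_smul_left,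
      real_inner_smul_right, ← mul_assoc] at h1
    have h2 : ((ε i : ℤ) : ℝ) * ((ε j : ℤ) : ℝ) = -1 := by
      have : ((ε i * ε j : ℤˣ) : ℤ) = -1 := by rw [hij]; rfl
      rw [Units.val_mul] at this
      exact_mod_cast this
    rw [h2] at h1
    change -1 * inner ℝ (f i) (f j) = inner ℝ (f i) (f j) at h1
    linarith
  have hcyc : ∀ i, ‖f i‖ ^ 2 = ‖f (i + 1)‖ ^ 2 := by
    intro i
    have h1 := hinv _ (hK cyc_mem_T2) (EuclideanSpace.single (i + 1) 1)
      (EuclideanSpace.single (i + 1) 1)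
    have h2 : signedLin cyc3 1 (EuclideanSpace.single (i + 1) 1) = EuclideanSpace.single i 1 := by
      ext j
      simp [signedLin_apply, cyc3_apply]
    rw [signedIso_linear, h2, real_inner_self_eq_norm_sq, real_inner_self_eq_norm_sq] at h1
    exact h1
  have h01 : inner ℝ (f 0) (f 1) = (0 : ℝ) := hdiag ![1, -1, -1] (by simp) 0 1 (by simp)
  have h02 : inner ℝ (f 0) (f 2) = (0 : ℝ) := hdiag ![1, -1, -1] (by simp) 0 2 (by simp)
  have h12 : inner ℝ (f 1) (f 2) = (0 : ℝ) := hdiag ![-1, 1, -1] (by simp) 1 2 (by simp)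
  have n1 : ‖f 1‖ ^ 2 = ‖f 0‖ ^ 2 := (hcyc 0).symm
  have n2 : ‖f 2‖ ^ 2 = ‖f 0‖ ^ 2 := hcyc 2
  intro x
  have hx : x = x 0 • EuclideanSpace.single 0 1 + x 1 • EuclideanSpace.single 1 1 +
      x 2 • (EuclideanSpace.single 2 1 : E3) := by
    ext i
    fin_cases i <;> simp
  have hL : φ.linear x = x 0 • f 0 + x 1 • f 1 + x 2 • f 2 := by
    conv_lhs => rw [hx]
    rw [map_add, map_add, map_smul, map_smul, map_smul]
  change _ = ‖f 0‖ ^ 2 * _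
  rw [hL, norm_add_sq_real, norm_add_sq_real, inner_add_left, real_inner_smul_left,
    real_inner_smul_left, real_inner_smul_left, real_inner_smul_right, real_inner_smul_right,
    real_inner_smul_right, h01, h02, h12, norm_smul, norm_smul, norm_smul, mul_pow, mul_pow,
    mul_pow, n1, n2, norm_sq_fin_three x, Real.norm_eq_abs, Real.norm_eq_abs, Real.norm_eq_abs,
    sq_abs, sq_abs, sq_abs]
  ring

/-- An affine conjugate of a translation is the translation by the image vector. -/
theorem exists_translation {φ : E3 ≃ᵃ[ℝ] E3} {K H : Subgroup Isom3} (hH : H ≤ latticeAut)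
    (h : ∀ g ∈ K, ∃ k ∈ H, ∀ x : E3, k (φ x) = φ (g x)) {T : Fin 3 → ℤ}
    (hT : signedIso 1 1 T ∈ K) :
    ∃ S, signedIso 1 1 S ∈ H ∧ φ.linear (halfPoint T) = halfPoint S := by
  have htr : ∀ (T : Fin 3 → ℤ) (x : E3), signedIso 1 1 T x = halfPoint T + x := fun T x => by
    ext i
    simp [add_comm]
  obtain ⟨k, hk, hkT⟩ := h _ hT
  have hk2 : ∀ y, k y = φ.linear (halfPoint T) + y := by
    intro y
    obtain ⟨x, rfl⟩ := φ.surjective y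
    rw [hkT, htr, affine_apply_add]
  obtain ⟨σ, ε, S, hS, rfl⟩ := (mem_latticeAut_iff k).1 (hH hk)
  have h0 : halfPoint S = φ.linear (halfPoint T) := by
    have := hk2 0
    rw [add_zero] at this
    rw [← this]
    ext i
    simp
  refine ⟨S, ?_, h0.symm⟩
  convert hk using 1
  ext1 y
  rw [htr, hk2, h0]

theorem translation_mem_kindOdd {b : Bool} {T : Fin 3 → ℤ} (h : signedIso 1 1 T ∈ kindOdd b) :
    T 0 % 2 = 0 ∧ T 1 % 2 = 0 ∧ T 2 % 2 = 0 ∧ (T 0 + T 1 + T 2) % 4 = 0 ∧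
      (b = true → T 0 % 4 = 0 ∧ T 1 % 4 = 0 ∧ T 2 % 4 = 0) := by
  obtain ⟨h1, h2⟩ := mem_kindOdd_iff.1 h
  have hT := signedIso_mem_latticeAut_iff.1 h2.mem_latticeAut
  rw [induces_one_iff hT] at h2
  obtain ⟨-, -, h3, h4⟩ := h2
  have h01 := hT 0 1
  have h02 := hT 0 2
  refine ⟨h3, by omega, by omega, h4, ?_⟩
  rintro rfl
  have h5 := (translation_mem_lineGroup_iff hT).1 (by simpa [kindGroup] using h1)
  obtain ⟨-, h7, h8⟩ := h5
  rw [ZMod.intCast_eq_intCast_iff, Int.modEq_iff_dvd] at h7 h8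
  push_cast at h7 h8
  omega

/-- The minimal norm of the translation vectors, in half units. -/
def kindNorm (b : Bool) : ℤ := if b then 16 else 8

theorem kindNorm_le {b : Bool} {T : Fin 3 → ℤ} (h : signedIso 1 1 T ∈ kindOdd b) (h0 : T ≠ 0) :
    kindNorm b ≤ T 0 ^ 2 + T 1 ^ 2 + T 2 ^ 2 := by
  obtain ⟨h1, h2, h3, h4, h5⟩ := translation_mem_kindOdd h
  have hsq : ∀ (m n : ℤ), m % n = 0 → m ≠ 0 → n ^ 2 ≤ m ^ 2 := fun m n hm h0 => by
    apply sq_le_sq.2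
    exact Int.le_of_dvd (abs_pos.2 h0) ((abs_dvd_abs _ _).2 (Int.dvd_of_emod_eq_zero hm))
  have hne : T 0 ≠ 0 ∨ T 1 ≠ 0 ∨ T 2 ≠ 0 := by
    by_contra hc
    push Not at hc
    apply h0
    funext i
    fin_cases i
    · exact hc.1
    · exact hc.2.1
    · exact hc.2.2
  cases b
  · change 8 ≤ _
    -- A single nonzero entry is divisible by 4 and gives at least 16; two nonzero even entries give
    -- at least `4 + 4`.
    by_cases a0 : T 0 = 0 <;> by_cases a1 : T 1 = 0 <;> by_cases a2 : T 2 = 0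
    · simp [a0, a1, a2] at hne
    · have := hsq (T 2) 4 (by omega) a2
      nlinarith
    · have := hsq (T 1) 4 (by omega) a1
      nlinarith
    · have := hsq _ _ h2 a1
      have := hsq _ _ h3 a2
      nlinarith
    · have := hsq (T 0) 4 (by omega) a0
      nlinarith
    · have := hsq _ _ h1 a0
      have := hsq _ _ h3 a2
      nlinarith
    · have := hsq _ _ h1 a0
      have := hsq _ _ h2 a1
      nlinarith
    · have := hsq _ _ h1 a0
      have := hsq _ _ h2 a1
      nlinarith [sq_nonneg (T 2)]
  · change 16 ≤ _
    obtain ⟨b0, b1, b2⟩ := h5 rfl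
    rcases hne with hn | hn | hn
    · have := hsq _ _ b0 hn
      nlinarith [sq_nonneg (T 1), sq_nonneg (T 2)]
    · have := hsq _ _ b1 hn
      nlinarith [sq_nonneg (T 0), sq_nonneg (T 2)]
    · have := hsq _ _ b2 hn
      nlinarith [sq_nonneg (T 0), sq_nonneg (T 1)]

theorem norm_halfPoint_sq (T : Fin 3 → ℤ) :
    ‖halfPoint T‖ ^ 2 = ((T 0 ^ 2 + T 1 ^ 2 + T 2 ^ 2 : ℤ) : ℝ) / 4 := by
  rw [norm_sq_fin_three]
  simp only [halfPoint_apply]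
  push_cast
  ring

theorem exists_kindNorm (b : Bool) : ∃ T : Fin 3 → ℤ, signedIso 1 1 T ∈ kindOdd b ∧ T ≠ 0 ∧
    T 0 ^ 2 + T 1 ^ 2 + T 2 ^ 2 = kindNorm b := by
  cases b
  · refine ⟨![2, 2, 0], ?_, fun h => by simpa using congrFun h 0, by simp [kindNorm]⟩
    rw [mem_kindOdd_iff, induces_one_iff (by simp [sameParity_iff])]
    simp [kindGroup]
  · refine ⟨4 • ![1, 0, 0], translation_mem_T2 _, fun h => by simpa using congrFun h 0,
      by simp [kindNorm]⟩

/-- The scale of a similarity between odd subgroups is bounded from below. -/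
theorem scale_ge {φ : E3 ≃ᵃ[ℝ] E3} {a b : Bool}
    (h : AffineConjugates φ (kindOdd a) (kindOdd b)) :
    (kindNorm b : ℝ) ≤ ‖φ.linear (EuclideanSpace.single 0 1)‖ ^ 2 * kindNorm a := by
  obtain ⟨T, hT, hT0, hn⟩ := exists_kindNorm a
  obtain ⟨S, hS, hTS⟩ := exists_translation
    ((kindOdd_le_T1 b).trans (T1_eq ▸ fullGroup_le_latticeAut _)) h.1 hT
  have h1 := linear_norm_sq (T2_le_kindOdd a) h.1 (halfPoint T)
  rw [hTS, norm_halfPoint_sq, norm_halfPoint_sq, hn] at h1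
  have hS0 : S ≠ 0 := by
    rintro rfl
    have e0 : halfPoint 0 = 0 := by
      ext i
      simp
    rw [e0, LinearEquiv.map_eq_zero_iff, ← e0] at hTS
    exact hT0 (halfPoint_injective hTS)
  have h2 : (kindNorm b : ℝ) ≤ ((S 0 ^ 2 + S 1 ^ 2 + S 2 ^ 2 : ℤ) : ℝ) := by
    exact_mod_cast kindNorm_le hS hS0
  linarith

theorem scale_mul_scale {φ : E3 ≃ᵃ[ℝ] E3} {a b : Bool}
    (h : AffineConjugates φ (kindOdd a) (kindOdd b)) :
    ‖φ.linear (EuclideanSpace.single 0 1)‖ ^ 2 *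
      ‖φ.symm.linear (EuclideanSpace.single 0 1)‖ ^ 2 = 1 := by
  have h1 := linear_norm_sq (T2_le_kindOdd a) h.1 (φ.symm.linear (EuclideanSpace.single 0 1))
  have h2 : φ.linear (φ.symm.linear (EuclideanSpace.single 0 1)) = EuclideanSpace.single 0 1 :=
    φ.linear.apply_symm_apply _
  rw [h2] at h1
  rw [← h1]
  simp

/-- The squared scale must be 2, so shortest vectors of the face-centred lattice become shortest
vectors of a primitive cubic one. But the former contain two vectors together with their difference,
and the latter do not: this would give inner product `1/2` for integral vectors. -/
theorem not_affineConjugates_T1_T2 (φ : E3 ≃ᵃ[ℝ] E3) : ¬ AffineConjugates φ T1 T2 := by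
  intro h
  have h' : AffineConjugates φ (kindOdd false) (kindOdd true) := by simpa [kindOdd] using h
  have h1 := scale_ge h'
  have h2 := scale_ge h'.symm
  have h3 := scale_mul_scale h'
  have hn := linear_norm_sq (T2_le_kindOdd false) h'.1
  simp only [kindNorm, if_true, Bool.false_eq_true, if_false] at h1 h2
  generalize ‖φ.linear (EuclideanSpace.single 0 1)‖ ^ 2 = κ at *
  generalize ‖φ.symm.linear (EuclideanSpace.single 0 1)‖ ^ 2 = κ' at *
  have hκ : κ = 2 := by
    push_cast at h1 h2
    nlinarith
  subst hκ
  have key : ∀ T : Fin 3 → ℤ, SameParity T → T 0 % 2 = 0 → (T 0 + T 1 + T 2) % 4 = 0 →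
      T 0 ^ 2 + T 1 ^ 2 + T 2 ^ 2 = 8 → ∃ v : Fin 3 → ℤ,
        φ.linear (halfPoint T) = halfPoint (4 • v) ∧ v 0 ^ 2 + v 1 ^ 2 + v 2 ^ 2 = 1 := by
    intro T hT h0 h4 hT8
    have hmem : signedIso 1 1 T ∈ T1 := by
      rw [T1_eq, mem_fullGroup_bot, induces_one_iff hT]
      exact ⟨by simp, by simp, h0, h4⟩
    obtain ⟨S, hS, hTS⟩ := exists_translation
      (T2_le_T1.trans (T1_eq ▸ fullGroup_le_latticeAut _)) h.1 hmem
    obtain ⟨-, -, -, -, h5⟩ := translation_mem_kindOdd (b := true) (by simpa [kindOdd] using hS)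
    obtain ⟨b0, b1, b2⟩ := h5 rfl
    have hS4 : S = 4 • fun i => S i / 4 := by
      funext i
      fin_cases i <;> simp <;> omega
    refine ⟨fun i => S i / 4, by rw [hTS, ← hS4], ?_⟩
    have e := hn (halfPoint T)
    rw [hTS, norm_halfPoint_sq, norm_halfPoint_sq, hT8, hS4] at e
    simp only [Pi.smul_apply, nsmul_eq_mul] at e
    push_cast at e
    have e2 : ((S 0 / 4 : ℤ) : ℝ) ^ 2 + ((S 1 / 4 : ℤ) : ℝ) ^ 2 + ((S 2 / 4 : ℤ) : ℝ) ^ 2 = 1 := by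
      linarith
    exact_mod_cast e2
  obtain ⟨u, hu, hu1⟩ := key ![2, 2, 0] (by simp [sameParity_iff]) (by simp) (by simp) (by simp)
  obtain ⟨v, hv, hv1⟩ := key ![2, 0, 2] (by simp [sameParity_iff]) (by simp) (by simp) (by simp)
  obtain ⟨w, hw, hw1⟩ := key ![0, 2, -2] (by simp [sameParity_iff]) (by simp) (by simp) (by simp)
  have hsub : halfPoint ![0, 2, -2] = halfPoint ![2, 2, 0] - halfPoint ![2, 0, 2] := by
    ext i
    fin_cases i <;> simp
  rw [hsub, map_sub, hu, hv] at hw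
  have hw2 : 4 • w = 4 • u - 4 • v := by
    apply halfPoint_injective
    rw [← hw]
    ext i
    simp
    ring
  have hw3 : ∀ i, w i = u i - v i := fun i => by
    have := congrFun hw2 i
    simp at this
    omega
  rw [hw3, hw3, hw3] at hw1
  have : 2 * (u 0 * v 0 + u 1 * v 1 + u 2 * v 2) = 1 := by linarith
  omega

/-- An affine equivalence between groups with odd subgroup `T₁` or `T₂` is an isometry. -/
theorem exists_isometry_of_affineConjugates {φ : E3 ≃ᵃ[ℝ] E3} {G H : Subgroup Isom3} {a b : Bool}
    (hG : oddSubgroup G = kindOdd a) (hH : oddSubgroup H = kindOdd b)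
    (h : AffineConjugates φ G H) :
    ∃ g : Isom3, g.toAffineEquiv = φ ∧ ∀ k ∈ G, g * k * g⁻¹ ∈ H := by
  have ho := h.odd
  rw [hG, hH] at ho
  have hab : a = b := by
    cases a <;> cases b
    · rfl
    · exact absurd (by simpa [kindOdd] using ho) (not_affineConjugates_T1_T2 φ)
    · exact absurd (by simpa [kindOdd] using ho.symm) (not_affineConjugates_T1_T2 φ.symm)
    · rfl
  subst hab
  have h1 := scale_ge ho
  have h2 := scale_ge ho.symm
  have h3 := scale_mul_scale ho
  have hpos : (0 : ℝ) < kindNorm a := by cases a <;> simp [kindNorm]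
  have hn := linear_norm_sq (T2_le_kindOdd a) ho.1
  have hκ : ‖φ.linear (EuclideanSpace.single 0 1)‖ ^ 2 = 1 := by
    generalize ‖φ.linear (EuclideanSpace.single 0 1)‖ ^ 2 = κ at *
    generalize ‖φ.symm.linear (EuclideanSpace.single 0 1)‖ ^ 2 = κ' at *
    -- Neither the map nor its inverse can shrink the shortest translations, so the scale is 1.
    have h4 : 1 ≤ κ := by nlinarith
    have h5 : 1 ≤ κ' := by nlinarith
    nlinarith
  let g : Isom3 := ⟨φ, fun x => by
    have := hn x
    rw [hκ, one_mul] at this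
    exact (sq_eq_sq₀ (norm_nonneg _) (norm_nonneg _)).1 this⟩
  refine ⟨g, rfl, fun k hk => ?_⟩
  obtain ⟨l, hl, hkl⟩ := h.1 k hk
  convert hl using 1
  rw [mul_inv_eq_iff_eq_mul]
  ext1 x
  exact (hkl x).symm

theorem not_affineConjugates {A B : IrreducibleName} (hAB : A ≠ B) (φ : E3 ≃ᵃ[ℝ] E3) :
    ¬ AffineConjugates φ (namedGroup A) (namedGroup B) := by
  have key : ∀ {A B : IrreducibleName} {φ : E3 ≃ᵃ[ℝ] E3},
      AffineConjugates φ (namedGroup A) (namedGroup B) → tableTest A B = true := by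
    intro A B φ h
    obtain ⟨g, -, hg⟩ := exists_isometry_of_affineConjugates (oddSubgroup_namedGroup A)
      (oddSubgroup_namedGroup B) h
    rw [← inclusionTest_eq_tableTest, ← included_iff]
    exact ⟨g, conjGroup_le_iff.2 hg⟩
  exact fun h => hAB (tableTest_antisymm A B (key h) (key h.symm))

/-! ### Enantiomorphous forms -/

theorem det_signedLin (σ : Equiv.Perm (Fin 3)) (ε : Fin 3 → ℤˣ) :
    LinearMap.det ((signedLin σ ε).toLinearEquiv : E3 →ₗ[ℝ] E3) =
      (((Equiv.Perm.sign σ * ∏ i, ε i : ℤˣ) : ℤ) : ℝ) := by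
  have hM : LinearMap.toMatrix (EuclideanSpace.basisFun (Fin 3) ℝ).toBasis
      (EuclideanSpace.basisFun (Fin 3) ℝ).toBasis ((signedLin σ ε).toLinearEquiv : E3 →ₗ[ℝ] E3) =
      Matrix.of fun i j => ((ε i : ℤ) : ℝ) * (1 : Matrix (Fin 3) (Fin 3) ℝ).submatrix σ id i j := by
    ext i j
    simp [LinearMap.toMatrix_apply, signedLin_apply, Matrix.one_apply]
  rw [← LinearMap.det_toMatrix (EuclideanSpace.basisFun (Fin 3) ℝ).toBasis, hM,
    Matrix.det_mul_column, Matrix.det_permute, Matrix.det_one]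
  push_cast
  ring

theorem mem_quarterGroup_of_induces {S : Subgroup (Equiv.Perm (Fin 4))} {g : Isom3}
    {s : SignedPerm} (h : Induces g s) : g ∈ quarterGroup S ↔ g ∈ lineGroup ∧ s.1 ∈ S := by
  constructor
  · rintro ⟨hl, t, ht, hgt⟩
    rw [h.unique hgt]
    exact ⟨hl, ht.1⟩
  · rintro ⟨hl, hs⟩
    exact ⟨hl, s, ⟨hs, trivial⟩, h⟩

theorem oddSubgroup_quarterGroup (S : Subgroup (Equiv.Perm (Fin 4))) :
    oddSubgroup (quarterGroup S) = kindOdd true := by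
  refine oddSubgroup_eq_kindOdd (fun g hg => ?_) inf_le_left
    (inf_le_right.trans (fullGroup_le_latticeAut _))
  obtain ⟨h1, h2⟩ := mem_kindOdd_iff.1 hg
  exact (mem_quarterGroup_of_induces h2).2 ⟨by simpa [kindGroup] using h1, one_mem _⟩

theorem mem_zpowers_swap (π : Equiv.Perm (Fin 4)) :
    π ∈ Subgroup.zpowers (Equiv.swap (0 : Fin 4) 3 * Equiv.swap 1 2) ↔
      π = 1 ∨ π = Equiv.swap 0 3 * Equiv.swap 1 2 := by
  constructor
  · rintro ⟨n, rfl⟩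
    have h2 : (Equiv.swap (0 : Fin 4) 3 * Equiv.swap 1 2) ^ (2 : ℤ) = 1 := by decide
    rcases Int.even_or_odd' n with ⟨m, rfl | rfl⟩
    · left
      simp only [zpow_mul, h2, one_zpow]
    · right
      simp only [zpow_add, zpow_mul, h2, one_zpow, one_mul, zpow_one]
  · rintro (rfl | rfl)
    · exact one_mem _
    · exact Subgroup.mem_zpowers _

/-- The inversion preserves the lines and induces `(13)`, which conjugates `(01)(23)` to `(03)(12)`.
-/
theorem enantiomorph_exists :
    ∃ g : Isom3, AffineConjugates g.toAffineEquiv (namedGroup (.quarter .p2))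
      (quarterGroup (Subgroup.zpowers (Equiv.swap 0 3 * Equiv.swap 1 2))) := by
  have hi := induces_inversion
  have hl := inversion_mem_lineGroup
  generalize signedIso 1 (-1) 0 = g at *
  have e1 : ∀ π ∈ dihedralElements .p2,
      affPerm (-1) 0 * π * (affPerm (-1) 0)⁻¹ = 1 ∨
      affPerm (-1) 0 * π * (affPerm (-1) 0)⁻¹ = Equiv.swap 0 3 * Equiv.swap 1 2 := by decide
  have e2 : ∀ π : Equiv.Perm (Fin 4), π = 1 ∨ π = Equiv.swap 0 3 * Equiv.swap 1 2 →
      (affPerm (-1) 0)⁻¹ * π * (affPerm (-1) 0)⁻¹⁻¹ ∈ dihedralElements .p2 := by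
    rintro π (rfl | rfl) <;> decide
  refine ⟨g, fun k hk => ⟨g * k * g⁻¹, ?_, fun x => ?_⟩,
    fun k hk => ⟨g⁻¹ * k * g⁻¹⁻¹, ?_, fun x => ?_⟩⟩
  · obtain ⟨hkl, s, hs, hks⟩ := hk
    rw [mem_quarterGroup_of_induces (induces_conj hi hks), mem_zpowers_swap]
    exact ⟨mul_mem (mul_mem hl hkl) (inv_mem hl), e1 _ hs.1⟩
  · change (g * k * g⁻¹) (g x) = g (k x)
    rw [AffineIsometryEquiv.coe_mul, AffineIsometryEquiv.coe_mul, Function.comp_apply,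
      Function.comp_apply, isom_inv_apply_self]
  · obtain ⟨hkl, s, hs, hks⟩ := hk
    refine (mem_quarterGroup_of_induces (induces_conj hi.inv hks)).2
      ⟨mul_mem (mul_mem (inv_mem hl) hkl) (inv_mem (inv_mem hl)), ?_⟩
    exact e2 _ ((mem_zpowers_swap _).1 hs.1)
  · change k (g x) = g ((g⁻¹ * k * g⁻¹⁻¹) x)
    rw [AffineIsometryEquiv.coe_mul, AffineIsometryEquiv.coe_mul, Function.comp_apply,
      Function.comp_apply, isom_apply_inv_self, inv_inv]

theorem enantiomorph_orientation {φ : E3 ≃ᵃ[ℝ] E3}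
    (h : AffineConjugates φ (namedGroup (.quarter .p2))
      (quarterGroup (Subgroup.zpowers (Equiv.swap 0 3 * Equiv.swap 1 2)))) :
    LinearMap.det (φ.linear : E3 →ₗ[ℝ] E3) < 0 := by
  obtain ⟨g, rfl, hg⟩ := exists_isometry_of_affineConjugates
    (oddSubgroup_namedGroup (.quarter .p2)) (oddSubgroup_quarterGroup _) h
  have hnorm : ∀ k ∈ T2, g * k * g⁻¹ ∈ T2 := by
    have h1 := conj_mem_oddSubgroup hg
    rw [oddSubgroup_namedGroup, oddSubgroup_quarterGroup] at h1
    simpa [kindOdd, isQuarter] using h1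
  have haut := mem_latticeAut_of_conj fun k hk => T2_le_T1 (hnorm k hk)
  have hline := mem_lineGroup_of_conj haut hnorm
  obtain ⟨σ, ε, T, hT, rfl⟩ := (mem_latticeAut_iff g).1 haut
  have hind := induces_signedIso (σ := σ) (ε := ε) hT
  have hsign := lineGroup_sign hline hind
  have hp2 : Equiv.swap (0 : Fin 4) 1 * Equiv.swap 2 3 ∈ dihedralElements .p2 := by decide
  have hsub : dihedralElements .p2 ⊆ dihedralElements .o8 := by decide
  obtain ⟨k, hk, hkind⟩ := exists_line_induces (hsub hp2)
  have hk2 := hg k ((mem_namedGroup_of_induces hkind).2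
    ⟨by simpa [kindGroup, isQuarter] using hk, hp2, rfl⟩)
  rw [mem_quarterGroup_of_induces (induces_conj hind hkind), mem_zpowers_swap] at hk2
  -- The even elements of the dihedral group commute with `(01)(23)`; only 4-cycles and
  -- transpositions can move it.
  have key : ∀ π ∈ dihedralElements .o8,
      π * (Equiv.swap 0 1 * Equiv.swap 2 3) * π⁻¹ = 1 ∨
      π * (Equiv.swap 0 1 * Equiv.swap 2 3) * π⁻¹ = Equiv.swap 0 3 * Equiv.swap 1 2 →
      Equiv.Perm.sign π = -1 := by decide
  have hodd := key _ hind.mem_dihedral hk2.2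
  have hpar : paritySign (T 0 + T 1 + T 2) = paritySign (T 0) := by
    have h1 := hT 0 1
    have h2 := hT 0 2
    have : (T 0 + T 1 + T 2) % 2 = T 0 % 2 := by omega
    simp [paritySign, this]
  simp only [inducedPerm] at hodd hsign
  rw [sign_affPerm, hpar] at hodd
  -- The determinant is the product of the signature of the colour permutation and the sign of the
  -- signed permutation, here `-1` and `+1`; the parity of `T 0` cancels.
  have hdet : Equiv.Perm.sign σ * ∏ i, ε i = -1 := by
    generalize ∏ i, ε i = p at *
    rcases Int.units_eq_one_or (paritySign (T 0)) with h | h <;> rw [h] at hodd hsign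
    · rw [mul_one] at hodd hsign
      rw [hodd, hsign, one_mul]
    · rw [mul_neg_one, neg_inj] at hodd
      rw [mul_neg_one, neg_eq_iff_eq_neg] at hsign
      rw [hodd, hsign, mul_one]
  have hlin : ((signedIso σ ε T).toAffineEquiv.linear : E3 →ₗ[ℝ] E3) =
      ((signedLin σ ε).toLinearEquiv : E3 →ₗ[ℝ] E3) := by
    rw [← signedIso_linear σ ε T]
    rfl
  rw [hlin, det_signedLin, hdet]
  norm_num

/-! ### The main theorem -/

theorem mainTheorem5 :
    -- the 35 groups are irreducible space groups with odd subgroup `T₁` or `T₂`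
    (Nat.card IrreducibleName = 35 ∧
      (∀ A, IsSpaceGroup (namedGroup A) ∧ IsIrreducibleGroup (namedGroup A)) ∧
      (∀ A, oddSubgroup (namedGroup A) = T1 ∨ oddSubgroup (namedGroup A) = T2)) ∧
    -- no two of them are affinely equivalent
    (∀ A B, A ≠ B → ∀ φ : E3 ≃ᵃ[ℝ] E3, ¬ AffineConjugates φ (namedGroup A) (namedGroup B)) ∧
    -- up to congruence, they are all the groups whose odd subgroup is `T₁` or `T₂`
    (∀ G : Subgroup Isom3, oddSubgroup G = T1 ∨ oddSubgroup G = T2 →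
      ∃ (A : IrreducibleName) (g : Isom3), conjGroup g (namedGroup A) = G) ∧
    -- there are exactly 83 minimal inclusions, `8 * 2 + 11 * 5 + 12`, and these are they
    {p : IrreducibleName × IrreducibleName | MinimalInclusion p.1 p.2}.ncard = 83 ∧
    (∀ A B, MinimalInclusion A B ↔ HeavyBox A B ∨ HeavyEdge A B ∨ ThinEdge A B) ∧
    {p : IrreducibleName × IrreducibleName | HeavyBox p.1 p.2}.ncard = 8 * 2 ∧
    {p : IrreducibleName × IrreducibleName | HeavyEdge p.1 p.2}.ncard = 11 * 5 ∧
    {p : IrreducibleName × IrreducibleName | ThinEdge p.1 p.2}.ncard = 12 ∧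
    -- `G/4` is of index 4 in `G`, which is of index 2 in `G:2`
    (∀ N : DihedralName,
      namedGroup (.quarter N) ≤ namedGroup (.full N) ∧
      (namedGroup (.quarter N)).relIndex (namedGroup (.full N)) = 4 ∧
      namedGroup (.full N) ≤ namedGroup (.double N) ∧
      (namedGroup (.full N)).relIndex (namedGroup (.double N)) = 2) ∧
    -- `Nⁱ ⊂ 2Nⁱʲ ⊂ 2Nʲ:2`, and the triple of `Nⁱ` is of index 2 in the triple of `2Nʲ`
    (∀ A B, HeavyEdge A B →
      namedGroup A ≤ namedGroup B ∧ (namedGroup A).relIndex (namedGroup B) = 2) ∧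
    -- the inclusions `Nⁱʲ ⊂ 2Nᵏˡ` are of index 2
    (∀ A B, ThinEdge A B → ∀ g : Isom3, conjGroup g (namedGroup A) ≤ namedGroup B →
      (conjGroup g (namedGroup A)).relIndex (namedGroup B) = 2) ∧
    -- the group `2⁺/4` has two enantiomorphous forms, from `(01)(23)` and from `(03)(12)`
    ((∃ g : Isom3, AffineConjugates g.toAffineEquiv (namedGroup (.quarter .p2))
        (quarterGroup (Subgroup.zpowers (Equiv.swap 0 3 * Equiv.swap 1 2)))) ∧
      ¬ ∃ φ : E3 ≃ᵃ[ℝ] E3, 0 < LinearMap.det (φ.linear : E3 →ₗ[ℝ] E3) ∧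
        AffineConjugates φ (namedGroup (.quarter .p2))
          (quarterGroup (Subgroup.zpowers (Equiv.swap 0 3 * Equiv.swap 1 2)))) := by
  refine ⟨⟨card_irreducibleName, fun A => ⟨isSpaceGroup_of_T2_le (T2_le_namedGroup A)
      (namedGroup_le_latticeAut A), isIrreducible_of_T2_le (T2_le_namedGroup A)⟩, fun A => ?_⟩,
    fun A B h φ => not_affineConjugates h φ, ?_, ?_, minimalInclusion_iff, ncard_heavyBox,
    ncard_heavyEdge, ncard_thinEdge,
    fun N => ⟨quarter_le_full N, quarter_relIndex N, full_le_double N⟩,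
    fun A B h => heavyEdge_relIndex h, fun A B h g hg => thinEdge_relIndex h hg,
    enantiomorph_exists, ?_⟩
  · rw [oddSubgroup_namedGroup]
    cases isQuarter A <;> simp [kindOdd]
  · rintro G (h | h)
    · exact exists_named_of_oddSubgroup (b := false) (by simpa [kindOdd] using h)
    · exact exists_named_of_oddSubgroup (b := true) (by simpa [kindOdd] using h)
  · simp only [minimalInclusion_iff]
    exact ncard_edges
  · rintro ⟨φ, hdet, h⟩
    exact absurd hdet (not_lt.2 (enantiomorph_orientation h).le)
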